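/- **Setting.** Let $(N,h)$ be an oriented real-analytic Riemannian $3$-manifold and $A$ a smooth nowhere zero one-form on $N$ satisfying the Beltrami fields equation $\mathrm dA+2*A=0$. Put $M=N\times(0,\infty)$, with $\rho$ the coordinate on $(0,\infty)$, and $$\theta=\rho\,\mathrm d\rho+A,\qquad g=\rho^2h+\rho^{-2}\theta^2,\qquad V=\rho^{-1}\tfrac{\partial}{\partial\rho}.$$ The horizontal lift of a tangent vector $S$ of $N$ is $\widetilde S=S-\rho^{-1}A(S)\tfrac{\partial}{\partial\rho}$ (so $\theta(\widetilde S)=0$). Let $E$ be a real-analytic vector field on $M$, written $E=fV+F$ with $f=\theta(E)$ and $F$ horizontal ($\theta(F)=0$). A vector field $E$ is a soliton flow with constant $a\in\mathbb R$ on an open subset of $M$ if $\mathrm{Ric}^M+a\,g+\tfrac12\mathcal L_Eg=0$ there. Let $U\subseteq N$ be open, let $\gamma=\{\rho\in\mathbb C:|\rho|=r\}$, $r>0$, and suppose that $E$ admits a complexification on a set containing $U\times\gamma$; that is, for each $p\in U$, the components of $E$ with respect to a real-analytic chart of $N$ around $p$ and to $\rho$ extend holomorphically to a neighbourhood of $\{p\}\times\gamma$.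 **Statement.** (1) There exist smooth functions $f_j$ and real-analytic vector fields $F_j$ on $U$ ($j\in\mathbb Z$) such that, locally on $U$ and for $\rho$ near $r$, $$f=\sum_{j=-\infty}^{\infty}\rho^jf_j,\qquad F=\sum_{j=-\infty}^{\infty}\rho^j\widetilde{F_j}.$$ (2) For all such Laurent expansions and every $a\in\mathbb R$, $E$ is a soliton flow with constant $a$ on $U\times(0,\infty)$ if and only if, at each point of $U$ and for each positive orthonormal frame $(X,Y,Z)$ there with $Z=|A|^{-1}A^\sharp$, writing $F_j=x_jX+y_jY+z_jZ$, the following relations hold: $$\begin{aligned} &(j-1)f_j+z_j|A|=0 &&(j\in\mathbb Z\setminus\{2\}),\\ &f_2+z_2|A|+a=0,\\ &X(f_j)+2y_j|A|+(j-2)x_{j-2}=0 &&(j\in\mathbb Z),\\ &Y(f_j)-2x_j|A|+(j-2)y_{j-2}=0 &&(j\in\mathbb Z),\\ &-(j+2)|A|f_{j+2}+Z(f_j)+(j-2)z_{j-2}=0 &&(j\in\mathbb Z),\\ &\mathcal L_{F_{j-2}}h-2j\,A\odot F_j^\flat+2(f_j-z_j|A|)h=0 &&(j\in\mathbb Z\setminus\{0,2\}),\\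 &\mathcal L_{F_{-2}}h+2\,\mathrm{Ric}^N+2(f_0-z_0|A|-2)h=0,\\ &\mathcal L_{F_0}h-4A\odot F_2^\flat+2(f_2-z_2|A|+a)h=0, \end{aligned}$$ where $(\alpha\odot\beta)(S,T)=\tfrac12\bigl(\alpha(S)\beta(T)+\alpha(T)\beta(S)\bigr)$. (3) If $A$ is real-analytic and $U$ meets every connected component of $N$, then these relations on $U$ hold if and only if $E$ is a soliton flow with constant $a$ on the whole of $(M,g)$. -/

import Mathlib

open scoped Manifold ContDiff Topology
open Bundle

noncomputable section

namespace BeltramiSoliton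

/-! ### Tensor calculus in an open subset of a vector space -/

section Coordinates

/-- The pull-back `(v, w) ↦ b (T v) (T w)` of a bilinear form `b` by a linear map `T`. -/
def pullBilin {V W : Type*} [AddCommGroup V] [Module ℝ V] [TopologicalSpace V]
    [AddCommGroup W] [Module ℝ W] [TopologicalSpace W]
    (b : W →L[ℝ] W →L[ℝ] ℝ) (T : V →L[ℝ] W) : V →L[ℝ] V →L[ℝ] ℝ :=
  (ContinuousLinearMap.precomp ℝ T).comp (b.comp T)

lemma pullBilin_apply {V W : Type*} [AddCommGroup V] [Module ℝ V] [TopologicalSpace V]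
    [AddCommGroup W] [Module ℝ W] [TopologicalSpace W]
    (b : W →L[ℝ] W →L[ℝ] ℝ) (T : V →L[ℝ] W) (v w : V) : pullBilin b T v w = b (T v) (T w) := rfl

variable {W : Type*} [NormedAddCommGroup W] [NormedSpace ℝ W]

/-- Christoffel symbols of the first kind of a metric `G` on a vector space, i.e. the covector
`z ↦ ½ (∂_v G(w, z) + ∂_w G(v, z) - ∂_z G(v, w))`. -/
def christoffelFirst (G : W → W →L[ℝ] W →L[ℝ] ℝ) (u v w : W) : W →L[ℝ] ℝ :=
  (1 / 2 : ℝ) • (fderiv ℝ G u v w + fderiv ℝ G u w v - ((fderiv ℝ G u).flip v).flip w)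

lemma christoffelFirst_apply (G : W → W →L[ℝ] W →L[ℝ] ℝ) (u v w z : W) :
    christoffelFirst G u v w z =
      (1 / 2) * (fderiv ℝ G u v w z + fderiv ℝ G u w v z - fderiv ℝ G u z v w) := by
  simp [christoffelFirst]

/-- The Christoffel symbols `Γ(v, w)` (the Levi-Civita derivative of the constant field `w` along
`v`), i.e. the vector dual, with respect to `G`, to the covector `christoffelFirst G u v w`. -/
def christoffel (G : W → W →L[ℝ] W →L[ℝ] ℝ) (u v w : W) : W :=
  (G u).inverse (christoffelFirst G u v w)

/-- The curvature tensor
`R(v, w)z = (∂_v Γ)(w, z) - (∂_w Γ)(v, z) + Γ(v, Γ(w, z)) - Γ(w, Γ(v, z))`. -/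
def curvature (G : W → W →L[ℝ] W →L[ℝ] ℝ) (u v w z : W) : W :=
  fderiv ℝ (fun u' ↦ christoffel G u' w z) u v - fderiv ℝ (fun u' ↦ christoffel G u' v z) u w
    + christoffel G u v (christoffel G u w z) - christoffel G u w (christoffel G u v z)

/-- The Ricci tensor `Ric(w, z) = tr (v ↦ R(v, w)z)`; the trace is computed in a basis. -/
def coordRicci [FiniteDimensional ℝ W] (G : W → W →L[ℝ] W →L[ℝ] ℝ) (u w z : W) : ℝ :=
  ∑ i, (Module.finBasis ℝ W).coord i (curvature G u (Module.finBasis ℝ W i) w z)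

/-- The Lie derivative of a covariant two-tensor `G` along a vector field `E`:
`(L_E G)(v, w) = (∂_E G)(v, w) + G(∂_v E, w) + G(v, ∂_w E)`. -/
def coordLie (E : W → W) (G : W → W →L[ℝ] W →L[ℝ] ℝ) (u v w : W) : ℝ :=
  fderiv ℝ G u (E u) v w + G u (fderiv ℝ E u v) w + G u v (fderiv ℝ E u w)

/-- The exterior derivative of a one-form: `dα(v, w) = (∂_v α)(w) - (∂_w α)(v)`. -/
def coordExtDeriv (α : W → W →L[ℝ] ℝ) (u v w : W) : ℝ :=
  fderiv ℝ α u v w - fderiv ℝ α u w v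

end Coordinates

/-! ### Tensor calculus on a manifold without boundary

The tensors at `x` are computed in the preferred chart at `x`, whose derivative at `x` is, in
Mathlib, the identity of the model space (`mfderiv_extChartAt_self`); so tangent vectors at `x` are
their own coordinate vectors. -/

section Manifold

variable {W : Type*} [NormedAddCommGroup W] [NormedSpace ℝ W] {H : Type*} [TopologicalSpace H]
  (I : ModelWithCorners ℝ W H) {M : Type*} [TopologicalSpace M] [ChartedSpace H M]

/-- The inverse of the chart at `x₀`, differentiated at the coordinate point `u`. -/
def chartFrame (x₀ : M) (u : W) : W →L[ℝ] TangentSpace I ((extChartAt I x₀).symm u) :=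
  mfderivWithin 𝓘(ℝ, W) I (extChartAt I x₀).symm (Set.range I) u

/-- Coordinate expression, in the chart at `x₀`, of a covariant two-tensor. -/
def chartBilin (g : ∀ x : M, TangentSpace I x →L[ℝ] TangentSpace I x →L[ℝ] ℝ) (x₀ : M) (u : W) :
    W →L[ℝ] W →L[ℝ] ℝ :=
  pullBilin (g ((extChartAt I x₀).symm u)) (chartFrame I x₀ u)

/-- Coordinate expression, in the chart at `x₀`, of a one-form. -/
def chartForm (α : ∀ x : M, TangentSpace I x →L[ℝ] ℝ) (x₀ : M) (u : W) : W →L[ℝ] ℝ :=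
  (α ((extChartAt I x₀).symm u)).comp (chartFrame I x₀ u)

/-- Coordinate expression, in the chart at `x₀`, of a vector field. -/
def chartField (E : ∀ x : M, TangentSpace I x) (x₀ : M) (u : W) : W :=
  (chartFrame I x₀ u).inverse (E ((extChartAt I x₀).symm u))

/-- The Ricci tensor of a Riemannian metric `g`. -/
def ricci [FiniteDimensional ℝ W] (g : ∀ x : M, TangentSpace I x →L[ℝ] TangentSpace I x →L[ℝ] ℝ) (x : M)
    (v w : TangentSpace I x) : ℝ :=
  coordRicci (chartBilin I g x) (extChartAt I x x) v w

/-- The Lie derivative `L_E g` of a covariant two-tensor `g`. -/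
def lieDeriv (E : ∀ x : M, TangentSpace I x)
    (g : ∀ x : M, TangentSpace I x →L[ℝ] TangentSpace I x →L[ℝ] ℝ) (x : M)
    (v w : TangentSpace I x) : ℝ :=
  coordLie (chartField I E x) (chartBilin I g x) (extChartAt I x x) v w

/-- The exterior derivative of a one-form. -/
def extDerivForm (α : ∀ x : M, TangentSpace I x →L[ℝ] ℝ) (x : M) (v w : TangentSpace I x) : ℝ :=
  coordExtDeriv (chartForm I α x) (extChartAt I x x) v w

/-- `E` satisfies the Ricci soliton equation `Ric + a g + ½ L_E g = 0` at the points of `S`. -/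
def IsSolitonFlowOn [FiniteDimensional ℝ W]
    (g : ∀ x : M, TangentSpace I x →L[ℝ] TangentSpace I x →L[ℝ] ℝ)
    (E : ∀ x : M, TangentSpace I x) (a : ℝ) (S : Set M) : Prop :=
  ∀ x ∈ S, ∀ v w : TangentSpace I x,
    ricci I g x v w + a * g x v w + (1 / 2) * lieDeriv I E g x v w = 0

end Manifold

/-! ### Oriented three-manifolds and Beltrami fields -/

/-- The model space `ℝ³`. -/
abbrev E3 : Type := EuclideanSpace ℝ (Fin 3)

section Three

variable {N : Type*} [TopologicalSpace N] [ChartedSpace E3 N]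

/-- The tangent space of the three-manifold `N` at `p`. -/
abbrev TN (p : N) : Type := TangentSpace 𝓘(ℝ, E3) p

variable (N) in
/-- An orientation of a three-manifold: an orientation of each tangent space, such that a basis
at `p` and its transports to nearby points, by the chart at `p`, have the same sign. -/
structure ManifoldOrientation where
  /-- The orientation of the tangent space at a point. -/
  at_point : ∀ p : N, Orientation ℝ (TN p) (Fin 3)
  locally_constant : ∀ p : N, ∀ᶠ q in 𝓝 p,
    ∀ (b : Module.Basis (Fin 3) ℝ (TN p)) (b' : Module.Basis (Fin 3) ℝ (TN q)),
      (∀ i, (mfderiv 𝓘(ℝ, E3) 𝓘(ℝ, E3) (extChartAt 𝓘(ℝ, E3) p) q (b' i) : E3) = b i) →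
        (b'.orientation = at_point q ↔ b.orientation = at_point p)

/-- A one-form on `N`, without regularity. -/
abbrev OneForm (N : Type*) [TopologicalSpace N] [ChartedSpace E3 N] : Type _ :=
  ∀ p : N, TN p →L[ℝ] ℝ

/-- The one-form `A` is of class `C^n`, as a section of the cotangent bundle. -/
def OneForm.IsContMDiff (n : WithTop ℕ∞) (A : OneForm N) [IsManifold 𝓘(ℝ, E3) ω N] : Prop :=
  ContMDiff 𝓘(ℝ, E3) (𝓘(ℝ, E3).prod 𝓘(ℝ, E3 →L[ℝ] ℝ)) n
    (fun p : N ↦ (TotalSpace.mk' (E3 →L[ℝ] ℝ)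
      (E := fun p : N ↦ (TN p →L[ℝ] Bundle.Trivial N ℝ p)) p (A p)))

/-- A real-analytic Riemannian metric on `N`. -/
abbrev AnalyticMetric (N : Type*) [TopologicalSpace N] [ChartedSpace E3 N]
    [IsManifold 𝓘(ℝ, E3) ω N] : Type _ :=
  ContMDiffRiemannianMetric 𝓘(ℝ, E3) ω E3 (fun p : N ↦ TN p)

variable [IsManifold 𝓘(ℝ, E3) ω N]

/-- `e` is an `h`-orthonormal, positively oriented basis of the tangent space at `p`. -/
def IsPositiveOrthonormal (h : AnalyticMetric N) (o : ManifoldOrientation N) {p : N}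
    (e : Module.Basis (Fin 3) ℝ (TN p)) : Prop :=
  (∀ i j, h.inner p (e i) (e j) = if i = j then 1 else 0) ∧ e.orientation = o.at_point p

/-- The alternating form `β` at `p` is the Hodge dual `*α` of the covector `α`, i.e.
`β(e₀, e₁) = α(e₂)` for all positive orthonormal bases. -/
def IsHodgeDual (h : AnalyticMetric N) (o : ManifoldOrientation N) (p : N)
    (α : TN p →L[ℝ] ℝ) (β : TN p → TN p → ℝ) : Prop :=
  ∀ e : Module.Basis (Fin 3) ℝ (TN p), IsPositiveOrthonormal h o e → β (e 0) (e 1) = α (e 2)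

/-- `A` is a smooth nowhere zero one-form satisfying the Beltrami fields equation `dA = -2 * A`,
where `*` is the Hodge star operator. -/
structure IsBeltramiField (h : AnalyticMetric N) (o : ManifoldOrientation N)
    (A : OneForm N) : Prop where
  smooth : OneForm.IsContMDiff ∞ A
  ne_zero : ∀ p, A p ≠ 0
  beltrami : ∀ p, IsHodgeDual h o p (-(2 : ℝ) • A p) (extDerivForm 𝓘(ℝ, E3) A p)

/-- The vector `A♯` dual to `A`, with respect to `h`. -/
def sharp (h : AnalyticMetric N) (A : OneForm N) (p : N) : TN p :=
  (h.inner p).inverse (A p)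

/-- The pointwise norm `|A|`, with respect to `h`. -/
def formNorm (h : AnalyticMetric N) (A : OneForm N) (p : N) : ℝ :=
  Real.sqrt (h.inner p (sharp h A p) (sharp h A p))

/-- `e = (X, Y, Z)` is a positive orthonormal basis at `p`, with `Z = A♯ / |A|`. -/
def IsAdaptedFrame (h : AnalyticMetric N) (o : ManifoldOrientation N) (A : OneForm N) {p : N}
    (e : Module.Basis (Fin 3) ℝ (TN p)) : Prop :=
  IsPositiveOrthonormal h o e ∧ e 2 = (formNorm h A p)⁻¹ • sharp h A p

end Three

/-! ### The Beltrami fields construction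

The manifold `M = N × (0, ∞)` is the open subset `{0 < ρ}` of `N × ℝ`; the values, where `ρ ≤ 0`,
of the objects below are irrelevant. -/

section Construction

variable {N : Type*} [TopologicalSpace N] [ChartedSpace E3 N]

/-- The model with corners of the four-manifold `N × ℝ`. -/
abbrev J : ModelWithCorners ℝ (E3 × ℝ) (ModelProd E3 ℝ) := 𝓘(ℝ, E3).prod 𝓘(ℝ, ℝ)

/-- The tangent space of `N × ℝ` at `x`. -/
abbrev TM (x : N × ℝ) : Type := TangentSpace J x

/-- The open subset `U × (0, ∞)` of `M`, as a subset of `N × ℝ`. -/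
def cylinder (U : Set N) : Set (N × ℝ) := {x | x.1 ∈ U ∧ 0 < x.2}

/-- The differential of the projection `φ : M → N`. -/
def dproj (x : N × ℝ) : TM x →L[ℝ] TN x.1 := mfderiv J 𝓘(ℝ, E3) Prod.fst x

/-- The one-form `dρ` on `M`. -/
def drho (x : N × ℝ) : TM x →L[ℝ] ℝ :=
  (NormedSpace.fromTangentSpace (𝕜 := ℝ) x.2).toContinuousLinearMap.comp
    (mfderiv J 𝓘(ℝ, ℝ) Prod.snd x)

/-- The tangent vector `v + c ∂/∂ρ` at `(p, ρ)`. -/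
def mkTangent (x : N × ℝ) (v : TN x.1) (c : ℝ) : TM x :=
  show E3 × ℝ from ((show E3 from v), c)

/-- The one-form `θ = ρ dρ + A` on `M`. -/
def theta (A : OneForm N) (x : N × ℝ) : TM x →L[ℝ] ℝ :=
  x.2 • drho x + (A x.1).comp (dproj x)

/-- The metric `g = ρ² h + ρ⁻² (ρ dρ + A)²`. -/
def beltramiMetric [IsManifold 𝓘(ℝ, E3) ω N] (h : AnalyticMetric N) (A : OneForm N)
    (x : N × ℝ) : TM x →L[ℝ] TM x →L[ℝ] ℝ :=
  x.2 ^ 2 • pullBilin (h.inner x.1) (dproj x) +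
    (x.2 ^ 2)⁻¹ • (theta A x).smulRight (theta A x)

/-- The fundamental vertical vector field `V = ρ⁻¹ ∂/∂ρ`. -/
def fundamentalField (x : N × ℝ) : TM x := mkTangent x 0 x.2⁻¹

/-- The horizontal lift `v - ρ⁻¹ A(v) ∂/∂ρ` of `v`: it is projected to `v`, and `θ` vanishes
on it. -/
def horizontalLift (A : OneForm N) (x : N × ℝ) (v : TN x.1) : TM x :=
  mkTangent x v (-(A x.1 v) * x.2⁻¹)

/-- The function `f` in the decomposition `E = f V + F`, with `F` horizontal (`θ(F) = 0`). -/
def verticalPart (A : OneForm N) (E : ∀ x : N × ℝ, TM x) (x : N × ℝ) : ℝ :=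
  theta A x (E x)

/-- The horizontal vector field `F` in the decomposition `E = f V + F`. -/
def horizontalPart (A : OneForm N) (E : ∀ x : N × ℝ, TM x) (x : N × ℝ) : TM x :=
  E x - verticalPart A E x • fundamentalField x

lemma dproj_mkTangent (x : N × ℝ) (v : TN x.1) (c : ℝ) : dproj x (mkTangent x v c) = v := by
  simp only [dproj, mfderiv_fst]
  rfl

lemma drho_mkTangent (x : N × ℝ) (v : TN x.1) (c : ℝ) : drho x (mkTangent x v c) = c := by
  simp only [drho, mfderiv_snd]
  rfl

lemma theta_horizontalLift (A : OneForm N) (x : N × ℝ) (hx : 0 < x.2) (v : TN x.1) :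
    theta A x (horizontalLift A x v) = 0 := by
  simp only [theta, horizontalLift, add_apply, smul_apply,
    ContinuousLinearMap.comp_apply, dproj_mkTangent, drho_mkTangent, smul_eq_mul]
  field_simp
  ring

/-- The inclusion of `ℝ³ × ℝ` in its complexification. -/
def toComplex (w : E3 × ℝ) : (Fin 3 → ℂ) × ℂ := (fun i ↦ (w.1 i : ℂ), (w.2 : ℂ))

/-- The vector field `E` on `M` admits a complexification on a set containing `U × γ`, where `γ` is
the circle of radius `r` centred at `0` in the complex plane: near `{p} × γ`, for each `p ∈ U`, the
components of `E`, in the coordinates given by the chart of `N` at `p` and by `ρ`, admit a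
holomorphic extension. (Charts of `N` extend to holomorphic charts of its complexification;
as `{p} × γ` has a basis of neighbourhoods of the form ball times annulus, these extensions are
locally unique, and together they are a complexification of `E` along `U × γ`.) -/
def ComplexifiesAlong (E : ∀ x : N × ℝ, TM x) (U : Set N) (r : ℝ) : Prop :=
  ∀ p ∈ U, ∃ (D : Set ((Fin 3 → ℂ) × ℂ)) (Φ : (Fin 3 → ℂ) × ℂ → (Fin 3 → ℂ) × ℂ),
    IsOpen D ∧
    (∀ ζ ∈ Metric.sphere (0 : ℂ) r, ((toComplex (extChartAt J (p, r) (p, r))).1, ζ) ∈ D) ∧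
    DifferentiableOn ℂ Φ D ∧
    ∀ w ∈ (extChartAt J (p, r)).target, 0 < w.2 → toComplex w ∈ D →
      Φ (toComplex w) = toComplex (chartField J E (p, r) w)

/-- On `U`, near `ρ = r`, there are the Laurent series expansions `f = ∑ ρʲ fⱼ` and `F = ∑ ρʲ F̃ⱼ`,
`j ∈ ℤ`, where `F̃ⱼ` is the horizontal lift of `Fⱼ`, and `E = f V + F` with `F` horizontal. -/
def IsLaurentExpansion (A : OneForm N) (E : ∀ x : N × ℝ, TM x) (U : Set N) (r : ℝ)
    (f : ℤ → N → ℝ) (F : ℤ → ∀ p : N, TN p) : Prop :=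
  ∀ p ∈ U, ∃ ε > 0, ∀ᶠ q in 𝓝 p, ∀ ρ : ℝ, |ρ - r| < ε →
    HasSum (fun j : ℤ ↦ ρ ^ j * f j q) (verticalPart A E (q, ρ)) ∧
    HasSum (fun j : ℤ ↦ ρ ^ j • horizontalLift A (q, ρ) (F j q)) (horizontalPart A E (q, ρ))

/-- The value on `(v, w)` of the symmetric product `A ⊙ X♭`. -/
def symProd [IsManifold 𝓘(ℝ, E3) ω N] (h : AnalyticMetric N) (A : OneForm N) (p : N)
    (X v w : TN p) : ℝ :=
  (1 / 2) * (A p v * h.inner p X w + A p w * h.inner p X v)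

/-- The derivative `X(f)` of a function `f` on `N`, for a tangent vector `X` at `p`. -/
def dirDeriv (f : N → ℝ) (p : N) (X : TN p) : ℝ :=
  NormedSpace.fromTangentSpace (𝕜 := ℝ) (f p) (mfderiv 𝓘(ℝ, E3) 𝓘(ℝ, ℝ) f p X)

/-- The relations among the coefficients at the point `p`, with respect to the frame
`e = (X, Y, Z)`; here `x j`, `y j`, `z j` are the components of `F j` and `nA` is `|A|`. -/
structure LaurentRelationsAt [IsManifold 𝓘(ℝ, E3) ω N] (h : AnalyticMetric N) (A : OneForm N)
    (a : ℝ) (f : ℤ → N → ℝ) (F : ℤ → ∀ p : N, TN p) (p : N) (nA : ℝ) (X Y Z : TN p)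
    (x y z : ℤ → ℝ) : Prop where
  rel₁ : ∀ j : ℤ, j ≠ 2 → ((j : ℝ) - 1) * f j p + z j * nA = 0
  rel₂ : f 2 p + z 2 * nA + a = 0
  rel₃ : ∀ j : ℤ, dirDeriv (f j) p X + 2 * y j * nA
    + ((j : ℝ) - 2) * x (j - 2) = 0
  rel₄ : ∀ j : ℤ, dirDeriv (f j) p Y - 2 * x j * nA
    + ((j : ℝ) - 2) * y (j - 2) = 0
  rel₅ : ∀ j : ℤ, -((j : ℝ) + 2) * nA * f (j + 2) p
    + dirDeriv (f j) p Z + ((j : ℝ) - 2) * z (j - 2) = 0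
  rel₆ : ∀ j : ℤ, j ≠ 0 → j ≠ 2 → ∀ v w : TN p,
    lieDeriv 𝓘(ℝ, E3) (F (j - 2)) h.inner p v w - 2 * (j : ℝ) * symProd h A p (F j p) v w
      + 2 * (f j p - z j * nA) * h.inner p v w = 0
  rel₇ : ∀ v w : TN p,
    lieDeriv 𝓘(ℝ, E3) (F (-2)) h.inner p v w + 2 * ricci 𝓘(ℝ, E3) h.inner p v w
      + 2 * (f 0 p - z 0 * nA - 2) * h.inner p v w = 0
  rel₈ : ∀ v w : TN p,
    lieDeriv 𝓘(ℝ, E3) (F 0) h.inner p v w - 4 * symProd h A p (F 2 p) v w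
      + 2 * (f 2 p - z 2 * nA + a) * h.inner p v w = 0

/-- The relations among the Laurent coefficients, at all points of `U` and with respect to all
frames `(X, Y, Z)` adapted to `A`, where `F j = x j X + y j Y + z j Z`. -/
def LaurentRelations [IsManifold 𝓘(ℝ, E3) ω N] (h : AnalyticMetric N) (o : ManifoldOrientation N)
    (A : OneForm N) (a : ℝ) (f : ℤ → N → ℝ) (F : ℤ → ∀ p : N, TN p) (U : Set N) : Prop :=
  ∀ p ∈ U, ∀ e : Module.Basis (Fin 3) ℝ (TN p), IsAdaptedFrame h o A e →
    LaurentRelationsAt h A a f F p (formNorm h A p) (e 0) (e 1) (e 2)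
      (fun j ↦ e.repr (F j p) 0) (fun j ↦ e.repr (F j p) 1) (fun j ↦ e.repr (F j p) 2)

end Construction

end BeltramiSoliton

end

set_option maxSynthPendingDepth 3
set_option linter.unusedSectionVars false

noncomputable section

namespace BeltramiSoliton

/-! ### Christoffel symbols as connection forms; curvature under changes of coordinates and frame.
-/

section ConnectionForms

variable {W W' X : Type*} [NormedAddCommGroup W] [NormedSpace ℝ W] [NormedAddCommGroup W']
  [NormedSpace ℝ W'] [NormedAddCommGroup X] [NormedSpace ℝ X]

/-! The geometric input is that $\mathrm{Ric}^M$ is the pull-back of $\mathrm{Ric}^N-2h$. In the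
frame formed by the horizontal lifts and $V$, the Levi-Civita connection of $g$ is that of $h$ plus
a tensor $T$ made of $\rho$, $h$, $A$, $A^\sharp$ and the endomorphism $K=*A$. Its curvature is
therefore that of $h$, plus the antisymmetrised $\nabla T$, plus the commutator of $T$ with itself
(`curvForm_frameConn`). Taking the trace leaves an algebraic identity at one point (`frame_trace`,
`coordRicci_liftMetric`), for which three facts about $\nabla A$ suffice: its skew part is given by
$dA=-2*A$, it determines $\nabla K$, and it is trace free because $d(dA)=0$.

The soliton equation then splits, along vertical and horizontal directions, into a scalar, a
covector and a bilinear equation (`soliton_iff`). These are affine in $f=\theta(E)$, in the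
projection of $E$ to $N$ and in their first derivatives, with coefficients that are powers of $\rho$
times tensors of $N$. Insert the Laurent series: $\rho\,\partial/\partial\rho$ multiplies the $j$-th
coefficient by $j$, a power of $\rho$ shifts the index, and the coefficients of $\rho^j$ are the
stated relations (`laurentRelationsAt_iff`). A Laurent series that vanishes for real $\rho$ near $r$
has zero coefficients (`eq_zero_of_hasSum_zpow`). Conversely, vanishing near $r$ propagates to all
$\rho>0$, since above a fixed point of $N$ the equations are analytic in $\rho$
(`soliton_iff_coeff`); smoothness of $A$ is enough for this.

The series exist because Laurent coefficients are Fourier coefficients on circles. To get analytic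
dependence on the point of $N$, and to differentiate termwise along $N$, the complexified field is
regarded as a map from the base to the Banach space of continuous functions on a closed annulus.
Cauchy's formula in polydiscs makes this map analytic (`contDiffAt_of_eval_differentiableOn`), and
its coefficients are continuous linear functionals of it (`exists_laurent_expansion`). Uniqueness of
the coefficients makes the local expansions agree. The $F_j$ inherit analyticity, whereas $f_j$
involves $A$ and is only as regular as $A$.

If $A$ is analytic, the soliton tensor is analytic on $M$, and the set of points of $N$ around which
it vanishes is open and closed (`forall_isSolitonAt_of_connectedComponent`). -/

/-- The linear map that sends `T(v, w, z)`, the derivative of a metric, to the Christoffel symbols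
of the first kind. -/
def christoffelOp (W : Type*) [NormedAddCommGroup W] [NormedSpace ℝ W] :
    (W →L[ℝ] W →L[ℝ] W →L[ℝ] ℝ) →L[ℝ] (W →L[ℝ] W →L[ℝ] W →L[ℝ] ℝ) :=
  let flip₁₂ : (W →L[ℝ] W →L[ℝ] W →L[ℝ] ℝ) →L[ℝ] (W →L[ℝ] W →L[ℝ] W →L[ℝ] ℝ) :=
    (ContinuousLinearMap.flipₗᵢ ℝ W W (W →L[ℝ] ℝ)).toContinuousLinearEquiv.toContinuousLinearMap
  let flip₂₃ : (W →L[ℝ] W →L[ℝ] W →L[ℝ] ℝ) →L[ℝ] (W →L[ℝ] W →L[ℝ] W →L[ℝ] ℝ) :=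
    ContinuousLinearMap.compL ℝ W _ _
      (ContinuousLinearMap.flipₗᵢ ℝ W W ℝ).toContinuousLinearEquiv.toContinuousLinearMap
  (1 / 2 : ℝ) • (ContinuousLinearMap.id ℝ _ + flip₁₂ - flip₂₃.comp flip₁₂)

/-- The Christoffel symbols as a bilinear map. -/
def christoffelL (G : W → W →L[ℝ] W →L[ℝ] ℝ) (u : W) : W →L[ℝ] W →L[ℝ] W :=
  (ContinuousLinearMap.compL ℝ W _ _ ((G u).inverse)).comp (christoffelOp W (fderiv ℝ G u))

lemma christoffelL_apply (G : W → W →L[ℝ] W →L[ℝ] ℝ) (u v w : W) :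
    christoffelL G u v w = christoffel G u v w := by
  simp only [christoffelL, christoffel, ContinuousLinearMap.comp_apply,
    ContinuousLinearMap.compL_apply]
  congr 1

lemma christoffel_eq_iff {G : W → W →L[ℝ] W →L[ℝ] ℝ} {u : W} (hG : (G u).IsInvertible)
    {v w x : W} : christoffel G u v w = x ↔ ∀ z, G u x z = christoffelFirst G u v w z := by
  obtain ⟨e, he⟩ := hG
  rw [christoffel, ← he, ContinuousLinearMap.inverse_equiv]
  constructor
  · rintro rfl z
    simp
  · intro hz
    have : e x = christoffelFirst G u v w := ContinuousLinearMap.ext hz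
    simp [← this]

lemma apply_christoffel {G : W → W →L[ℝ] W →L[ℝ] ℝ} {u : W} (hG : (G u).IsInvertible)
    (v w z : W) : G u (christoffel G u v w) z = christoffelFirst G u v w z :=
  (christoffel_eq_iff hG).1 rfl z

lemma fderiv_bilin_symm {G : W → W →L[ℝ] W →L[ℝ] ℝ} {u : W} (hG : DifferentiableAt ℝ G u)
    (hs : ∀ᶠ u' in 𝓝 u, ∀ v w, G u' v w = G u' w v) (x v w : W) :
    fderiv ℝ G u x v w = fderiv ℝ G u x w v := by
  have h1 : ∀ v w : W, HasFDerivAt (fun u' ↦ G u' v w)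
      (((ContinuousLinearMap.apply ℝ ℝ w).comp (ContinuousLinearMap.apply ℝ (W →L[ℝ] ℝ) v)).comp
        (fderiv ℝ G u)) u := fun v w ↦
    (((ContinuousLinearMap.apply ℝ ℝ w).comp
      (ContinuousLinearMap.apply ℝ (W →L[ℝ] ℝ) v)).hasFDerivAt).comp u hG.hasFDerivAt
  have h3 := (h1 w v).congr_of_eventuallyEq
    (f₁ := fun u' ↦ G u' v w) (by filter_upwards [hs] with u' hu' using hu' v w)
  exact DFunLike.congr_fun ((h1 v w).unique h3) x

lemma christoffel_symm {G : W → W →L[ℝ] W →L[ℝ] ℝ} {u : W} (hG : DifferentiableAt ℝ G u)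
    (hs : ∀ᶠ u' in 𝓝 u, ∀ v w, G u' v w = G u' w v) (v w : W) :
    christoffel G u v w = christoffel G u w v := by
  unfold christoffel
  congr 1
  ext z
  rw [christoffelFirst_apply, christoffelFirst_apply, fderiv_bilin_symm hG hs z v w]
  ring

/-- The Levi-Civita connection is metric. -/
lemma fderiv_metric {G : W → W →L[ℝ] W →L[ℝ] ℝ} {u : W} (hG : DifferentiableAt ℝ G u)
    (hs : ∀ᶠ u' in 𝓝 u, ∀ v w, G u' v w = G u' w v) (hi : (G u).IsInvertible) (x v w : W) :
    fderiv ℝ G u x v w = G u (christoffel G u x v) w + G u v (christoffel G u x w) := by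
  rw [hs.self_of_nhds v, apply_christoffel hi, apply_christoffel hi, christoffelFirst_apply,
    christoffelFirst_apply, fderiv_bilin_symm hG hs x w v, fderiv_bilin_symm hG hs v x w,
    fderiv_bilin_symm hG hs w x v]
  ring

/-- The condition `n + 1 ≤ n` singles out the classes `∞` and `ω`, for which taking a derivative
costs no regularity. -/
lemma contDiffAt_christoffelL [CompleteSpace W] {n : WithTop ℕ∞} (hn : n + 1 ≤ n)
    {G : W → W →L[ℝ] W →L[ℝ] ℝ} {u : W} (hG : ContDiffAt ℝ n G u) (hi : (G u).IsInvertible) :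
    ContDiffAt ℝ n (christoffelL G) u := by
  have h1 : ContDiffAt ℝ n (fun u' ↦ christoffelOp W (fderiv ℝ G u')) u :=
    (hG.fderiv_right hn).continuousLinearMap_comp (christoffelOp W)
  have h2 : ContDiffAt ℝ n (fun u' ↦ (G u').inverse) u :=
    (hi.contDiffAt_map_inverse).comp u hG
  exact (h2.continuousLinearMap_comp (ContinuousLinearMap.compL ℝ W _ _)).clm_comp h1

/-- The curvature of the connection form `conn` of a connection on a trivial bundle. -/
def curvForm (conn : W → W →L[ℝ] X →L[ℝ] X) (u x y : W) (s : X) : X :=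
  fderiv ℝ conn u x y s - fderiv ℝ conn u y x s + conn u x (conn u y s) - conn u y (conn u x s)

lemma fderiv_clm_apply₂ {F : Type*} [NormedAddCommGroup F] [NormedSpace ℝ F]
    {conn : W → W' →L[ℝ] X →L[ℝ] F} {u : W}
    (hω : DifferentiableAt ℝ conn u) (x : W) (y : W') (s : X) :
    fderiv ℝ (fun u' ↦ conn u' y s) u x = fderiv ℝ conn u x y s := by
  have h1 : HasFDerivAt (fun u' ↦ conn u' y s)
      (((ContinuousLinearMap.apply ℝ F s).comp (ContinuousLinearMap.apply ℝ (X →L[ℝ] F) y)).comp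
        (fderiv ℝ conn u)) u :=
    (((ContinuousLinearMap.apply ℝ F s).comp
      (ContinuousLinearMap.apply ℝ (X →L[ℝ] F) y)).hasFDerivAt).comp u hω.hasFDerivAt
  rw [h1.fderiv]
  rfl

lemma curvature_eq_curvForm {G : W → W →L[ℝ] W →L[ℝ] ℝ} {u : W}
    (hG : DifferentiableAt ℝ (christoffelL G) u) (v w z : W) :
    curvature G u v w z = curvForm (christoffelL G) u v w z := by
  simp only [curvature, curvForm, ← christoffelL_apply]
  rw [fderiv_clm_apply₂ hG, fderiv_clm_apply₂ hG]

/-- The curvature of a connection after a change of coordinates `φ` and a change of frame `P`. -/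
lemma curvForm_gauge {conn : W' → W' →L[ℝ] X →L[ℝ] X} {Γ : W → W →L[ℝ] W →L[ℝ] W}
    {φ : W' → W} {P : W' → X →L[ℝ] W} {u : W'}
    (hφ : ContDiffAt ℝ 2 φ u) (hP : ContDiffAt ℝ 2 P u)
    (hω : DifferentiableAt ℝ conn u) (hΓ : DifferentiableAt ℝ Γ (φ u))
    (h : ∀ᶠ u' in 𝓝 u, ∀ x s, P u' (conn u' x s) =
      Γ (φ u') (fderiv ℝ φ u' x) (P u' s) + fderiv ℝ P u' x s) (x y : W') (s : X) :
    P u (curvForm conn u x y s) = curvForm Γ (φ u) (fderiv ℝ φ u x) (fderiv ℝ φ u y) (P u s) := by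
  have hφ' : DifferentiableAt ℝ (fderiv ℝ φ) u :=
    (hφ.fderiv_right (m := 1) (by norm_num)).differentiableAt (by norm_num)
  have hP' : DifferentiableAt ℝ (fderiv ℝ P) u :=
    (hP.fderiv_right (m := 1) (by norm_num)).differentiableAt (by norm_num)
  have hφ0 : DifferentiableAt ℝ φ u := hφ.differentiableAt (by norm_num)
  have hP0 : DifferentiableAt ℝ P u := hP.differentiableAt (by norm_num)
  -- Differentiate the gauge relation in the direction `y`. Exchanging `x` and `y` and subtracting
  -- removes the second derivatives of `φ` and `P`, which are symmetric; the remaining first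
  -- derivatives of `P` are eliminated by the relation itself.
  have key : ∀ x y : W', fderiv ℝ P u y (conn u x s) + P u (fderiv ℝ conn u y x s) =
      fderiv ℝ Γ (φ u) (fderiv ℝ φ u y) (fderiv ℝ φ u x) (P u s) +
      Γ (φ u) (fderiv ℝ (fderiv ℝ φ) u y x) (P u s) + Γ (φ u) (fderiv ℝ φ u x) (fderiv ℝ P u y s)
      + fderiv ℝ (fderiv ℝ P) u y x s := by
    intro x y
    have hωx : HasFDerivAt (fun u' ↦ conn u' x s) _ u :=
      (hω.hasFDerivAt.clm_apply (hasFDerivAt_const x u)).clm_apply (hasFDerivAt_const s u)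
    have h1 : HasFDerivAt (fun u' ↦ P u' (conn u' x s)) _ u := hP0.hasFDerivAt.clm_apply hωx
    have h2 : HasFDerivAt (fun u' ↦ Γ (φ u') (fderiv ℝ φ u' x) (P u' s) + fderiv ℝ P u' x s) _ u :=
      (((hΓ.hasFDerivAt.comp u hφ0.hasFDerivAt).clm_apply
        (hφ'.hasFDerivAt.clm_apply (hasFDerivAt_const x u))).clm_apply
        (hP0.hasFDerivAt.clm_apply (hasFDerivAt_const s u))).add
        ((hP'.hasFDerivAt.clm_apply (hasFDerivAt_const x u)).clm_apply (hasFDerivAt_const s u))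
    have h3 := h1.unique (h2.congr_of_eventuallyEq (by
      filter_upwards [h] with u' hu' using hu' x s))
    have h4 := DFunLike.congr_fun h3 y
    simp at h4
    rw [add_comm, h4]
    abel
  have hs1 : fderiv ℝ (fderiv ℝ φ) u x y = fderiv ℝ (fderiv ℝ φ) u y x :=
    (hφ.isSymmSndFDerivAt (by simp)) x y
  have hs2 : fderiv ℝ (fderiv ℝ P) u x y = fderiv ℝ (fderiv ℝ P) u y x :=
    (hP.isSymmSndFDerivAt (by simp)) x y
  have e1 := key x y
  have e2 := key y x
  have h0 := h.self_of_nhds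
  have e3 := h0 x (conn u y s)
  have e4 := h0 y (conn u x s)
  rw [h0 y s, map_add] at e3
  rw [h0 x s, map_add] at e4
  rw [hs1, hs2] at e2
  simp only [curvForm, map_add, map_sub]
  rw [e3, e4, ← sub_eq_zero]
  linear_combination (norm := module) e2 - e1

end ConnectionForms
end BeltramiSoliton

namespace BeltramiSoliton

lemma two_le_infty : (2 : WithTop ℕ∞) ≤ ∞ := WithTop.coe_le_coe.2 (le_top : (2 : ℕ∞) ≤ ⊤)

lemma one_le_infty : (1 : WithTop ℕ∞) ≤ ∞ := WithTop.coe_le_coe.2 (le_top : (1 : ℕ∞) ≤ ⊤)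

/-! ### Invariance of the Ricci tensor, the Lie derivative and the exterior derivative under changes
of coordinates. -/

section Covariance

variable {W : Type*} [NormedAddCommGroup W] [NormedSpace ℝ W]

lemma isInvertible_of_nondegenerate [FiniteDimensional ℝ W] {b : W →L[ℝ] W →L[ℝ] ℝ}
    (hb : ∀ v, (∀ w, b v w = 0) → v = 0) : b.IsInvertible := by
  have hinj : Function.Injective (b : W →ₗ[ℝ] W →L[ℝ] ℝ) := by
    rw [← LinearMap.ker_eq_bot, LinearMap.ker_eq_bot']
    intro v hv
    exact hb v fun w ↦ DFunLike.congr_fun hv w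
  have hdim : Module.finrank ℝ W = Module.finrank ℝ (W →L[ℝ] ℝ) := by
    rw [(LinearMap.toContinuousLinearMap (𝕜 := ℝ) (E := W) (F' := ℝ)).symm.finrank_eq]
    exact (Subspace.dual_finrank_eq (K := ℝ) (V := W)).symm
  refine ⟨(LinearEquiv.ofInjectiveOfFinrankEq _ hinj hdim).toContinuousLinearEquiv, ?_⟩
  ext v w
  rfl

lemma eq_zero_of_isInvertible {b : W →L[ℝ] W →L[ℝ] ℝ} (hb : b.IsInvertible) {v : W}
    (hv : ∀ w, b v w = 0) : v = 0 := by
  obtain ⟨e, rfl⟩ := hb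
  exact (map_eq_zero_iff e e.injective).1 (ContinuousLinearMap.ext hv)

lemma isInvertible_pullBilin [FiniteDimensional ℝ W] {b : W →L[ℝ] W →L[ℝ] ℝ} {T : W →L[ℝ] W}
    (hb : b.IsInvertible) (hT : T.IsInvertible) : (pullBilin b T).IsInvertible := by
  apply isInvertible_of_nondegenerate
  intro v hv
  obtain ⟨e, rfl⟩ := hT
  have : e v = 0 := eq_zero_of_isInvertible hb fun w ↦ by
    simpa [pullBilin_apply] using hv (e.symm w)
  simpa using this

lemma hasFDerivAt_pullBilin {G : W → W →L[ℝ] W →L[ℝ] ℝ} {φ : W → W} {P : W → W →L[ℝ] W} {u : W}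
    (hG : DifferentiableAt ℝ G (φ u)) (hφ : DifferentiableAt ℝ φ u) (hP : DifferentiableAt ℝ P u)
    {G' : W → W →L[ℝ] W →L[ℝ] ℝ} (hd : DifferentiableAt ℝ G' u)
    (h : G' =ᶠ[𝓝 u] fun u' ↦ pullBilin (G (φ u')) (P u')) (x v w : W) :
    fderiv ℝ G' u x v w = fderiv ℝ G (φ u) (fderiv ℝ φ u x) (P u v) (P u w)
      + G (φ u) (fderiv ℝ P u x v) (P u w) + G (φ u) (P u v) (fderiv ℝ P u x w) := by
  have h1 : HasFDerivAt (fun u' ↦ G' u' v w) _ u :=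
    (hd.hasFDerivAt.clm_apply (hasFDerivAt_const v u)).clm_apply (hasFDerivAt_const w u)
  have h2 : HasFDerivAt (fun u' ↦ G (φ u') (P u' v) (P u' w)) _ u :=
    ((hG.hasFDerivAt.comp u hφ.hasFDerivAt).clm_apply
      (hP.hasFDerivAt.clm_apply (hasFDerivAt_const v u))).clm_apply
      (hP.hasFDerivAt.clm_apply (hasFDerivAt_const w u))
  have h3 := DFunLike.congr_fun (h1.unique (h2.congr_of_eventuallyEq (by
    filter_upwards [h] with u' hu'
    rw [hu', pullBilin_apply]))) x
  simp at h3
  rw [h3]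
  abel

variable [FiniteDimensional ℝ W]

lemma contDiffAt_pullBilin {n : WithTop ℕ∞} {G : W → W →L[ℝ] W →L[ℝ] ℝ} {φ : W → W}
    {P : W → W →L[ℝ] W} {u : W} (hG : ContDiffAt ℝ n G (φ u)) (hφ : ContDiffAt ℝ n φ u)
    (hP : ContDiffAt ℝ n P u) : ContDiffAt ℝ n (fun u' ↦ pullBilin (G (φ u')) (P u')) u :=
  (hP.continuousLinearMap_comp ((ContinuousLinearMap.compL ℝ W W ℝ).flip)).clm_comp
    ((hG.comp u hφ).clm_comp hP)

/-- Transformation law of the Christoffel symbols. -/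
lemma christoffel_pullBilin {G : W → W →L[ℝ] W →L[ℝ] ℝ} {φ : W → W} {u : W}
    (hφ : ContDiffAt ℝ 2 φ u) (hφi : (fderiv ℝ φ u).IsInvertible)
    (hG : ContDiffAt ℝ 1 G (φ u)) (hi : (G (φ u)).IsInvertible)
    (hs : ∀ v w, G (φ u) v w = G (φ u) w v)
    {G' : W → W →L[ℝ] W →L[ℝ] ℝ}
    (h : G' =ᶠ[𝓝 u] fun u' ↦ pullBilin (G (φ u')) (fderiv ℝ φ u')) (v w : W) :
    fderiv ℝ φ u (christoffel G' u v w) =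
      christoffel G (φ u) (fderiv ℝ φ u v) (fderiv ℝ φ u w) + fderiv ℝ (fderiv ℝ φ) u v w := by
  have hφ1 : ContDiffAt ℝ 1 (fderiv ℝ φ) u := hφ.fderiv_right (by norm_num)
  have hφ' : DifferentiableAt ℝ (fderiv ℝ φ) u := hφ1.differentiableAt (by norm_num)
  have hφ0 : ContDiffAt ℝ 1 φ u := hφ.of_le (by norm_num)
  have hd : DifferentiableAt ℝ G' u :=
    ((contDiffAt_pullBilin hG hφ0 hφ1).congr_of_eventuallyEq h).differentiableAt (by norm_num)
  have hsym : ∀ x y, fderiv ℝ (fderiv ℝ φ) u x y = fderiv ℝ (fderiv ℝ φ) u y x :=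
    hφ.isSymmSndFDerivAt (by simp)
  have hD := hasFDerivAt_pullBilin (hG.differentiableAt (by norm_num))
    (hφ0.differentiableAt (by norm_num)) hφ' hd h
  have hG' : G' u = pullBilin (G (φ u)) (fderiv ℝ φ u) := h.self_of_nhds
  have hi' : (G' u).IsInvertible := hG' ▸ isInvertible_pullBilin hi hφi
  obtain ⟨e, he⟩ := hφi
  have key : christoffel G' u v w = e.symm (christoffel G (φ u) (fderiv ℝ φ u v) (fderiv ℝ φ u w)
      + fderiv ℝ (fderiv ℝ φ) u v w) := by
    rw [christoffel_eq_iff hi']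
    intro z
    rw [hG', pullBilin_apply, ← he]
    simp only [ContinuousLinearEquiv.coe_coe, ContinuousLinearEquiv.apply_symm_apply]
    rw [map_add, add_apply, apply_christoffel hi, christoffelFirst_apply, christoffelFirst_apply,
      hD, hD, hD, ← he, hsym w v, hsym z v, hsym z w]
    simp only [ContinuousLinearEquiv.coe_coe]
    rw [hs (e w) (fderiv ℝ (fderiv ℝ φ) u v z)]
    ring
  rw [key, ← he]
  simp

lemma sum_coord_eq_trace {ι : Type*} [Fintype ι] (b : Module.Basis ι ℝ W) (L : W →ₗ[ℝ] W) :
    ∑ i, b.coord i (L (b i)) = LinearMap.trace ℝ W L := by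
  classical
  rw [LinearMap.trace_eq_matrix_trace ℝ b, Matrix.trace]
  simp [LinearMap.toMatrix_apply]

lemma curvForm_add_left {X : Type*} [NormedAddCommGroup X] [NormedSpace ℝ X]
    (conn : W → W →L[ℝ] X →L[ℝ] X) (u x x' y : W) (s : X) :
    curvForm conn u (x + x') y s = curvForm conn u x y s + curvForm conn u x' y s := by
  simp only [curvForm, map_add, add_apply]
  abel

lemma curvForm_smul_left {X : Type*} [NormedAddCommGroup X] [NormedSpace ℝ X]
    (conn : W → W →L[ℝ] X →L[ℝ] X) (u : W) (c : ℝ) (x y : W) (s : X) :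
    curvForm conn u (c • x) y s = c • curvForm conn u x y s := by
  simp only [curvForm, map_smul, smul_apply]
  module

lemma coordRicci_eq_sum {G : W → W →L[ℝ] W →L[ℝ] ℝ} {u : W}
    (hG : DifferentiableAt ℝ (christoffelL G) u) {ι : Type*} [Fintype ι]
    (b : Module.Basis ι ℝ W) (w z : W) :
    coordRicci G u w z = ∑ i, b.coord i (curvForm (christoffelL G) u (b i) w z) := by
  let L : W →ₗ[ℝ] W :=
    { toFun := fun x ↦ curvForm (christoffelL G) u x w z
      map_add' := fun x x' ↦ curvForm_add_left _ u x x' w z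
      map_smul' := fun c x ↦ curvForm_smul_left _ u c x w z }
  calc coordRicci G u w z
      = ∑ i, (Module.finBasis ℝ W).coord i (L (Module.finBasis ℝ W i)) := by
        simp only [coordRicci, curvature_eq_curvForm hG]
        rfl
    _ = ∑ i, b.coord i (L (b i)) := by rw [sum_coord_eq_trace, sum_coord_eq_trace]
    _ = _ := rfl

/-- The trace that defines the Ricci tensor does not depend on the basis, and the curvature is
tensorial. So both may be read in a moving frame `P`: this is `curvForm_gauge` without change of
coordinates, the hypothesis `h` being the definition of the connection form in the frame. -/
lemma coordRicci_eq_sum_frame {G : W → W →L[ℝ] W →L[ℝ] ℝ} {u : W}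
    (hG : DifferentiableAt ℝ (christoffelL G) u) {X : Type*} [NormedAddCommGroup X]
    [NormedSpace ℝ X] {conn : W → W →L[ℝ] X →L[ℝ] X} {P : W → X →L[ℝ] W}
    (hP : ContDiffAt ℝ 2 P u) (hconn : DifferentiableAt ℝ conn u)
    (h : ∀ᶠ u' in 𝓝 u, ∀ x s, P u' (conn u' x s) =
      christoffel G u' x (P u' s) + fderiv ℝ P u' x s)
    (e : X ≃L[ℝ] W) (he : P u = e) {ι : Type*} [Fintype ι] (b : Module.Basis ι ℝ X)
    (w : W) (s : X) :
    coordRicci G u w (P u s) = ∑ i, b.coord i (curvForm conn u (P u (b i)) w s) := by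
  rw [coordRicci_eq_sum hG (b.map e.toLinearEquiv)]
  refine Finset.sum_congr rfl fun i _ ↦ ?_
  have h1 := curvForm_gauge (φ := id) contDiffAt_id hP hconn hG (by
    filter_upwards [h] with u' hu' x s
    simpa [christoffelL_apply] using hu' x s) (P u (b i)) w s
  simp only [fderiv_id, ContinuousLinearMap.id_apply, id_eq] at h1
  rw [Module.Basis.map_apply, ContinuousLinearEquiv.coe_toLinearEquiv]
  rw [he] at h1 ⊢
  simp only [ContinuousLinearEquiv.coe_coe] at h1 ⊢
  rw [← h1]
  simp [Module.Basis.coord_apply, Module.Basis.map_repr]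

lemma eventually_isInvertible {V F : Type*} [NormedAddCommGroup V] [NormedSpace ℝ V]
    [CompleteSpace V] [NormedAddCommGroup F] [NormedSpace ℝ F]
    {Y : Type*} [TopologicalSpace Y] {g : Y → V →L[ℝ] F} {x : Y}
    (hg : ContinuousAt g x) (hi : (g x).IsInvertible) : ∀ᶠ y in 𝓝 x, (g y).IsInvertible := by
  obtain ⟨e, he⟩ := hi
  have h1 : Set.range ((↑) : (V ≃L[ℝ] F) → V →L[ℝ] F) ∈ 𝓝 (g x) := he ▸ e.nhds
  filter_upwards [hg.eventually h1] with y ⟨e', he'⟩ using ⟨e', he'⟩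

/-- Ricci curvature is invariant under changes of coordinates. -/
lemma coordRicci_pullBilin {G : W → W →L[ℝ] W →L[ℝ] ℝ} {φ : W → W} {u : W}
    (hφ : ContDiffAt ℝ ∞ φ u) (hφi : (fderiv ℝ φ u).IsInvertible)
    (hG : ContDiffAt ℝ ∞ G (φ u)) (hi : (G (φ u)).IsInvertible)
    (hs : ∀ᶠ y in 𝓝 (φ u), ∀ v w, G y v w = G y w v)
    {G' : W → W →L[ℝ] W →L[ℝ] ℝ}
    (h : G' =ᶠ[𝓝 u] fun u' ↦ pullBilin (G (φ u')) (fderiv ℝ φ u')) (v w : W) :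
    coordRicci G' u v w = coordRicci G (φ u) (fderiv ℝ φ u v) (fderiv ℝ φ u w) := by
  have hφ1 : ContDiffAt ℝ ∞ (fderiv ℝ φ) u := hφ.fderiv_right le_rfl
  have hG' : ContDiffAt ℝ ∞ G' u := (contDiffAt_pullBilin hG hφ hφ1).congr_of_eventuallyEq h
  have hiG' : (G' u).IsInvertible := h.self_of_nhds ▸ isInvertible_pullBilin hi hφi
  have hd' : DifferentiableAt ℝ (christoffelL G') u :=
    (contDiffAt_christoffelL le_rfl hG' hiG').differentiableAt (by simp)
  have hd : DifferentiableAt ℝ (christoffelL G) (φ u) :=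
    (contDiffAt_christoffelL le_rfl hG hi).differentiableAt (by simp)
  obtain ⟨e, he⟩ := hφi
  let b := Module.finBasis ℝ W
  rw [coordRicci_eq_sum hd' b, coordRicci_eq_sum hd (b.map e.toLinearEquiv)]
  refine Finset.sum_congr rfl fun i _ ↦ ?_
  -- The transformation law of the Christoffel symbols is the gauge relation whose frame is the
  -- differential of `φ`.
  have h1 := curvForm_gauge (φ := φ) (P := fderiv ℝ φ) (conn := christoffelL G')
    (Γ := christoffelL G) (hφ.of_le two_le_infty) (hφ1.of_le two_le_infty) hd' hd (by
      have e1 := h.eventually_nhds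
      have e2 := hφ.continuousAt.eventually hs
      have e3 := (hφ.of_le two_le_infty).eventually (by simp)
      have e4 := hφ.continuousAt.eventually ((hG.of_le one_le_infty).eventually (by simp))
      have e5 := eventually_isInvertible hφ1.continuousAt ⟨e, he⟩
      have e6 := hφ.continuousAt.eventually (eventually_isInvertible hG.continuousAt hi)
      filter_upwards [e1, e2, e3, e4, e5, e6] with u' h1 h2 h3 h4 h5 h6 x s
      simp only [christoffelL_apply]
      exact christoffel_pullBilin h3 h5
        h4 h6 h2 h1 x s) (b i) v w
  rw [Module.Basis.map_apply, ContinuousLinearEquiv.coe_toLinearEquiv]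
  rw [← he] at h1 ⊢
  simp only [ContinuousLinearEquiv.coe_coe] at h1 ⊢
  rw [← h1]
  simp [Module.Basis.coord_apply, Module.Basis.map_repr]

/-- The Lie derivative is invariant under changes of coordinates. -/
lemma coordLie_pullBilin {G : W → W →L[ℝ] W →L[ℝ] ℝ} {φ : W → W} {u : W}
    (hφ : ContDiffAt ℝ 2 φ u) (hG : DifferentiableAt ℝ G (φ u))
    {G' : W → W →L[ℝ] W →L[ℝ] ℝ} (hG' : DifferentiableAt ℝ G' u)
    (h : G' =ᶠ[𝓝 u] fun u' ↦ pullBilin (G (φ u')) (fderiv ℝ φ u'))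
    {E E' : W → W} (hE : DifferentiableAt ℝ E (φ u)) (hE' : DifferentiableAt ℝ E' u)
    (hEE : ∀ᶠ u' in 𝓝 u, fderiv ℝ φ u' (E' u') = E (φ u')) (v w : W) :
    coordLie E' G' u v w = coordLie E G (φ u) (fderiv ℝ φ u v) (fderiv ℝ φ u w) := by
  have hφ' : DifferentiableAt ℝ (fderiv ℝ φ) u :=
    (hφ.fderiv_right (m := 1) (by norm_num)).differentiableAt (by norm_num)
  have hφ0 : DifferentiableAt ℝ φ u := hφ.differentiableAt (by norm_num)
  have hsym : ∀ x y, fderiv ℝ (fderiv ℝ φ) u x y = fderiv ℝ (fderiv ℝ φ) u y x :=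
    hφ.isSymmSndFDerivAt (by simp)
  have h1 : HasFDerivAt (fun u' ↦ fderiv ℝ φ u' (E' u')) _ u :=
    hφ'.hasFDerivAt.clm_apply hE'.hasFDerivAt
  have h2 : HasFDerivAt (fun u' ↦ E (φ u')) _ u := hE.hasFDerivAt.comp u hφ0.hasFDerivAt
  -- The derivative of the relation `dφ(E') = E ∘ φ`. Its second-order term cancels against the one
  -- in the derivative of the pulled-back metric.
  have h3 : ∀ x, fderiv ℝ E (φ u) (fderiv ℝ φ u x) =
      fderiv ℝ φ u (fderiv ℝ E' u x) + fderiv ℝ (fderiv ℝ φ) u x (E' u) := by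
    intro x
    have := DFunLike.congr_fun (h2.unique (h1.congr_of_eventuallyEq (by
      filter_upwards [hEE] with u' hu' using hu'.symm))) x
    simpa using this
  rw [coordLie, coordLie, hasFDerivAt_pullBilin hG hφ0 hφ' hG' h, h3, h3, h.self_of_nhds,
    hEE.self_of_nhds, hsym v, hsym w]
  simp only [pullBilin_apply, map_add, add_apply]
  ring

/-- The exterior derivative is invariant under changes of coordinates. -/
lemma coordExtDeriv_pull {α : W → W →L[ℝ] ℝ} {φ : W → W} {u : W}
    (hφ : ContDiffAt ℝ 2 φ u) (hα : DifferentiableAt ℝ α (φ u))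
    {α' : W → W →L[ℝ] ℝ}
    (h : α' =ᶠ[𝓝 u] fun u' ↦ (α (φ u')).comp (fderiv ℝ φ u')) (v w : W) :
    coordExtDeriv α' u v w = coordExtDeriv α (φ u) (fderiv ℝ φ u v) (fderiv ℝ φ u w) := by
  have hφ' : DifferentiableAt ℝ (fderiv ℝ φ) u :=
    (hφ.fderiv_right (m := 1) (by norm_num)).differentiableAt (by norm_num)
  have hφ0 : DifferentiableAt ℝ φ u := hφ.differentiableAt (by norm_num)
  have hsym : ∀ x y, fderiv ℝ (fderiv ℝ φ) u x y = fderiv ℝ (fderiv ℝ φ) u y x :=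
    hφ.isSymmSndFDerivAt (by simp)
  have h1 : HasFDerivAt α' _ u := (HasFDerivAt.clm_comp (hα.hasFDerivAt.comp u hφ0.hasFDerivAt)
    hφ'.hasFDerivAt).congr_of_eventuallyEq h
  rw [coordExtDeriv, coordExtDeriv, h1.fderiv]
  simp [hsym v w]

end Covariance
end BeltramiSoliton

namespace BeltramiSoliton

/-! ### The metric on `V × ℝ` and its Christoffel symbols. -/

section LocalBeltrami

variable {V : Type*} [NormedAddCommGroup V] [NormedSpace ℝ V]

/-- The one-form `ρ dρ + A` on `V × ℝ`. -/
def thetaL (A : V → V →L[ℝ] ℝ) (w : V × ℝ) : V × ℝ →L[ℝ] ℝ :=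
  w.2 • ContinuousLinearMap.snd ℝ V ℝ + (A w.1).comp (ContinuousLinearMap.fst ℝ V ℝ)

lemma thetaL_apply (A : V → V →L[ℝ] ℝ) (w x : V × ℝ) :
    thetaL A w x = w.2 * x.2 + A w.1 x.1 := rfl

/-- The metric `ρ² h + ρ⁻² (ρ dρ + A)²` on `V × ℝ`. -/
def liftMetric (h : V → V →L[ℝ] V →L[ℝ] ℝ) (A : V → V →L[ℝ] ℝ) (w : V × ℝ) :
    V × ℝ →L[ℝ] V × ℝ →L[ℝ] ℝ :=
  w.2 ^ 2 • pullBilin (h w.1) (ContinuousLinearMap.fst ℝ V ℝ) +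
    (w.2 ^ 2)⁻¹ • (thetaL A w).smulRight (thetaL A w)

lemma liftMetric_apply (h : V → V →L[ℝ] V →L[ℝ] ℝ) (A : V → V →L[ℝ] ℝ) (w x y : V × ℝ) :
    liftMetric h A w x y =
      w.2 ^ 2 * h w.1 x.1 y.1 + (w.2 ^ 2)⁻¹ * (thetaL A w x * thetaL A w y) := rfl

/-- The vector field dual to `A`. -/
def sharpL (h : V → V →L[ℝ] V →L[ℝ] ℝ) (A : V → V →L[ℝ] ℝ) (u : V) : V := (h u).inverse (A u)

/-- The endomorphism `K` with `h (K s) t = -½ dA(s, t)`. -/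
def hodgeL (h : V → V →L[ℝ] V →L[ℝ] ℝ) (A : V → V →L[ℝ] ℝ) (u : V) : V →L[ℝ] V :=
  ((h u).inverse).comp ((-(1 / 2) : ℝ) • (fderiv ℝ A u - (fderiv ℝ A u).flip))

lemma apply_inverse {b : V →L[ℝ] V →L[ℝ] ℝ} (hb : b.IsInvertible) (α : V →L[ℝ] ℝ) (t : V) :
    b (b.inverse α) t = α t := by
  obtain ⟨e, rfl⟩ := hb
  simp

lemma apply_sharpL {h : V → V →L[ℝ] V →L[ℝ] ℝ} {A : V → V →L[ℝ] ℝ} {u : V}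
    (hi : (h u).IsInvertible) (t : V) : h u (sharpL h A u) t = A u t :=
  apply_inverse hi _ _

lemma apply_hodgeL {h : V → V →L[ℝ] V →L[ℝ] ℝ} {A : V → V →L[ℝ] ℝ} {u : V}
    (hi : (h u).IsInvertible) (s t : V) :
    h u (hodgeL h A u s) t = -(1 / 2) * coordExtDeriv A u s t := by
  rw [hodgeL, ContinuousLinearMap.comp_apply, apply_inverse hi]
  rfl

section smoothness

variable {n : WithTop ℕ∞} {h : V → V →L[ℝ] V →L[ℝ] ℝ} {A : V → V →L[ℝ] ℝ}

lemma contDiffAt_thetaL {w : V × ℝ} (hA : ContDiffAt ℝ n A w.1) : ContDiffAt ℝ n (thetaL A) w := by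
  have h1 : ContDiffAt ℝ n (fun w : V × ℝ ↦ A w.1) w := hA.comp w contDiffAt_fst
  exact (contDiffAt_snd.smul contDiffAt_const).add (h1.clm_comp contDiffAt_const)

lemma contDiffAt_liftMetric {w : V × ℝ} (hh : ContDiffAt ℝ n h w.1) (hA : ContDiffAt ℝ n A w.1)
    (hw : w.2 ≠ 0) : ContDiffAt ℝ n (liftMetric h A) w := by
  have h1 : ContDiffAt ℝ n (fun w : V × ℝ ↦ h w.1) w := hh.comp w contDiffAt_fst
  have h2 : ContDiffAt ℝ n (fun w : V × ℝ ↦ w.2 ^ 2) w := contDiffAt_snd.pow 2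
  have h3 := contDiffAt_thetaL hA
  have h4 : ContDiffAt ℝ n (fun w : V × ℝ ↦ (thetaL A w).smulRight (thetaL A w)) w := by
    have := (ContinuousLinearMap.smulRightL ℝ (V × ℝ) (V × ℝ →L[ℝ] ℝ)).isBoundedBilinearMap
    exact this.contDiff.contDiffAt.comp w (h3.prodMk h3)
  have h5 : ContDiffAt ℝ n (fun w : V × ℝ ↦ pullBilin (h w.1) (ContinuousLinearMap.fst ℝ V ℝ)) w :=
    contDiffAt_const.clm_comp (h1.clm_comp contDiffAt_const)
  exact (h2.smul h5).add ((h2.inv (pow_ne_zero 2 hw)).smul h4)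

variable [CompleteSpace V]

lemma contDiffAt_sharpL {u : V} (hh : ContDiffAt ℝ n h u) (hi : (h u).IsInvertible)
    (hA : ContDiffAt ℝ n A u) : ContDiffAt ℝ n (sharpL h A) u :=
  (hi.contDiffAt_map_inverse.comp u hh).clm_apply hA

lemma contDiffAt_hodgeL (hn : n + 1 ≤ n) {u : V} (hh : ContDiffAt ℝ n h u)
    (hi : (h u).IsInvertible) (hA : ContDiffAt ℝ n A u) : ContDiffAt ℝ n (hodgeL h A) u := by
  have h1 := hA.fderiv_right hn
  have h2 : ContDiffAt ℝ n (fun u ↦ (fderiv ℝ A u).flip) u := h1.continuousLinearMap_comp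
    (ContinuousLinearMap.flipₗᵢ ℝ V V ℝ).toContinuousLinearEquiv.toContinuousLinearMap
  exact (hi.contDiffAt_map_inverse.comp u hh).clm_comp ((h1.sub h2).const_smul _)

end smoothness

variable [FiniteDimensional ℝ V]

/-- A vector in the kernel has zero base component by testing against horizontal lifts, on which `θ`
vanishes; testing against `∂/∂ρ` then kills its `ρ`-component. -/
lemma isInvertible_liftMetric {h : V → V →L[ℝ] V →L[ℝ] ℝ} {A : V → V →L[ℝ] ℝ} {w : V × ℝ}
    (hi : (h w.1).IsInvertible) (hw : w.2 ≠ 0) : (liftMetric h A w).IsInvertible := by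
  apply isInvertible_of_nondegenerate
  intro x hx
  have h1 : x.1 = 0 := by
    apply eq_zero_of_isInvertible hi
    intro t
    have := hx (t, -(A w.1 t) * w.2⁻¹)
    rw [liftMetric_apply, thetaL_apply _ _ (t, _)] at this
    field_simp at this
    simp at this
    simpa [hw] using this
  have h2 := hx (0, 1)
  rw [liftMetric_apply, thetaL_apply, thetaL_apply] at h2
  simp [h1, hw] at h2
  exact Prod.ext h1 h2

/-- The derivative of the metric `liftMetric h A`. -/
lemma fderiv_liftMetric {h : V → V →L[ℝ] V →L[ℝ] ℝ} {A : V → V →L[ℝ] ℝ} {w : V × ℝ}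
    (hh : DifferentiableAt ℝ h w.1) (hA : DifferentiableAt ℝ A w.1) (hw : w.2 ≠ 0)
    (hd : DifferentiableAt ℝ (liftMetric h A) w) (x y z : V × ℝ) :
    fderiv ℝ (liftMetric h A) w x y z =
      2 * w.2 * x.2 * h w.1 y.1 z.1 + w.2 ^ 2 * fderiv ℝ h w.1 x.1 y.1 z.1
      - 2 * w.2⁻¹ ^ 3 * x.2 * (thetaL A w y * thetaL A w z)
      + w.2⁻¹ ^ 2 * ((x.2 * y.2 + fderiv ℝ A w.1 x.1 y.1) * thetaL A w z
        + thetaL A w y * (x.2 * z.2 + fderiv ℝ A w.1 x.1 z.1)) := by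
  have h1 : HasFDerivAt (fun w' ↦ liftMetric h A w' y z) _ w :=
    (hd.hasFDerivAt.clm_apply (hasFDerivAt_const y w)).clm_apply (hasFDerivAt_const z w)
  have h2 : ∀ y : V × ℝ, HasFDerivAt (fun w' : V × ℝ ↦ w'.2 * y.2 + A w'.1 y.1) _ w := fun y ↦
    (hasFDerivAt_snd.mul_const y.2).add
      ((hA.hasFDerivAt.comp w hasFDerivAt_fst).clm_apply (hasFDerivAt_const y.1 w))
  have h3 : HasFDerivAt (fun w' : V × ℝ ↦ h w'.1 y.1 z.1) _ w :=
    ((hh.hasFDerivAt.comp w hasFDerivAt_fst).clm_apply (hasFDerivAt_const y.1 w)).clm_apply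
      (hasFDerivAt_const z.1 w)
  have h0 : HasFDerivAt (fun w' : V × ℝ ↦ w'.2) (ContinuousLinearMap.snd ℝ V ℝ) w :=
    hasFDerivAt_snd
  have h4 : HasFDerivAt (fun w' : V × ℝ ↦ w'.2 ^ 2) _ w := h0.pow 2
  have h5 : HasFDerivAt (fun w' : V × ℝ ↦ (w'.2 ^ 2)⁻¹) _ w :=
    (hasDerivAt_inv (pow_ne_zero 2 hw)).comp_hasFDerivAt w h4
  have h6 : HasFDerivAt (fun w' : V × ℝ ↦ w'.2 ^ 2 * h w'.1 y.1 z.1 +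
    (w'.2 ^ 2)⁻¹ * ((w'.2 * y.2 + A w'.1 y.1) * (w'.2 * z.2 + A w'.1 z.1))) _ w :=
    (h4.mul h3).add (h5.mul ((h2 y).mul (h2 z)))
  have h7 := DFunLike.congr_fun (h1.unique h6) x
  simp at h7
  rw [h7]
  simp only [thetaL_apply]
  field_simp
  ring

/-- The Levi-Civita derivative of a constant field: the component in `V`. -/
def liftChristoffelFst (h : V → V →L[ℝ] V →L[ℝ] ℝ) (A : V → V →L[ℝ] ℝ) (w x y : V × ℝ) : V :=
  christoffel h w.1 x.1 y.1 + w.2⁻¹ • (x.2 • y.1 + y.2 • x.1)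
    + (w.2⁻¹ ^ 2 * (h w.1 x.1 y.1 - w.2⁻¹ ^ 4 * (thetaL A w x * thetaL A w y))) • sharpL h A w.1
    - w.2⁻¹ ^ 4 • (thetaL A w y • hodgeL h A w.1 x.1 + thetaL A w x • hodgeL h A w.1 y.1)

/-- The Levi-Civita derivative of a constant field: the value of the form `θ`. -/
def liftChristoffelTheta (h : V → V →L[ℝ] V →L[ℝ] ℝ) (A : V → V →L[ℝ] ℝ) (w x y : V × ℝ) : ℝ :=
  -(w.2⁻¹ ^ 2) * (thetaL A w x * thetaL A w y - A w.1 x.1 * thetaL A w y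
      - A w.1 y.1 * thetaL A w x) - w.2 ^ 2 * h w.1 x.1 y.1 + h w.1 (hodgeL h A w.1 x.1) y.1
    + x.2 * y.2 + fderiv ℝ A w.1 x.1 y.1

/-- A vector of `V × ℝ` is recovered from its base component and its value under `θ`, and the metric
pairs these two separately. The stated vector is therefore verified by comparing its pairing with an
arbitrary `z` to the Koszul formula. -/
lemma christoffel_liftMetric {h : V → V →L[ℝ] V →L[ℝ] ℝ} {A : V → V →L[ℝ] ℝ} {w : V × ℝ}
    (hh : ContDiffAt ℝ 1 h w.1) (hA : ContDiffAt ℝ 1 A w.1) (hw : w.2 ≠ 0)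
    (hi : (h w.1).IsInvertible) (x y : V × ℝ) :
    christoffel (liftMetric h A) w x y = (liftChristoffelFst h A w x y,
      w.2⁻¹ * (liftChristoffelTheta h A w x y - A w.1 (liftChristoffelFst h A w x y))) := by
  have hd := (contDiffAt_liftMetric hh hA hw).differentiableAt (by norm_num)
  rw [christoffel_eq_iff (isInvertible_liftMetric hi hw)]
  intro z
  have hD := fderiv_liftMetric (hh.differentiableAt (by norm_num))
    (hA.differentiableAt (by norm_num)) hw hd
  have e1 : thetaL A w (liftChristoffelFst h A w x y,
      w.2⁻¹ * (liftChristoffelTheta h A w x y - A w.1 (liftChristoffelFst h A w x y))) =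
      liftChristoffelTheta h A w x y := by
    rw [thetaL_apply]
    field_simp
    ring
  rw [liftMetric_apply, e1, christoffelFirst_apply, hD, hD, hD, liftChristoffelTheta]
  have e2 : h w.1 (liftChristoffelFst h A w x y) z.1 =
      christoffelFirst h w.1 x.1 y.1 z.1
      + w.2⁻¹ * (x.2 * h w.1 y.1 z.1 + y.2 * h w.1 x.1 z.1)
      + (w.2⁻¹ ^ 2 * (h w.1 x.1 y.1 - w.2⁻¹ ^ 4 * (thetaL A w x * thetaL A w y))) * A w.1 z.1
      - w.2⁻¹ ^ 4 * (thetaL A w y * (-(1 / 2) * coordExtDeriv A w.1 x.1 z.1)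
        + thetaL A w x * (-(1 / 2) * coordExtDeriv A w.1 y.1 z.1)) := by
    rw [liftChristoffelFst, map_sub, map_add, map_add, ← apply_christoffel hi, ← apply_sharpL hi,
      ← apply_hodgeL hi, ← apply_hodgeL hi]
    simp only [map_smul, map_add, sub_apply, add_apply, smul_apply, smul_eq_mul]
  rw [e2, apply_hodgeL hi, christoffelFirst_apply]
  simp only [coordExtDeriv, thetaL_apply]
  field_simp
  ring

end LocalBeltrami
end BeltramiSoliton

namespace BeltramiSoliton

/-! ### The Levi-Civita connection in the frame of horizontal lifts and `ρ⁻¹ ∂/∂ρ`, and the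
derivative of its tensorial part. -/

section LocalBeltrami

variable {V : Type*} [NormedAddCommGroup V] [NormedSpace ℝ V]

/-- The frame of `V × ℝ` formed by the horizontal lifts of vectors of `V` and by `ρ⁻¹ ∂/∂ρ`. -/
def liftFrame (A : V → V →L[ℝ] ℝ) (w : V × ℝ) : V × ℝ →L[ℝ] V × ℝ :=
  (ContinuousLinearMap.fst ℝ V ℝ).prod
    (w.2⁻¹ • (ContinuousLinearMap.snd ℝ V ℝ - (A w.1).comp (ContinuousLinearMap.fst ℝ V ℝ)))

lemma liftFrame_apply (A : V → V →L[ℝ] ℝ) (w s : V × ℝ) :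
    liftFrame A w s = (s.1, w.2⁻¹ * (s.2 - A w.1 s.1)) := rfl

/-- The dual frame. -/
def liftCoframe (A : V → V →L[ℝ] ℝ) (w : V × ℝ) : V × ℝ →L[ℝ] V × ℝ :=
  (ContinuousLinearMap.fst ℝ V ℝ).prod (thetaL A w)

lemma liftCoframe_apply (A : V → V →L[ℝ] ℝ) (w s : V × ℝ) :
    liftCoframe A w s = (s.1, thetaL A w s) := rfl

lemma liftFrame_liftCoframe (A : V → V →L[ℝ] ℝ) {w : V × ℝ} (hw : w.2 ≠ 0) (s : V × ℝ) :
    liftFrame A w (liftCoframe A w s) = s := by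
  rw [liftFrame_apply, liftCoframe_apply, thetaL_apply]
  refine Prod.ext rfl ?_
  field_simp
  ring

lemma liftCoframe_liftFrame (A : V → V →L[ℝ] ℝ) {w : V × ℝ} (hw : w.2 ≠ 0) (s : V × ℝ) :
    liftCoframe A w (liftFrame A w s) = s := by
  rw [liftFrame_apply, liftCoframe_apply, thetaL_apply]
  refine Prod.ext rfl ?_
  field_simp
  ring

/-- The frame as an isomorphism. -/
def liftFrameEquiv (A : V → V →L[ℝ] ℝ) {w : V × ℝ} (hw : w.2 ≠ 0) : (V × ℝ) ≃L[ℝ] V × ℝ :=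
  ContinuousLinearEquiv.equivOfInverse (liftFrame A w) (liftCoframe A w)
    (liftCoframe_liftFrame A hw) (liftFrame_liftCoframe A hw)

lemma thetaL_liftFrame (A : V → V →L[ℝ] ℝ) {w : V × ℝ} (hw : w.2 ≠ 0) (s : V × ℝ) :
    thetaL A w (liftFrame A w s) = s.2 :=
  congrArg Prod.snd (liftCoframe_liftFrame A hw s)

lemma contDiffAt_liftFrame {n : WithTop ℕ∞} {A : V → V →L[ℝ] ℝ} {w : V × ℝ}
    (hA : ContDiffAt ℝ n A w.1) (hw : w.2 ≠ 0) : ContDiffAt ℝ n (liftFrame A) w := by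
  have h1 : ContDiffAt ℝ n (fun w : V × ℝ ↦ A w.1) w := hA.comp w contDiffAt_fst
  have h2 : ContDiffAt ℝ n (fun w : V × ℝ ↦ w.2⁻¹) w := contDiffAt_snd.inv hw
  have h3 : ContDiffAt ℝ n (fun w : V × ℝ ↦ (ContinuousLinearMap.snd ℝ V ℝ -
      (A w.1).comp (ContinuousLinearMap.fst ℝ V ℝ))) w :=
    contDiffAt_const.sub (h1.clm_comp contDiffAt_const)
  exact (ContinuousLinearMap.prodₗᵢ (𝕜 := ℝ) (E := V × ℝ) (F := V) (G := ℝ) ℝ).contDiff.contDiffAt.comp w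
    (contDiffAt_const.prodMk (h2.smul h3))

lemma contDiffAt_liftCoframe {n : WithTop ℕ∞} {A : V → V →L[ℝ] ℝ} {w : V × ℝ}
    (hA : ContDiffAt ℝ n A w.1) : ContDiffAt ℝ n (liftCoframe A) w :=
  (ContinuousLinearMap.prodₗᵢ (𝕜 := ℝ) (E := V × ℝ) (F := V) (G := ℝ) ℝ).contDiff.contDiffAt.comp w
    (contDiffAt_const.prodMk (contDiffAt_thetaL hA))

lemma fderiv_liftFrame {A : V → V →L[ℝ] ℝ} {w : V × ℝ}
    (hA : ContDiffAt ℝ 1 A w.1) (hw : w.2 ≠ 0) (x s : V × ℝ) :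
    fderiv ℝ (liftFrame A) w x s =
      (0, -(w.2⁻¹ ^ 2) * x.2 * (s.2 - A w.1 s.1) - w.2⁻¹ * fderiv ℝ A w.1 x.1 s.1) := by
  have hd := (contDiffAt_liftFrame hA hw).differentiableAt (by norm_num)
  have h1 : HasFDerivAt (fun w' ↦ liftFrame A w' s) _ w :=
    hd.hasFDerivAt.clm_apply (hasFDerivAt_const s w)
  have h0 : HasFDerivAt (fun w' : V × ℝ ↦ w'.2) (ContinuousLinearMap.snd ℝ V ℝ) w :=
    hasFDerivAt_snd
  have h2 : HasFDerivAt (fun w' : V × ℝ ↦ w'.2⁻¹) _ w := (hasDerivAt_inv hw).comp_hasFDerivAt w h0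
  have h3 : HasFDerivAt (fun w' : V × ℝ ↦ A w'.1 s.1) _ w :=
    ((hA.differentiableAt (by norm_num)).hasFDerivAt.comp w hasFDerivAt_fst).clm_apply
      (hasFDerivAt_const s.1 w)
  have h4 : HasFDerivAt (fun w' : V × ℝ ↦ (s.1, w'.2⁻¹ * (s.2 - A w'.1 s.1))) _ w :=
    (hasFDerivAt_const s.1 w).prodMk (h2.mul ((hasFDerivAt_const s.2 w).sub h3))
  have h5 := DFunLike.congr_fun (h1.unique h4) x
  simp at h5
  rw [h5]
  refine Prod.ext rfl ?_
  simp
  ring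

/-- The tensorial part of the Levi-Civita connection in the frame `liftFrame`, horizontal
component. -/
def frameTensorFst (h : V → V →L[ℝ] V →L[ℝ] ℝ) (A : V → V →L[ℝ] ℝ) (w x s : V × ℝ) : V :=
  (w.2⁻¹ * x.2) • s.1 + (w.2⁻¹ ^ 2 * (s.2 - A w.1 s.1)) • x.1
    + (w.2⁻¹ ^ 2 * h w.1 x.1 s.1 - w.2⁻¹ ^ 6 * s.2 * thetaL A w x) • sharpL h A w.1
    - (w.2⁻¹ ^ 4 * s.2) • hodgeL h A w.1 x.1 - (w.2⁻¹ ^ 4 * thetaL A w x) • hodgeL h A w.1 s.1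

/-- The tensorial part of the Levi-Civita connection in the frame `liftFrame`, vertical
component. -/
def frameTensorSnd (h : V → V →L[ℝ] V →L[ℝ] ℝ) (A : V → V →L[ℝ] ℝ) (w x s : V × ℝ) : ℝ :=
  -(w.2⁻¹ * x.2 * (s.2 - A w.1 s.1)) + w.2⁻¹ ^ 2 * A w.1 s.1 * A w.1 x.1
    - w.2 ^ 2 * h w.1 x.1 s.1 + h w.1 (hodgeL h A w.1 x.1) s.1

/-- The Levi-Civita connection in the frame `liftFrame`. -/
def frameConn (h : V → V →L[ℝ] V →L[ℝ] ℝ) (A : V → V →L[ℝ] ℝ) (w : V × ℝ) :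
    V × ℝ →L[ℝ] V × ℝ →L[ℝ] V × ℝ :=
  (ContinuousLinearMap.compL ℝ (V × ℝ) _ _ (liftCoframe A w)).comp
    (((ContinuousLinearMap.compL ℝ (V × ℝ) (V × ℝ) (V × ℝ)).flip (liftFrame A w)).comp
      (christoffelL (liftMetric h A) w) + fderiv ℝ (liftFrame A) w)

lemma frameConn_apply (h : V → V →L[ℝ] V →L[ℝ] ℝ) (A : V → V →L[ℝ] ℝ) (w x s : V × ℝ) :
    frameConn h A w x s = liftCoframe A w
      (christoffel (liftMetric h A) w x (liftFrame A w s) + fderiv ℝ (liftFrame A) w x s) := by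
  rw [← christoffelL_apply]
  rfl

variable [FiniteDimensional ℝ V]

lemma contDiffAt_frameConn {n : WithTop ℕ∞} (hn : n + 1 ≤ n) {h : V → V →L[ℝ] V →L[ℝ] ℝ}
    {A : V → V →L[ℝ] ℝ} {w : V × ℝ} (hh : ContDiffAt ℝ n h w.1) (hA : ContDiffAt ℝ n A w.1)
    (hw : w.2 ≠ 0) (hi : (h w.1).IsInvertible) : ContDiffAt ℝ n (frameConn h A) w := by
  have h1 := contDiffAt_liftCoframe (w := w) hA
  have h2 := contDiffAt_liftFrame hA hw
  have h3 := h2.fderiv_right hn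
  have h4 := contDiffAt_christoffelL hn (contDiffAt_liftMetric hh hA hw)
    (isInvertible_liftMetric hi hw)
  have h5 := h1.continuousLinearMap_comp (ContinuousLinearMap.compL ℝ (V × ℝ) (V × ℝ) (V × ℝ))
  have h6 := h2.continuousLinearMap_comp
    (ContinuousLinearMap.compL ℝ (V × ℝ) (V × ℝ) (V × ℝ)).flip
  exact h5.clm_comp ((h6.clm_comp h4).add h3)

lemma frameConn_eq {h : V → V →L[ℝ] V →L[ℝ] ℝ} {A : V → V →L[ℝ] ℝ} {w : V × ℝ}
    (hh : ContDiffAt ℝ 1 h w.1) (hA : ContDiffAt ℝ 1 A w.1) (hw : w.2 ≠ 0)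
    (hi : (h w.1).IsInvertible) (x s : V × ℝ) :
    frameConn h A w x s = (christoffelL h w.1 x.1 s.1 + frameTensorFst h A w x s,
      frameTensorSnd h A w x s) := by
  rw [frameConn_apply, fderiv_liftFrame hA hw, christoffel_liftMetric hh hA hw hi,
    liftCoframe_apply, christoffelL_apply]
  refine Prod.ext ?_ ?_
  · simp only [Prod.fst_add, add_zero, liftChristoffelFst, frameTensorFst, thetaL_liftFrame A hw]
    simp only [liftFrame_apply]
    module
  · simp only [thetaL_apply A w (_ + _), Prod.fst_add, add_zero, Prod.snd_add, liftChristoffelTheta,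
      frameTensorSnd, thetaL_liftFrame A hw]
    simp only [liftFrame_apply, thetaL_apply]
    field_simp
    ring

/-! ### Covariant derivatives on the base -/

/-- The covariant derivative of `A`. -/
def covForm (h : V → V →L[ℝ] V →L[ℝ] ℝ) (A : V → V →L[ℝ] ℝ) (u x t : V) : ℝ :=
  fderiv ℝ A u x t - A u (christoffelL h u x t)

/-- The covariant derivative of `sharpL h A`. -/
def covSharp (h : V → V →L[ℝ] V →L[ℝ] ℝ) (A : V → V →L[ℝ] ℝ) (u x : V) : V :=
  fderiv ℝ (sharpL h A) u x + christoffelL h u x (sharpL h A u)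

/-- The covariant derivative of `hodgeL h A`. -/
def covHodge (h : V → V →L[ℝ] V →L[ℝ] ℝ) (A : V → V →L[ℝ] ℝ) (u x t : V) : V :=
  fderiv ℝ (hodgeL h A) u x t + christoffelL h u x (hodgeL h A u t)
    - hodgeL h A u (christoffelL h u x t)

/-- The covariant derivative of `frameTensorFst`. -/
def covFrameTensorFst (h : V → V →L[ℝ] V →L[ℝ] ℝ) (A : V → V →L[ℝ] ℝ) (w x y s : V × ℝ) : V :=
  (-(w.2⁻¹ ^ 2 * x.2 * y.2)) • s.1
    + (-(2 * w.2⁻¹ ^ 3 * x.2 * (s.2 - A w.1 s.1)) - w.2⁻¹ ^ 2 * covForm h A w.1 x.1 s.1) • y.1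
    + (-(2 * w.2⁻¹ ^ 3 * x.2 * h w.1 y.1 s.1) + 6 * w.2⁻¹ ^ 7 * x.2 * s.2 * thetaL A w y
      - w.2⁻¹ ^ 6 * s.2 * (x.2 * y.2 + covForm h A w.1 x.1 y.1)) • sharpL h A w.1
    + (w.2⁻¹ ^ 2 * h w.1 y.1 s.1 - w.2⁻¹ ^ 6 * s.2 * thetaL A w y) • covSharp h A w.1 x.1
    + (4 * w.2⁻¹ ^ 5 * x.2 * s.2) • hodgeL h A w.1 y.1
    + (4 * w.2⁻¹ ^ 5 * x.2 * thetaL A w y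
      - w.2⁻¹ ^ 4 * (x.2 * y.2 + covForm h A w.1 x.1 y.1)) • hodgeL h A w.1 s.1
    - (w.2⁻¹ ^ 4 * s.2) • covHodge h A w.1 x.1 y.1
    - (w.2⁻¹ ^ 4 * thetaL A w y) • covHodge h A w.1 x.1 s.1

/-- The covariant derivative of `frameTensorSnd`. -/
def covFrameTensorSnd (h : V → V →L[ℝ] V →L[ℝ] ℝ) (A : V → V →L[ℝ] ℝ) (w x y s : V × ℝ) : ℝ :=
  w.2⁻¹ ^ 2 * x.2 * y.2 * (s.2 - A w.1 s.1) + w.2⁻¹ * y.2 * covForm h A w.1 x.1 s.1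
    - 2 * w.2⁻¹ ^ 3 * x.2 * A w.1 s.1 * A w.1 y.1
    + w.2⁻¹ ^ 2 * (covForm h A w.1 x.1 s.1 * A w.1 y.1 + A w.1 s.1 * covForm h A w.1 x.1 y.1)
    - 2 * w.2 * x.2 * h w.1 y.1 s.1 + h w.1 (covHodge h A w.1 x.1 y.1) s.1

section derivatives

variable {h : V → V →L[ℝ] V →L[ℝ] ℝ} {A : V → V →L[ℝ] ℝ} {w : V × ℝ}
  (hh : ContDiffAt ℝ ∞ h w.1) (hA : ContDiffAt ℝ ∞ A w.1) (hw : w.2 ≠ 0)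
  (hi : (h w.1).IsInvertible) (hs : ∀ᶠ u in 𝓝 w.1, ∀ v v', h u v v' = h u v' v)
include hh hA hw hi hs

/-- This is the product rule, with each derivative of `A`, `h`, `A♯` and `K` traded for a covariant
one plus Christoffel terms. The former make up `covFrameTensorFst`. The latter reassemble into one
correction for each slot and one for the value; these have no `ρ`-component because only the base is
curved by `christoffelL h`. -/
lemma fderiv_frameTensorFst (x y s : V × ℝ) :
    fderiv ℝ (fun w' ↦ frameTensorFst h A w' y s) w x = covFrameTensorFst h A w x y s
      + frameTensorFst h A w (christoffelL h w.1 x.1 y.1, 0) s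
      + frameTensorFst h A w y (christoffelL h w.1 x.1 s.1, 0)
      - christoffelL h w.1 x.1 (frameTensorFst h A w y s) := by
  have h0 : HasFDerivAt (fun w' : V × ℝ ↦ w'.2) (ContinuousLinearMap.snd ℝ V ℝ) w :=
    hasFDerivAt_snd
  have h2 : HasFDerivAt (fun w' : V × ℝ ↦ w'.2⁻¹) _ w := (hasDerivAt_inv hw).comp_hasFDerivAt w h0
  have hAs : ∀ s : V, HasFDerivAt (fun w' : V × ℝ ↦ A w'.1 s) _ w := fun s ↦
    ((hA.differentiableAt (by simp)).hasFDerivAt.comp w hasFDerivAt_fst).clm_apply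
      (hasFDerivAt_const s w)
  have hhs : HasFDerivAt (fun w' : V × ℝ ↦ h w'.1 y.1 s.1) _ w :=
    (((hh.differentiableAt (by simp)).hasFDerivAt.comp w hasFDerivAt_fst).clm_apply
      (hasFDerivAt_const y.1 w)).clm_apply (hasFDerivAt_const s.1 w)
  have ha : HasFDerivAt (fun w' : V × ℝ ↦ sharpL h A w'.1) _ w :=
    ((contDiffAt_sharpL hh hi hA).differentiableAt (by simp)).hasFDerivAt.comp w hasFDerivAt_fst
  have hK : ∀ t : V, HasFDerivAt (fun w' : V × ℝ ↦ hodgeL h A w'.1 t) _ w := fun t ↦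
    (((contDiffAt_hodgeL le_rfl hh hi hA).differentiableAt (by simp)).hasFDerivAt.comp w
      hasFDerivAt_fst).clm_apply (hasFDerivAt_const t w)
  have hth : HasFDerivAt (fun w' : V × ℝ ↦ w'.2 * y.2 + A w'.1 y.1) _ w :=
    (h0.mul_const y.2).add (hAs y.1)
  have hfull : HasFDerivAt (fun w' : V × ℝ ↦
      (w'.2⁻¹ * y.2) • s.1 + (w'.2⁻¹ ^ 2 * (s.2 - A w'.1 s.1)) • y.1
      + (w'.2⁻¹ ^ 2 * h w'.1 y.1 s.1 - w'.2⁻¹ ^ 6 * s.2 * (w'.2 * y.2 + A w'.1 y.1)) • sharpL h A w'.1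
      - (w'.2⁻¹ ^ 4 * s.2) • hodgeL h A w'.1 y.1
      - (w'.2⁻¹ ^ 4 * (w'.2 * y.2 + A w'.1 y.1)) • hodgeL h A w'.1 s.1) _ w :=
    ((((((h2.mul_const y.2).smul (hasFDerivAt_const s.1 w)).add
      (((h2.pow 2).mul ((hasFDerivAt_const s.2 w).sub (hAs s.1))).smul
        (hasFDerivAt_const y.1 w))).add
      ((((h2.pow 2).mul hhs).sub (((h2.pow 6).mul_const s.2).mul hth)).smul ha)).sub
      (((h2.pow 4).mul_const s.2).smul (hK y.1))).sub
      (((h2.pow 4).mul hth).smul (hK s.1)))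
  have e1 : ∀ t, fderiv ℝ A w.1 x.1 t = covForm h A w.1 x.1 t + A w.1 (christoffelL h w.1 x.1 t) := by
    intro t; rw [covForm]; ring
  have e2 : fderiv ℝ (sharpL h A) w.1 x.1 =
      covSharp h A w.1 x.1 - christoffelL h w.1 x.1 (sharpL h A w.1) := by
    rw [covSharp]; abel
  have e3 : ∀ t, fderiv ℝ (hodgeL h A) w.1 x.1 t = covHodge h A w.1 x.1 t
      - christoffelL h w.1 x.1 (hodgeL h A w.1 t) + hodgeL h A w.1 (christoffelL h w.1 x.1 t) := by
    intro t; rw [covHodge]; abel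
  have e4 := fderiv_metric (hh.differentiableAt (by simp)) hs hi x.1 y.1 s.1
  simp only [← christoffelL_apply] at e4
  have hF : fderiv ℝ (fun w' ↦ frameTensorFst h A w' y s) w x = _ :=
    DFunLike.congr_fun hfull.fderiv x
  rw [hF]
  simp [e1, e2, e3, e4]
  simp only [frameTensorFst, covFrameTensorFst, thetaL_apply, map_add, map_sub, map_smul]
  set i := w.2⁻¹ with hidef
  have hi2 : (w.2 ^ 2)⁻¹ = i ^ 2 := by rw [hidef, inv_pow]
  simp only [hi2]
  module

lemma fderiv_frameTensorSnd (x y s : V × ℝ) :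
    fderiv ℝ (fun w' ↦ frameTensorSnd h A w' y s) w x = covFrameTensorSnd h A w x y s
      + frameTensorSnd h A w (christoffelL h w.1 x.1 y.1, 0) s
      + frameTensorSnd h A w y (christoffelL h w.1 x.1 s.1, 0) := by
  have h0 : HasFDerivAt (fun w' : V × ℝ ↦ w'.2) (ContinuousLinearMap.snd ℝ V ℝ) w :=
    hasFDerivAt_snd
  have h2 : HasFDerivAt (fun w' : V × ℝ ↦ w'.2⁻¹) _ w := (hasDerivAt_inv hw).comp_hasFDerivAt w h0
  have hAs : ∀ s : V, HasFDerivAt (fun w' : V × ℝ ↦ A w'.1 s) _ w := fun s ↦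
    ((hA.differentiableAt (by simp)).hasFDerivAt.comp w hasFDerivAt_fst).clm_apply
      (hasFDerivAt_const s w)
  have hh0 : HasFDerivAt (fun w' : V × ℝ ↦ h w'.1) _ w :=
    (hh.differentiableAt (by simp)).hasFDerivAt.comp w hasFDerivAt_fst
  have hK : ∀ t : V, HasFDerivAt (fun w' : V × ℝ ↦ hodgeL h A w'.1 t) _ w := fun t ↦
    (((contDiffAt_hodgeL le_rfl hh hi hA).differentiableAt (by simp)).hasFDerivAt.comp w
      hasFDerivAt_fst).clm_apply (hasFDerivAt_const t w)
  have hfull : HasFDerivAt (fun w' : V × ℝ ↦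
      -(w'.2⁻¹ * y.2 * (s.2 - A w'.1 s.1)) + w'.2⁻¹ ^ 2 * A w'.1 s.1 * A w'.1 y.1
      - w'.2 ^ 2 * h w'.1 y.1 s.1 + h w'.1 (hodgeL h A w'.1 y.1) s.1) _ w :=
    ((((h2.mul_const y.2).mul ((hasFDerivAt_const s.2 w).sub (hAs s.1))).neg.add
      (((h2.pow 2).mul (hAs s.1)).mul (hAs y.1))).sub
      ((h0.pow 2).mul ((hh0.clm_apply (hasFDerivAt_const y.1 w)).clm_apply
        (hasFDerivAt_const s.1 w)))).add
      ((hh0.clm_apply (hK y.1)).clm_apply (hasFDerivAt_const s.1 w))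
  have e1 : ∀ t, fderiv ℝ A w.1 x.1 t = covForm h A w.1 x.1 t + A w.1 (christoffelL h w.1 x.1 t) := by
    intro t; rw [covForm]; ring
  have e3 : ∀ t, fderiv ℝ (hodgeL h A) w.1 x.1 t = covHodge h A w.1 x.1 t
      - christoffelL h w.1 x.1 (hodgeL h A w.1 t) + hodgeL h A w.1 (christoffelL h w.1 x.1 t) := by
    intro t; rw [covHodge]; abel
  have e4 := fderiv_metric (hh.differentiableAt (by simp)) hs hi
  simp only [← christoffelL_apply] at e4
  have hF : fderiv ℝ (fun w' ↦ frameTensorSnd h A w' y s) w x = _ :=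
    DFunLike.congr_fun hfull.fderiv x
  rw [hF]
  simp [e1, e3, e4]
  simp only [frameTensorSnd, covFrameTensorSnd]
  set i := w.2⁻¹ with hidef
  have hi2 : (w.2 ^ 2)⁻¹ = i ^ 2 := by rw [hidef, inv_pow]
  simp only [hi2]
  ring

end derivatives

end LocalBeltrami
end BeltramiSoliton

namespace BeltramiSoliton

/-! ### Curvature in the frame, and its trace. -/

section LocalBeltrami

variable {V : Type*} [NormedAddCommGroup V] [NormedSpace ℝ V] [FiniteDimensional ℝ V]

/-- The tensorial part of the Levi-Civita connection in the frame `liftFrame`. -/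
def frameTensor (h : V → V →L[ℝ] V →L[ℝ] ℝ) (A : V → V →L[ℝ] ℝ) (w x s : V × ℝ) : V × ℝ :=
  (frameTensorFst h A w x s, frameTensorSnd h A w x s)

section curvature

variable {h : V → V →L[ℝ] V →L[ℝ] ℝ} {A : V → V →L[ℝ] ℝ} {w : V × ℝ}
  (hh : ContDiffAt ℝ ∞ h w.1) (hA : ContDiffAt ℝ ∞ A w.1) (hw : w.2 ≠ 0)
  (hi : (h w.1).IsInvertible) (hs : ∀ᶠ u in 𝓝 w.1, ∀ v v', h u v v' = h u v' v)
include hh hA hw hi hs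

lemma fderiv_frameConn (x y s : V × ℝ) :
    fderiv ℝ (frameConn h A) w x y s =
      (fderiv ℝ (christoffelL h) w.1 x.1 y.1 s.1 + covFrameTensorFst h A w x y s
        + frameTensorFst h A w (christoffelL h w.1 x.1 y.1, 0) s
        + frameTensorFst h A w y (christoffelL h w.1 x.1 s.1, 0)
        - christoffelL h w.1 x.1 (frameTensorFst h A w y s),
      covFrameTensorSnd h A w x y s
        + frameTensorSnd h A w (christoffelL h w.1 x.1 y.1, 0) s
        + frameTensorSnd h A w y (christoffelL h w.1 x.1 s.1, 0)) := by
  have hd : DifferentiableAt ℝ (frameConn h A) w :=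
    (contDiffAt_frameConn le_rfl hh hA hw hi).differentiableAt (by simp)
  have hdΓ : DifferentiableAt ℝ (christoffelL h) w.1 :=
    (contDiffAt_christoffelL le_rfl hh hi).differentiableAt (by simp)
  have hev : (fun w' ↦ frameConn h A w' y s) =ᶠ[𝓝 w] fun w' ↦
      (christoffelL h w'.1 y.1 s.1 + frameTensorFst h A w' y s, frameTensorSnd h A w' y s) := by
    have c1 : ContinuousAt (fun w' : V × ℝ ↦ w'.1) w := continuousAt_fst
    have e1 := c1.eventually ((hh.of_le one_le_infty).eventually (by simp))
    have e2 := c1.eventually ((hA.of_le one_le_infty).eventually (by simp))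
    have e3 := c1.eventually (eventually_isInvertible hh.continuousAt hi)
    have e4 : ∀ᶠ w' : V × ℝ in 𝓝 w, w'.2 ≠ 0 := continuousAt_snd.eventually_ne hw
    filter_upwards [e1, e2, e3, e4] with w' h1 h2 h3 h4
    exact frameConn_eq h1 h2 h4 h3 y s
  have hΓ : HasFDerivAt (fun w' : V × ℝ ↦ christoffelL h w'.1 y.1 s.1) _ w :=
    ((hdΓ.hasFDerivAt.comp w hasFDerivAt_fst).clm_apply (hasFDerivAt_const y.1 w)).clm_apply
      (hasFDerivAt_const s.1 w)
  have hc : DifferentiableAt ℝ (fun w' ↦ frameConn h A w' y s) w :=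
    (hd.clm_apply (differentiableAt_const y)).clm_apply (differentiableAt_const s)
  have hc' := hc.congr_of_eventuallyEq hev.symm
  have h2 : DifferentiableAt ℝ (fun w' ↦ frameTensorSnd h A w' y s) w := hc'.snd
  -- Differentiability of the tensorial part is inherited by difference from the whole connection
  -- and the base Christoffel symbols.
  have h1 : DifferentiableAt ℝ (fun w' ↦ frameTensorFst h A w' y s) w := by
    refine (hc'.fst.sub hΓ.differentiableAt).congr_of_eventuallyEq (.of_forall fun w' ↦ ?_)
    simp
  have h3 : HasFDerivAt (fun w' : V × ℝ ↦
      (christoffelL h w'.1 y.1 s.1 + frameTensorFst h A w' y s, frameTensorSnd h A w' y s)) _ w :=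
    (hΓ.add h1.hasFDerivAt).prodMk h2.hasFDerivAt
  rw [← fderiv_clm_apply₂ hd, hev.fderiv_eq, h3.fderiv]
  have e1 := fderiv_frameTensorFst hh hA hw hi hs x y s
  have e2 := fderiv_frameTensorSnd hh hA hw hi hs x y s
  refine Prod.ext ?_ ?_
  · simp [e1]
    abel
  · simp [e2]

lemma frameTensorFst_add (x s s' : V × ℝ) : frameTensorFst h A w x (s + s') =
    frameTensorFst h A w x s + frameTensorFst h A w x s' := by
  simp only [frameTensorFst, Prod.fst_add, Prod.snd_add, map_add]
  module

lemma frameTensorSnd_add (x s s' : V × ℝ) : frameTensorSnd h A w x (s + s') =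
    frameTensorSnd h A w x s + frameTensorSnd h A w x s' := by
  simp only [frameTensorSnd, Prod.fst_add, Prod.snd_add, map_add]
  ring

/-- Curvature of a connection plus a tensor `T`: base curvature, antisymmetrised covariant
derivative of `T`, commutator of `T`. The Christoffel corrections in the direction slot cancel
because the base connection is torsion free (`hsym`), the others against the cross terms of the
connection with `T`. -/
lemma curvForm_frameConn (x y s : V × ℝ) :
    curvForm (frameConn h A) w x y s =
      (curvForm (christoffelL h) w.1 x.1 y.1 s.1
        + (covFrameTensorFst h A w x y s - covFrameTensorFst h A w y x s
        + frameTensorFst h A w x (frameTensor h A w y s)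
        - frameTensorFst h A w y (frameTensor h A w x s)),
      covFrameTensorSnd h A w x y s - covFrameTensorSnd h A w y x s
        + frameTensorSnd h A w x (frameTensor h A w y s)
        - frameTensorSnd h A w y (frameTensor h A w x s)) := by
  have hsym : christoffelL h w.1 y.1 x.1 = christoffelL h w.1 x.1 y.1 := by
    rw [christoffelL_apply, christoffelL_apply,
      christoffel_symm (hh.differentiableAt (by simp)) hs]
  have hc := frameConn_eq (hh.of_le one_le_infty) (hA.of_le one_le_infty) hw hi
  have hc' : ∀ x s, frameConn h A w x s =
      (christoffelL h w.1 x.1 s.1, 0) + frameTensor h A w x s := by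
    intro x s
    rw [hc]
    simp [frameTensor]
  have e1 := frameTensorFst_add hh hA hw hi hs
  have e2 := frameTensorSnd_add hh hA hw hi hs
  rw [curvForm, fderiv_frameConn hh hA hw hi hs, fderiv_frameConn hh hA hw hi hs, hsym,
    hc x (frameConn h A w y s), hc y (frameConn h A w x s), hc' y s, hc' x s, e1, e1, e2, e2, curvForm]
  refine Prod.ext ?_ ?_
  · simp [frameTensor]
    abel
  · simp
    ring

end curvature

set_option maxHeartbeats 2000000 in
/-- The algebraic identity behind the computation of the Ricci tensor of `liftMetric h A`. -/
lemma frame_trace {h : V → V →L[ℝ] V →L[ℝ] ℝ} {A : V → V →L[ℝ] ℝ} {w : V × ℝ} (hw : w.2 ≠ 0)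
    (e : Fin 3 → V) (l : Fin 3 → V →ₗ[ℝ] ℝ) (hle : ∀ i j, l i (e j) = if i = j then 1 else 0)
    {n b00 b11 b01 b02 b12 : ℝ}
    (hh : ∀ v v', h w.1 v v' = l 0 v * l 0 v' + l 1 v * l 1 v' + l 2 v * l 2 v')
    (hA : ∀ v, A w.1 v = n * l 2 v)
    (ha0 : l 0 (sharpL h A w.1) = 0) (ha1 : l 1 (sharpL h A w.1) = 0)
    (ha2 : l 2 (sharpL h A w.1) = n)
    (hK0 : ∀ v, l 0 (hodgeL h A w.1 v) = -(n * l 1 v))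
    (hK1 : ∀ v, l 1 (hodgeL h A w.1 v) = n * l 0 v)
    (hK2 : ∀ v, l 2 (hodgeL h A w.1 v) = 0)
    (hb0 : ∀ v, l 0 (covSharp h A w.1 v) = b00 * l 0 v + (b01 + 2 * n) * l 1 v + b02 * l 2 v)
    (hb1 : ∀ v, l 1 (covSharp h A w.1 v) = b01 * l 0 v + b11 * l 1 v + b12 * l 2 v)
    (hb2 : ∀ v, l 2 (covSharp h A w.1 v) = b02 * l 0 v + b12 * l 1 v - (b00 + b11) * l 2 v)
    (hB : ∀ v v', covForm h A w.1 v v' = l 0 (covSharp h A w.1 v) * l 0 v'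
      + l 1 (covSharp h A w.1 v) * l 1 v' + l 2 (covSharp h A w.1 v) * l 2 v')
    (hL0 : ∀ v v', l 0 (covHodge h A w.1 v v') =
      l 1 (covSharp h A w.1 v) * l 2 v' - l 2 (covSharp h A w.1 v) * l 1 v')
    (hL1 : ∀ v v', l 1 (covHodge h A w.1 v v') =
      l 2 (covSharp h A w.1 v) * l 0 v' - l 0 (covSharp h A w.1 v) * l 2 v')
    (hL2 : ∀ v v', l 2 (covHodge h A w.1 v v') =
      l 0 (covSharp h A w.1 v) * l 1 v' - l 1 (covSharp h A w.1 v) * l 0 v')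
    (y s : V × ℝ) :
    (∑ k, l k (covFrameTensorFst h A w (liftFrame A w (e k, 0)) y s
        - covFrameTensorFst h A w y (liftFrame A w (e k, 0)) s
        + frameTensorFst h A w (liftFrame A w (e k, 0)) (frameTensor h A w y s)
        - frameTensorFst h A w y (frameTensor h A w (liftFrame A w (e k, 0)) s)))
      + (covFrameTensorSnd h A w (liftFrame A w (0, 1)) y s
        - covFrameTensorSnd h A w y (liftFrame A w (0, 1)) s
        + frameTensorSnd h A w (liftFrame A w (0, 1)) (frameTensor h A w y s)
        - frameTensorSnd h A w y (frameTensor h A w (liftFrame A w (0, 1)) s))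
      = -2 * h w.1 y.1 s.1 := by
  -- In the coordinates `l i`, the hypotheses turn both sides into rational functions of `ρ`, `n`,
  -- the components of `y` and `s`, and the five free entries `b..` of the covariant derivative of
  -- `A`; the claim is then an identity between them.
  rw [Fin.sum_univ_three]
  simp only [covFrameTensorFst, covFrameTensorSnd, frameTensor, frameTensorFst, frameTensorSnd,
    thetaL_liftFrame A hw]
  simp only [liftFrame_apply, thetaL_apply, LinearMap.map_add, LinearMap.map_sub,
    LinearMap.map_smul, smul_eq_mul, hh, hA, ha0,
    ha1, ha2, hK0, hK1, hK2, hB, hL0, hL1, hL2, hb0, hb1, hb2, hle, LinearMap.map_zero]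
  simp only [Fin.isValue, if_true, Fin.reduceEq, if_false]
  field_simp
  ring

end LocalBeltrami
end BeltramiSoliton

namespace BeltramiSoliton

/-! ### Covariant derivatives of a Beltrami field, and the Ricci tensor of the lifted metric. -/

section LocalBeltrami

variable {V : Type*} [NormedAddCommGroup V] [NormedSpace ℝ V] [FiniteDimensional ℝ V]

section covariant

variable {h : V → V →L[ℝ] V →L[ℝ] ℝ} {A : V → V →L[ℝ] ℝ} {u : V}
  (hh : ContDiffAt ℝ ∞ h u) (hA : ContDiffAt ℝ ∞ A u)
  (hi : (h u).IsInvertible) (hs : ∀ᶠ u' in 𝓝 u, ∀ v v', h u' v v' = h u' v' v)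
include hh hi hs

lemma fderiv_metric_apply {f g : V → V} (hf : DifferentiableAt ℝ f u) (hg : DifferentiableAt ℝ g u)
    (x : V) : fderiv ℝ (fun u' ↦ h u' (f u') (g u')) u x =
      h u (fderiv ℝ f u x + christoffelL h u x (f u)) (g u)
      + h u (f u) (fderiv ℝ g u x + christoffelL h u x (g u)) := by
  have hd := hh.differentiableAt (by simp)
  have h1 : HasFDerivAt (fun u' ↦ h u' (f u') (g u')) _ u :=
    (hd.hasFDerivAt.clm_apply hf.hasFDerivAt).clm_apply hg.hasFDerivAt
  have h2 := fderiv_metric hd hs hi x (f u) (g u)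
  rw [h1.fderiv]
  simp only [← christoffelL_apply] at h2
  simp [h2]
  ring

include hA

lemma differentiableAt_hodgeL_apply (s : V) : DifferentiableAt ℝ (fun u' ↦ hodgeL h A u' s) u :=
  ((contDiffAt_hodgeL le_rfl hh hi hA).differentiableAt (by simp)).clm_apply
    (differentiableAt_const s)

lemma fderiv_hodgeL_apply (x s : V) : fderiv ℝ (fun u' ↦ hodgeL h A u' s) u x
    + christoffelL h u x (hodgeL h A u s) =
      covHodge h A u x s + hodgeL h A u (christoffelL h u x s) := by
  have h1 : HasFDerivAt (fun u' ↦ hodgeL h A u' s) _ u :=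
    ((contDiffAt_hodgeL le_rfl hh hi hA).differentiableAt (by simp)).hasFDerivAt.clm_apply
      (hasFDerivAt_const s u)
  rw [h1.fderiv, covHodge]
  simp

/-- A metric connection commutes with the passage from `A` to its dual vector: differentiate `h(A♯,
t) = A(t)`. -/
lemma apply_covSharp (x t : V) : h u (covSharp h A u x) t = covForm h A u x t := by
  have hev : (fun u' ↦ h u' (sharpL h A u') t) =ᶠ[𝓝 u] fun u' ↦ A u' t := by
    filter_upwards [eventually_isInvertible hh.continuousAt hi] with u' h1 using apply_sharpL h1 t
  have h1 : HasFDerivAt (fun u' ↦ A u' t) _ u :=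
    (hA.differentiableAt (by simp)).hasFDerivAt.clm_apply (hasFDerivAt_const t u)
  have h2 := fderiv_metric_apply hh hi hs ((contDiffAt_sharpL hh hi hA).differentiableAt (by simp))
    (differentiableAt_const t) x
  rw [hev.fderiv_eq, h1.fderiv] at h2
  simp at h2
  rw [covSharp, covForm, h2, map_add, add_apply, apply_sharpL hi]
  ring

lemma hodgeL_skew (s t : V) : h u (hodgeL h A u s) t = -(h u (hodgeL h A u t) s) := by
  rw [apply_hodgeL hi, apply_hodgeL hi, coordExtDeriv, coordExtDeriv]
  ring

lemma christoffelL_symm (x t : V) : christoffelL h u x t = christoffelL h u t x := by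
  rw [christoffelL_apply, christoffelL_apply,
    christoffel_symm (hh.differentiableAt (by simp)) hs]

/-- For a torsion-free connection the skew part of the covariant derivative of `A` is `dA`, and `dA
= -2 h(K ·, ·)` by the definition of `hodgeL`. -/
lemma covForm_sub (x t : V) : covForm h A u x t - covForm h A u t x =
    -2 * h u (hodgeL h A u x) t := by
  rw [covForm, covForm, apply_hodgeL hi, christoffelL_symm hh hA hi hs x t, coordExtDeriv]
  ring

lemma covHodge_skew (x s t : V) : h u (covHodge h A u x s) t = -(h u (covHodge h A u x t) s) := by
  have hev : (fun u' ↦ h u' (hodgeL h A u' s) t) =ᶠ[𝓝 u]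
      fun u' ↦ -(h u' (hodgeL h A u' t) s) := by
    filter_upwards [eventually_isInvertible hh.continuousAt hi] with u' h1
    rw [apply_hodgeL h1, apply_hodgeL h1, coordExtDeriv, coordExtDeriv]
    ring
  have h1 := congrArg (fun T : V →L[ℝ] ℝ ↦ T x) hev.fderiv_eq
  simp only [fderiv_fun_neg, neg_apply] at h1
  rw [fderiv_metric_apply hh hi hs (differentiableAt_hodgeL_apply hh hA hi hs s)
    (differentiableAt_const t), fderiv_metric_apply hh hi hs
    (differentiableAt_hodgeL_apply hh hA hi hs t) (differentiableAt_const s),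
    fderiv_hodgeL_apply hh hA hi hs, fderiv_hodgeL_apply hh hA hi hs] at h1
  simp only [fderiv_fun_const, Pi.zero_apply, zero_apply, zero_add, map_add, add_apply] at h1
  have h2 := hodgeL_skew hh hA hi hs (christoffelL h u x s) t
  have h3 := hodgeL_skew hh hA hi hs (christoffelL h u x t) s
  linarith

/-- The covariant derivative of the identity for `h(Ks, Kt)`. It gives access to `∇K` in terms of
`∇A` without a volume form: where `A ≠ 0`, together with skewness, it determines `∇K` completely. -/
lemma covHodge_sq (hodge : ∀ᶠ u' in 𝓝 u, ∀ s t, h u' (hodgeL h A u' s) (hodgeL h A u' t) =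
      A u' (sharpL h A u') * h u' s t - A u' s * A u' t) (x s t : V) :
    h u (covHodge h A u x s) (hodgeL h A u t) + h u (hodgeL h A u s) (covHodge h A u x t) =
      2 * A u (covSharp h A u x) * h u s t - covForm h A u x s * A u t
        - A u s * covForm h A u x t := by
  have hev : (fun u' ↦ h u' (hodgeL h A u' s) (hodgeL h A u' t)) =ᶠ[𝓝 u]
      fun u' ↦ h u' (sharpL h A u') (sharpL h A u') * h u' s t - A u' s * A u' t := by
    filter_upwards [hodge, eventually_isInvertible hh.continuousAt hi] with u' h1 h2
    rw [h1, apply_sharpL h2]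
  have h1 := congrArg (fun T : V →L[ℝ] ℝ ↦ T x) hev.fderiv_eq
  have ds := (contDiffAt_sharpL hh hi hA).differentiableAt (by simp)
  have dh := hh.differentiableAt (by simp)
  have dst : DifferentiableAt ℝ (fun u' ↦ h u' s t) u :=
    (dh.clm_apply (differentiableAt_const s)).clm_apply (differentiableAt_const t)
  have daa : DifferentiableAt ℝ (fun u' ↦ h u' (sharpL h A u') (sharpL h A u')) u :=
    (dh.clm_apply ds).clm_apply ds
  have dA : ∀ s, DifferentiableAt ℝ (fun u' ↦ A u' s) u := fun s ↦
    (hA.differentiableAt (by simp)).clm_apply (differentiableAt_const s)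
  have dA' : ∀ s, fderiv ℝ (fun u' ↦ A u' s) u x =
      covForm h A u x s + A u (christoffelL h u x s) := by
    intro s
    have h1 : HasFDerivAt (fun u' ↦ A u' s) _ u :=
      (hA.differentiableAt (by simp)).hasFDerivAt.clm_apply (hasFDerivAt_const s u)
    rw [h1.fderiv, covForm]
    simp
  have e1 : fderiv ℝ (fun u' ↦ h u' (sharpL h A u') (sharpL h A u') * h u' s t - A u' s * A u' t) u =
      _ := ((daa.hasFDerivAt.mul dst.hasFDerivAt).sub
        ((dA s).hasFDerivAt.mul (dA t).hasFDerivAt)).fderiv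
  simp only [e1, sub_apply, add_apply, smul_apply, smul_eq_mul] at h1
  rw [fderiv_metric_apply hh hi hs (differentiableAt_hodgeL_apply hh hA hi hs s)
    (differentiableAt_hodgeL_apply hh hA hi hs t), fderiv_hodgeL_apply hh hA hi hs,
    fderiv_hodgeL_apply hh hA hi hs, dA', dA', fderiv_metric_apply hh hi hs ds ds,
    fderiv_metric_apply hh hi hs (differentiableAt_const s) (differentiableAt_const t)] at h1
  have hsym := hs.self_of_nhds
  have h2 : fderiv ℝ (sharpL h A) u x + christoffelL h u x (sharpL h A u) = covSharp h A u x := rfl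
  rw [h2, hsym (covSharp h A u x), apply_sharpL hi] at h1
  simp only [fderiv_fun_const, Pi.zero_apply, zero_apply, zero_add, map_add, add_apply] at h1
  have h3 := hodge.self_of_nhds (christoffelL h u x s) t
  have h4 := hodge.self_of_nhds s (christoffelL h u x t)
  rw [apply_sharpL hi (covSharp h A u x)] at h1
  linear_combination h1 - h3 - h4

/-- This is `d(dA) = 0`: the cyclic sum of the second derivatives of `A` vanishes by their symmetry,
and the Christoffel terms cancel by the skewness of `K` and the symmetry of the connection. -/
lemma covHodge_cyclic (x s t : V) : h u (covHodge h A u x s) t + h u (covHodge h A u s t) x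
    + h u (covHodge h A u t x) s = 0 := by
  have dA : DifferentiableAt ℝ (fderiv ℝ A) u :=
    (hA.fderiv_right (m := ∞) le_rfl).differentiableAt (by simp)
  have key : ∀ x s t : V, h u (covHodge h A u x s) t + h u (hodgeL h A u (christoffelL h u x s)) t
      + h u (hodgeL h A u s) (christoffelL h u x t) =
      -(1 / 2) * (fderiv ℝ (fderiv ℝ A) u x s t - fderiv ℝ (fderiv ℝ A) u x t s) := by
    intro x s t
    have hev : (fun u' ↦ h u' (hodgeL h A u' s) t) =ᶠ[𝓝 u]
        fun u' ↦ -(1 / 2) * (fderiv ℝ A u' s t - fderiv ℝ A u' t s) := by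
      filter_upwards [eventually_isInvertible hh.continuousAt hi] with u' h1
      rw [apply_hodgeL h1, coordExtDeriv]
    have h1 := congrArg (fun T : V →L[ℝ] ℝ ↦ T x) hev.fderiv_eq
    have d : ∀ s t, HasFDerivAt (fun u' ↦ fderiv ℝ A u' s t) _ u := fun s t ↦
      (dA.hasFDerivAt.clm_apply (hasFDerivAt_const s u)).clm_apply (hasFDerivAt_const t u)
    have e1 : fderiv ℝ (fun u' ↦ -(1 / 2) * (fderiv ℝ A u' s t - fderiv ℝ A u' t s)) u = _ :=
      (((d s t).sub (d t s)).const_mul (-(1 / 2))).fderiv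
    simp only [e1] at h1
    rw [fderiv_metric_apply hh hi hs (differentiableAt_hodgeL_apply hh hA hi hs s)
      (differentiableAt_const t), fderiv_hodgeL_apply hh hA hi hs] at h1
    simp at h1
    linarith
  have hsym : ∀ x y, fderiv ℝ (fderiv ℝ A) u x y = fderiv ℝ (fderiv ℝ A) u y x :=
    hA.isSymmSndFDerivAt (by simpa using two_le_infty)
  have e1 := key x s t
  have e2 := key s t x
  have e3 := key t x s
  rw [hsym s x] at e2
  rw [hsym t x, hsym t s] at e3
  rw [christoffelL_symm hh hA hi hs s x] at e2
  rw [christoffelL_symm hh hA hi hs t x, christoffelL_symm hh hA hi hs t s] at e3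
  have f1 := hodgeL_skew hh hA hi hs t (christoffelL h u x s)
  have f2 := hodgeL_skew hh hA hi hs x (christoffelL h u s t)
  have f3 := hodgeL_skew hh hA hi hs s (christoffelL h u x t)
  linarith

end covariant

/-- The Ricci tensor of the metric `ρ² h + ρ⁻² (ρ dρ + A)²`, for a Beltrami field `A`. -/
theorem coordRicci_liftMetric {h : V → V →L[ℝ] V →L[ℝ] ℝ} {A : V → V →L[ℝ] ℝ} {w : V × ℝ}
    (hw : w.2 ≠ 0) (hh : ContDiffAt ℝ ∞ h w.1) (hA : ContDiffAt ℝ ∞ A w.1)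
    (hi : (h w.1).IsInvertible) (hs : ∀ᶠ u in 𝓝 w.1, ∀ v v', h u v v' = h u v' v)
    (hodge : ∀ᶠ u in 𝓝 w.1, ∀ s t, h u (hodgeL h A u s) (hodgeL h A u t) =
      A u (sharpL h A u) * h u s t - A u s * A u t)
    (e : Module.Basis (Fin 3) ℝ V) (he : ∀ i j, h w.1 (e i) (e j) = if i = j then 1 else 0)
    {n : ℝ} (hn : n ≠ 0) (hA0 : A w.1 (e 0) = 0) (hA1 : A w.1 (e 1) = 0) (hA2 : A w.1 (e 2) = n)
    (hd : coordExtDeriv A w.1 (e 0) (e 1) = -2 * n) (x y : V × ℝ) :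
    coordRicci (liftMetric h A) w x y = coordRicci h w.1 x.1 y.1 - 2 * h w.1 x.1 y.1 := by
  set u := w.1 with hu
  have hsym := hs.self_of_nhds
  let l : Fin 3 → V →ₗ[ℝ] ℝ := e.coord
  have hsum : ∀ v : V, v = l 0 v • e 0 + l 1 v • e 1 + l 2 v • e 2 := by
    intro v
    have := e.sum_repr v
    rw [Fin.sum_univ_three] at this
    exact this.symm
  have hle : ∀ i j, l i (e j) = if i = j then 1 else 0 := by
    intro i j
    simp [l, Finsupp.single_apply, eq_comm]
  have hl : ∀ v i, h u v (e i) = l i v := by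
    intro v i
    conv_lhs => rw [hsum v]
    simp only [map_add, map_smul, add_apply, smul_apply, he]
    fin_cases i <;> simp
  have hl' : ∀ v i, h u (e i) v = l i v := fun v i ↦ by rw [hsym, hl]
  have hhh : ∀ v v', h u v v' = l 0 v * l 0 v' + l 1 v * l 1 v' + l 2 v * l 2 v' := by
    intro v v'
    conv_lhs => rw [hsum v]
    simp only [map_add, map_smul, add_apply, smul_apply, hl', smul_eq_mul]
  have hAv : ∀ v, A u v = n * l 2 v := by
    intro v
    conv_lhs => rw [hsum v]
    simp only [map_add, map_smul, hA0, hA1, hA2, smul_eq_mul]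
    ring
  have ha : ∀ i, l i (sharpL h A u) = A u (e i) := fun i ↦ by rw [← hl, apply_sharpL hi]
  have hskew := hodgeL_skew hh hA hi hs
  -- The identity `hodge` at `(e 2, e 2)` says that `|K e₂|² = n² - n² = 0`.
  have hK2' : ∀ i, l i (hodgeL h A u (e 2)) = 0 := by
    have h1 := hodge.self_of_nhds (e 2) (e 2)
    rw [hhh (hodgeL h A u (e 2)), he 2 2, hAv (sharpL h A u), ha, hA2] at h1
    simp only [if_true] at h1
    have h0 : l 0 (hodgeL h A u (e 2)) * l 0 (hodgeL h A u (e 2))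
      + l 1 (hodgeL h A u (e 2)) * l 1 (hodgeL h A u (e 2))
      + l 2 (hodgeL h A u (e 2)) * l 2 (hodgeL h A u (e 2)) = 0 := by linarith
    intro i
    fin_cases i <;>
    · simp only [Fin.zero_eta, Fin.mk_one, Fin.reduceFinMk]
      nlinarith [sq_nonneg (l 0 (hodgeL h A u (e 2))), sq_nonneg (l 1 (hodgeL h A u (e 2))),
        sq_nonneg (l 2 (hodgeL h A u (e 2)))]
  have hK01 : h u (hodgeL h A u (e 0)) (e 1) = n := by
    rw [apply_hodgeL hi, hd]; ring
  have hK00 : ∀ v, h u (hodgeL h A u v) v = 0 := fun v ↦ by linarith [hskew v v]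
  have hK2 : ∀ v, l 2 (hodgeL h A u v) = 0 := by
    intro v
    rw [← hl, hskew, hhh, hK2', hK2', hK2']
    ring
  have hK0 : ∀ v, l 0 (hodgeL h A u v) = -(n * l 1 v) := by
    intro v
    have h1 := hK00 (e 0)
    rw [hl] at h1 hK01
    rw [← hl, hskew, hhh, h1, hK01, hK2]
    ring
  have hK1 : ∀ v, l 1 (hodgeL h A u v) = n * l 0 v := by
    intro v
    have h1 := hK00 (e 1)
    have h2 := hskew (e 0) (e 1)
    rw [hK01, hl] at h2
    rw [hl] at h1
    rw [← hl, hskew, hhh, h1, hK2]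
    rw [show l 0 (hodgeL h A u (e 1)) = -n by linarith]
    ring
  have hβ : ∀ v i, l i (covSharp h A u v) = covForm h A u v (e i) := fun v i ↦ by
    rw [← hl, apply_covSharp hh hA hi hs]
  have hBsum : ∀ v t, covForm h A u v t = l 0 v * covForm h A u (e 0) t
      + l 1 v * covForm h A u (e 1) t + l 2 v * covForm h A u (e 2) t := by
    intro v t
    conv_lhs => rw [hsum v]
    simp only [covForm, map_add, map_smul, add_apply, smul_apply, smul_eq_mul]
    ring
  have hsub := covForm_sub hh hA hi hs
  have h01 : covForm h A u (e 1) (e 0) = covForm h A u (e 0) (e 1) + 2 * n := by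
    have h1 := hsub (e 0) (e 1)
    rw [hK01] at h1
    linarith
  have h02 : covForm h A u (e 2) (e 0) = covForm h A u (e 0) (e 2) := by
    have h1 := hsub (e 0) (e 2)
    rw [hl, hK2] at h1
    linarith
  have h12 : covForm h A u (e 2) (e 1) = covForm h A u (e 1) (e 2) := by
    have h1 := hsub (e 1) (e 2)
    rw [hl, hK2] at h1
    linarith
  have hLskew := covHodge_skew hh hA hi hs
  have hLsq := covHodge_sq hh hA hi hs hodge
  -- With `K` known to be `n` times a quarter turn of the plane of `e 0`, `e 1`, each instance of
  -- `covHodge_sq` is `n` times the wanted relation; here `n ≠ 0` is essential. Together, the three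
  -- relations say that `∇K = *∇A`.
  have hL01 : ∀ v, l 1 (covHodge h A u v (e 0)) = l 2 (covSharp h A u v) := by
    intro v
    have h1 := hLsq v (e 0) (e 0)
    rw [hsym (hodgeL h A u (e 0)), hhh (covHodge h A u v (e 0)), hK0, hK1, hK2, hle, hle, he,
      hAv (covSharp h A u v), hA0] at h1
    simp at h1
    have h2 : n * (l 1 (covHodge h A u v (e 0)) - l 2 (covSharp h A u v)) = 0 := by linarith
    rcases mul_eq_zero.1 h2 with h3 | h3
    · exact absurd h3 hn
    · linarith
  have hL12 : ∀ v, l 1 (covHodge h A u v (e 2)) = -(l 0 (covSharp h A u v)) := by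
    intro v
    have h1 := hLsq v (e 0) (e 2)
    rw [hhh (covHodge h A u v (e 0)), hhh (hodgeL h A u (e 0)), hK0, hK1, hK2, hK0, hK1, hK2, hle,
      hle, hle, hle, he, hA0, hA2, ← hβ] at h1
    simp at h1
    have h2 : n * (l 1 (covHodge h A u v (e 2)) + l 0 (covSharp h A u v)) = 0 := by linarith
    rcases mul_eq_zero.1 h2 with h3 | h3
    · exact absurd h3 hn
    · linarith
  have hL02 : ∀ v, l 0 (covHodge h A u v (e 2)) = l 1 (covSharp h A u v) := by
    intro v
    have h1 := hLsq v (e 1) (e 2)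
    rw [hhh (covHodge h A u v (e 1)), hhh (hodgeL h A u (e 1)), hK0, hK1, hK2, hK0, hK1, hK2, hle,
      hle, hle, hle, he, hA1, hA2, ← hβ] at h1
    simp at h1
    have h2 : n * (l 0 (covHodge h A u v (e 2)) - l 1 (covSharp h A u v)) = 0 := by linarith
    rcases mul_eq_zero.1 h2 with h3 | h3
    · exact absurd h3 hn
    · linarith
  have hLii : ∀ v i, l i (covHodge h A u v (e i)) = 0 := by
    intro v i
    have := hLskew v (e i) (e i)
    rw [hl] at this
    linarith
  have hLij : ∀ v i j, l i (covHodge h A u v (e j)) = -(l j (covHodge h A u v (e i))) := by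
    intro v i j
    have := hLskew v (e j) (e i)
    rwa [hl, hl] at this
  have hLv : ∀ v v' i, l i (covHodge h A u v v') = -(l 0 (covHodge h A u v (e i)) * l 0 v'
      + l 1 (covHodge h A u v (e i)) * l 1 v' + l 2 (covHodge h A u v (e i)) * l 2 v') := by
    intro v v' i
    rw [← hl, hLskew, hhh]
  -- With `∇K = *∇A`, the cyclic identity for `e 0`, `e 1`, `e 2` is the vanishing of the trace of
  -- `∇A`, that is, `A` is coclosed.
  have htr : covForm h A u (e 2) (e 2) =
      -(covForm h A u (e 0) (e 0) + covForm h A u (e 1) (e 1)) := by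
    have h1 := covHodge_cyclic hh hA hi hs (e 0) (e 1) (e 2)
    rw [hl, hl, hl, hLij (e 0) 2 1, hL12, hL02, hL01, hβ, hβ, hβ] at h1
    linarith
  have hP : liftFrame A w (liftCoframe A w y) = y := liftFrame_liftCoframe A hw y
  have hG : DifferentiableAt ℝ (christoffelL (liftMetric h A)) w :=
    (contDiffAt_christoffelL le_rfl (contDiffAt_liftMetric hh hA hw)
      (isInvertible_liftMetric hi hw)).differentiableAt (by simp)
  have hN : DifferentiableAt ℝ (christoffelL h) u :=
    (contDiffAt_christoffelL le_rfl hh hi).differentiableAt (by simp)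
  have hev : ∀ᶠ w' in 𝓝 w, ∀ x s, liftFrame A w' (frameConn h A w' x s) =
      christoffel (liftMetric h A) w' x (liftFrame A w' s) + fderiv ℝ (liftFrame A) w' x s := by
    have e4 : ∀ᶠ w' : V × ℝ in 𝓝 w, w'.2 ≠ 0 := continuousAt_snd.eventually_ne hw
    filter_upwards [e4] with w' hw' x s
    rw [frameConn_apply, liftFrame_liftCoframe A hw']
  -- The trace over `V × ℝ` is taken in the basis of the frame space made of `e` and of the unit
  -- vertical vector; its first three terms contain the base Ricci tensor, and `frame_trace`
  -- evaluates all the rest.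
  have hR := coordRicci_eq_sum_frame hG ((contDiffAt_liftFrame hA hw).of_le two_le_infty)
    ((contDiffAt_frameConn le_rfl hh hA hw hi).differentiableAt (by simp)) hev
    (liftFrameEquiv A hw) rfl (e.prod (Module.Basis.singleton Unit ℝ)) x (liftCoframe A w y)
  rw [hP] at hR
  rw [hR, Fintype.sum_sum_type]
  have hpl : ∀ i, (e.prod (Module.Basis.singleton Unit ℝ)) (Sum.inl i) = (e i, 0) := by
    intro i
    refine Prod.ext ?_ ?_ <;> simp
  have hpr : ∀ i, (e.prod (Module.Basis.singleton Unit ℝ)) (Sum.inr i) = (0, 1) := by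
    intro i
    refine Prod.ext ?_ ?_ <;> simp
  simp only [hpl, hpr, curvForm_frameConn hh hA hw hi hs]
  have halg := frame_trace (h := h) (A := A) (w := w) hw e l hle (n := n)
    (b00 := covForm h A u (e 0) (e 0)) (b11 := covForm h A u (e 1) (e 1))
    (b01 := covForm h A u (e 0) (e 1)) (b02 := covForm h A u (e 0) (e 2))
    (b12 := covForm h A u (e 1) (e 2)) hhh hAv (by rw [ha, hA0]) (by rw [ha, hA1])
    (by rw [ha, hA2]) hK0 hK1 hK2
    (fun v ↦ by rw [hβ, hBsum, h01, h02]; ring) (fun v ↦ by rw [hβ, hBsum, h12]; ring)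
    (fun v ↦ by rw [hβ, hBsum, htr]; ring)
    (fun v v' ↦ by rw [← hhh, apply_covSharp hh hA hi hs])
    (fun v v' ↦ by rw [hLv, hLii, hLij v 2 0, hL01, hL02]; ring)
    (fun v v' ↦ by rw [hLv, hLii, hLij v 0 1, hLij v 2 1, hL01, hL12]; ring)
    (fun v v' ↦ by rw [hLv, hLii, hL02, hL12]; ring) x (liftCoframe A w y)
  have hRN := coordRicci_eq_sum hN e x.1 y.1
  rw [hRN, show ∀ a b : ℝ, a - 2 * b = a + -2 * b from fun a b ↦ by ring]
  have hy1 : (liftCoframe A w y).1 = y.1 := rfl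
  rw [hy1] at halg
  rw [← halg]
  have hc1 : ∀ (i : Fin 3) (z : V × ℝ),
      (e.prod (Module.Basis.singleton Unit ℝ)).coord (Sum.inl i) z = e.coord i z.1 := by
    intro i z
    simp
  have hc2 : ∀ (i : Unit) (z : V × ℝ),
      (e.prod (Module.Basis.singleton Unit ℝ)).coord (Sum.inr i) z = z.2 := by
    intro i z
    simp
  simp only [hc1, hc2, hy1, Finset.univ_unique, Finset.sum_singleton, map_add,
    Finset.sum_add_distrib, add_assoc]
  rfl

end LocalBeltrami
end BeltramiSoliton

namespace BeltramiSoliton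

/-! ### Vertical, mixed and horizontal components of the soliton equation. -/

section LocalLie

variable {V : Type*} [NormedAddCommGroup V] [NormedSpace ℝ V] [FiniteDimensional ℝ V]

/-- The vertical-vertical component of the soliton equation, times `ρ⁴`. -/
def solitonVV (A : V → V →L[ℝ] ℝ) (a : ℝ) (E : V × ℝ → V × ℝ) (w : V × ℝ) : ℝ :=
  a * w.2 ^ 2 + w.2 * fderiv ℝ (fun w' ↦ thetaL A w' (E w')) w (0, 1)
    - thetaL A w (E w) + A w.1 (E w).1

/-- The horizontal-vertical component of the soliton equation, times `2 ρ²`. -/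
def solitonHV (h : V → V →L[ℝ] V →L[ℝ] ℝ) (A : V → V →L[ℝ] ℝ) (E : V × ℝ → V × ℝ) (w : V × ℝ)
    (s : V) : ℝ :=
  w.2 ^ 3 * h w.1 s (fderiv ℝ (fun w' ↦ (E w').1) w (0, 1))
    + fderiv ℝ (fun w' ↦ thetaL A w' (E w')) w (s, 0)
    - w.2⁻¹ * A w.1 s * fderiv ℝ (fun w' ↦ thetaL A w' (E w')) w (0, 1)
    + coordExtDeriv A w.1 (E w).1 s

/-- Twice the horizontal component of the soliton equation, where `R` stands for the Ricci tensor
of `h`. -/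
def solitonHH (R : V → V → ℝ) (h : V → V →L[ℝ] V →L[ℝ] ℝ) (A : V → V →L[ℝ] ℝ) (a : ℝ)
    (E : V × ℝ → V × ℝ) (w : V × ℝ) (s t : V) : ℝ :=
  2 * R s t - 4 * h w.1 s t + 2 * a * w.2 ^ 2 * h w.1 s t
    + 2 * (thetaL A w (E w) - A w.1 (E w).1) * h w.1 s t
    + w.2 ^ 2 * (fderiv ℝ h w.1 (E w).1 s t
      + h w.1 (fderiv ℝ (fun w' ↦ (E w').1) w (s, 0)) t
      + h w.1 s (fderiv ℝ (fun w' ↦ (E w').1) w (t, 0)))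
    - w.2 * (A w.1 s * h w.1 (fderiv ℝ (fun w' ↦ (E w').1) w (0, 1)) t
      + A w.1 t * h w.1 s (fderiv ℝ (fun w' ↦ (E w').1) w (0, 1)))

/-- Each vector is the horizontal lift of its base component plus `θ(x)` times `ρ⁻¹ ∂/∂ρ`, so a
symmetric form is a polynomial in `θ(x)` and `θ(y)`. The powers of `ρ` put into `solitonVV`,
`solitonHV` and `solitonHH` give them Laurent coefficients of the required form. -/
lemma soliton_decomposition {h : V → V →L[ℝ] V →L[ℝ] ℝ} {A : V → V →L[ℝ] ℝ} {w : V × ℝ}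
    {E : V × ℝ → V × ℝ} (hh : ContDiffAt ℝ 1 h w.1) (hA : ContDiffAt ℝ 1 A w.1) (hw : w.2 ≠ 0)
    (hs : ∀ v v', h w.1 v v' = h w.1 v' v) (hE : DifferentiableAt ℝ E w) (a : ℝ) (R : V → V → ℝ)
    (x y : V × ℝ) :
    R x.1 y.1 - 2 * h w.1 x.1 y.1 + a * liftMetric h A w x y
        + (1 / 2) * coordLie E (liftMetric h A) w x y =
      1 / 2 * solitonHH R h A a E w x.1 y.1
      + 1 / 2 * w.2⁻¹ ^ 2 * (thetaL A w y * solitonHV h A E w x.1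
        + thetaL A w x * solitonHV h A E w y.1)
      + w.2⁻¹ ^ 4 * (thetaL A w x * thetaL A w y) * solitonVV A a E w := by
  have hd := (contDiffAt_liftMetric hh hA hw).differentiableAt (by norm_num)
  have hD := fderiv_liftMetric (hh.differentiableAt (by norm_num))
    (hA.differentiableAt (by norm_num)) hw hd
  have h0 : HasFDerivAt (fun w' : V × ℝ ↦ w'.2) (ContinuousLinearMap.snd ℝ V ℝ) w :=
    hasFDerivAt_snd
  have hE1 : HasFDerivAt (fun w' ↦ (E w').1) _ w := hE.hasFDerivAt.fst
  have hE2 : HasFDerivAt (fun w' ↦ (E w').2) _ w := hE.hasFDerivAt.snd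
  have hth : HasFDerivAt (fun w' ↦ w'.2 * (E w').2 + A w'.1 (E w').1) _ w :=
    (h0.mul hE2).add (((hA.differentiableAt (by norm_num)).hasFDerivAt.comp w
      hasFDerivAt_fst).clm_apply hE1)
  have e1 : ∀ x, fderiv ℝ (fun w' ↦ (E w').1) w x = (fderiv ℝ E w x).1 := fun x ↦ by
    rw [hE1.fderiv]; rfl
  have e2 : ∀ x : V × ℝ, fderiv ℝ (fun w' ↦ thetaL A w' (E w')) w x =
      w.2 * (fderiv ℝ E w x).2 + (E w).2 * x.2 + A w.1 (fderiv ℝ E w x).1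
        + fderiv ℝ A w.1 x.1 (E w).1 := fun x ↦ by
    have : fderiv ℝ (fun w' ↦ thetaL A w' (E w')) w = _ := hth.fderiv
    rw [this]
    simp
    ring
  have e3 : ∀ x : V × ℝ, fderiv ℝ E w x = fderiv ℝ E w (x.1, 0) + x.2 • fderiv ℝ E w (0, 1) := by
    intro x
    rw [← map_smul, ← map_add]
    congr 1
    refine Prod.ext ?_ ?_ <;> simp
  rw [coordLie, hD, liftMetric_apply, liftMetric_apply, liftMetric_apply, e3 x, e3 y]
  simp only [solitonHH, solitonHV, solitonVV, e1, e2]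
  simp only [coordExtDeriv, thetaL_apply, Prod.fst_add, Prod.smul_fst,
    map_add, map_smul, add_apply, smul_apply,
    smul_eq_mul, map_zero, zero_apply]
  rw [hs (fderiv ℝ E w (0, 1)).1 y.1]
  field_simp
  ring

lemma soliton_iff {h : V → V →L[ℝ] V →L[ℝ] ℝ} {A : V → V →L[ℝ] ℝ} {w : V × ℝ}
    {E : V × ℝ → V × ℝ} (hh : ContDiffAt ℝ 1 h w.1) (hA : ContDiffAt ℝ 1 A w.1) (hw : w.2 ≠ 0)
    (hs : ∀ v v', h w.1 v v' = h w.1 v' v) (hE : DifferentiableAt ℝ E w) (a : ℝ) (R : V → V → ℝ) :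
    (∀ x y : V × ℝ, R x.1 y.1 - 2 * h w.1 x.1 y.1 + a * liftMetric h A w x y
        + (1 / 2) * coordLie E (liftMetric h A) w x y = 0) ↔
      solitonVV A a E w = 0 ∧ (∀ s, solitonHV h A E w s = 0) ∧
        ∀ s t, solitonHH R h A a E w s t = 0 := by
  simp only [soliton_decomposition hh hA hw hs hE a R]
  constructor
  · intro H
    have hHH : ∀ s t, solitonHH R h A a E w s t = 0 := by
      intro s t
      have := H (liftFrame A w (s, 0)) (liftFrame A w (t, 0))
      simp only [thetaL_liftFrame A hw] at this
      simpa [liftFrame_apply] using this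
    have hVV : solitonVV A a E w = 0 := by
      have := H (liftFrame A w (0, 1)) (liftFrame A w (0, 1))
      have h0 : solitonHV h A E w 0 = 0 := by
        simp [solitonHV, coordExtDeriv, show ((0 : V), (0 : ℝ)) = 0 from rfl]
      simp only [thetaL_liftFrame A hw] at this
      simpa [liftFrame_apply, hHH, hw, h0] using this
    refine ⟨hVV, fun s ↦ ?_, hHH⟩
    have := H (liftFrame A w (s, 0)) (liftFrame A w (0, 1))
    simp only [thetaL_liftFrame A hw] at this
    simpa [liftFrame_apply, hHH, hVV, hw] using this
  · rintro ⟨hVV, hHV, hHH⟩ x y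
    simp [hVV, hHV, hHH]

end LocalLie
end BeltramiSoliton

namespace BeltramiSoliton

/-! ### Two-sided power series of a real variable: bounds, termwise derivative, uniqueness. -/

section RealLaurent

variable {E : Type*} [NormedAddCommGroup E] [NormedSpace ℝ E]

/-- The weight `|j| + 1` leaves room for the factor `j` produced by termwise differentiation. -/
lemma summable_natAbs_geometric {q : ℝ} (h0 : 0 ≤ q) (h1 : q < 1) :
    Summable fun j : ℤ ↦ ((j.natAbs : ℝ) + 1) * q ^ j.natAbs := by
  have h : Summable fun n : ℕ ↦ ((n : ℝ) + 1) * q ^ n := by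
    have h2 := summable_pow_mul_geometric_of_norm_lt_one (R := ℝ) 1 (r := q)
      (by rwa [Real.norm_eq_abs, abs_of_nonneg h0])
    have h3 := summable_geometric_of_lt_one h0 h1
    refine (h2.add h3).congr fun n ↦ ?_
    ring
  refine Summable.of_nat_of_neg ?_ ?_ <;> simpa using h

lemma exists_bound_of_summable_zpow {c : ℤ → E} {s : ℝ} (hs : 0 < s)
    (h : Summable fun j : ℤ ↦ s ^ j • c j) : ∃ M, ∀ j, s ^ j * ‖c j‖ ≤ M := by
  have h1 := h.tendsto_cofinite_zero.norm
  rw [norm_zero] at h1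
  obtain ⟨M, hM⟩ := (h1.isBoundedUnder_le).bddAbove_range_of_cofinite
  refine ⟨M, fun j ↦ ?_⟩
  have := hM ⟨j, rfl⟩
  simpa [norm_smul, abs_of_pos hs] using this

/-- A two-sided series that converges at two radii is dominated geometrically in between. -/
lemma exists_geometric_bound {c : ℤ → E} {s₁ s₂ a b : ℝ} (hs : 0 < s₁) (ha : s₁ < a)
    (hab : a ≤ b) (hb : b < s₂) (h₁ : Summable fun j : ℤ ↦ s₁ ^ j • c j)
    (h₂ : Summable fun j : ℤ ↦ s₂ ^ j • c j) :
    ∃ M q, 0 ≤ q ∧ q < 1 ∧ ∀ j : ℤ, ∀ t, a ≤ t → t ≤ b → t ^ j * ‖c j‖ ≤ M * q ^ j.natAbs := by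
  have ha0 : 0 < a := hs.trans ha
  have hb0 : 0 < b := ha0.trans_le hab
  have hs2 : 0 < s₂ := hb0.trans hb
  obtain ⟨M₁, hM₁⟩ := exists_bound_of_summable_zpow hs h₁
  obtain ⟨M₂, hM₂⟩ := exists_bound_of_summable_zpow hs2 h₂
  have hM1 : 0 ≤ M₁ := le_trans (by positivity) (hM₁ 0)
  refine ⟨max M₁ M₂, max (s₁ / a) (b / s₂), by positivity, max_lt ?_ ?_, fun j t hat htb ↦ ?_⟩
  · rwa [div_lt_one ha0]
  · rwa [div_lt_one hs2]
  have ht : 0 < t := ha0.trans_le hat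
  -- Nonnegative powers are compared with the outer radius `s₂`, which gains `(b / s₂) ^ n`;
  -- negative ones with the inner radius `s₁`, which gains `(s₁ / a) ^ n`.
  rcases Int.eq_nat_or_neg j with ⟨n, rfl | rfl⟩
  · calc t ^ (n : ℤ) * ‖c n‖ ≤ b ^ (n : ℤ) * ‖c n‖ := by
          simp only [zpow_natCast]; gcongr
      _ = (s₂ ^ (n : ℤ) * ‖c n‖) * (b / s₂) ^ n := by
          simp only [zpow_natCast, div_pow]; field_simp
      _ ≤ _ := by
          simp only [Int.natAbs_natCast]
          gcongr
          · exact (hM₂ n).trans (le_max_right _ _)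
          · exact le_max_right _ _
  · calc t ^ (-(n : ℤ)) * ‖c (-n)‖ ≤ a ^ (-(n : ℤ)) * ‖c (-n)‖ := by
          simp only [zpow_neg, zpow_natCast]; gcongr
      _ = (s₁ ^ (-(n : ℤ)) * ‖c (-n)‖) * (s₁ / a) ^ n := by
          simp only [zpow_neg, zpow_natCast, div_pow]; field_simp
      _ ≤ _ := by
          simp only [Int.natAbs_neg, Int.natAbs_natCast]
          gcongr
          · exact (hM₁ _).trans (le_max_left _ _)
          · exact le_max_left _ _

/-- A real Laurent series can be differentiated term by term. -/
lemma hasDerivAt_of_hasSum_zpow [CompleteSpace E] {c : ℤ → E} {g : ℝ → E} {r ε : ℝ} (hε : ε ≤ r)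
    (h : ∀ t : ℝ, |t - r| < ε → HasSum (fun j : ℤ ↦ t ^ j • c j) (g t)) {t : ℝ}
    (ht : |t - r| < ε) :
    ∃ g', HasDerivAt g g' t ∧ HasSum (fun j : ℤ ↦ ((j : ℝ) * t ^ (j - 1)) • c j) g' := by
  rw [abs_lt] at ht
  -- Radii `s₁ < a < t < b < s₂` inside the interval of convergence: convergence at `s₁` and `s₂`
  -- dominates the derived series on `(a, b)`. As `ε ≤ r`, all of them are positive.
  obtain ⟨a, ha1, ha2⟩ := exists_between (show r - ε < t by linarith)
  obtain ⟨s₁, hs1, hs2⟩ := exists_between ha1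
  obtain ⟨b, hb1, hb2⟩ := exists_between (show t < r + ε by linarith)
  obtain ⟨s₂, hs3, hs4⟩ := exists_between hb2
  have hs0 : 0 < s₁ := by linarith
  obtain ⟨M, q, hq0, hq1, hM⟩ := exists_geometric_bound hs0 hs2 (ha2.le.trans hb1.le) hs3
    (h s₁ (by rw [abs_lt]; constructor <;> linarith)).summable
    (h s₂ (by rw [abs_lt]; constructor <;> linarith)).summable
  have ha0 : 0 < a := hs0.trans hs2
  have hu : Summable fun j : ℤ ↦ (M / a) * (((j.natAbs : ℝ) + 1) * q ^ j.natAbs) :=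
    (summable_natAbs_geometric hq0 hq1).mul_left _
  have hd : ∀ (j : ℤ), ∀ y ∈ Set.Ioo a b, HasDerivAt (fun t : ℝ ↦ t ^ j • c j)
      (((j : ℝ) * y ^ (j - 1)) • c j) y := fun j y hy ↦
    (hasDerivAt_zpow j y (Or.inl (ha0.trans hy.1).ne')).smul_const _
  have hbd : ∀ (j : ℤ), ∀ y ∈ Set.Ioo a b, ‖((j : ℝ) * y ^ (j - 1)) • c j‖ ≤
      (M / a) * (((j.natAbs : ℝ) + 1) * q ^ j.natAbs) := by
    intro j y hy
    have hy0 : 0 < y := ha0.trans hy.1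
    have h1 := hM j y hy.1.le hy.2.le
    have hM0 : 0 ≤ M * q ^ j.natAbs := le_trans (by positivity) h1
    rw [norm_smul, norm_mul, Real.norm_eq_abs, Real.norm_eq_abs, abs_of_pos (zpow_pos hy0 _),
      zpow_sub_one₀ hy0.ne']
    have h2 : |(j : ℝ)| ≤ (j.natAbs : ℝ) + 1 := by
      rw [Nat.cast_natAbs, Int.cast_abs]; linarith
    calc |(j : ℝ)| * (y ^ j * y⁻¹) * ‖c j‖ = |(j : ℝ)| * (y⁻¹ * (y ^ j * ‖c j‖)) := by ring
      _ ≤ ((j.natAbs : ℝ) + 1) * (a⁻¹ * (M * q ^ j.natAbs)) := by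
          gcongr
          exact hy.1.le
      _ = _ := by ring
  have htm : t ∈ Set.Ioo a b := ⟨ha2, hb1⟩
  have key := hasDerivAt_tsum_of_isPreconnected hu isOpen_Ioo isPreconnected_Ioo hd hbd htm
    (h t (by rw [abs_lt]; constructor <;> linarith)).summable htm
  refine ⟨_, key.congr_of_eventuallyEq ?_, ?_⟩
  · filter_upwards [Ioo_mem_nhds ha2 hb1] with y hy
    exact (h y (by rw [abs_lt]; constructor <;> linarith [hy.1, hy.2])).tsum_eq.symm
  · exact (Summable.of_norm_bounded hu fun j ↦ hbd j t htm).hasSum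

/-- The coefficients of a real Laurent series are determined by its sum near one radius. -/
lemma eq_zero_of_hasSum_zpow {c : ℤ → ℝ} {r ε : ℝ} (hr : 0 < r) (hε : 0 < ε)
    (h : ∀ t : ℝ, |t - r| < ε → HasSum (fun j : ℤ ↦ t ^ j * c j) 0) (k : ℤ) : c k = 0 := by
  wlog hεr : ε < r generalizing ε
  · exact this (ε := min ε (r / 2)) (by positivity)
      (fun t ht ↦ h t (ht.trans_le (min_le_left _ _)))
      ((min_le_right _ _).trans_lt (by linarith))
  set a := r - ε / 3 with ha
  set b := r + ε / 3 with hb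
  have ha0 : 0 < a := by rw [ha]; linarith
  have hb0 : 0 < b := by rw [hb]; linarith
  obtain ⟨M, q, hq0, hq1, hM⟩ := exists_geometric_bound (c := c) (s₁ := r - ε / 2) (a := a) (b := b)
    (s₂ := r + ε / 2) (by linarith) (by linarith) (by linarith) (by linarith)
    (h _ (by rw [abs_lt]; constructor <;> linarith)).summable
    (h _ (by rw [abs_lt]; constructor <;> linarith)).summable
  have hu : Summable fun j : ℤ ↦ M * (((j.natAbs : ℝ) + 1) * q ^ j.natAbs) :=
    (summable_natAbs_geometric hq0 hq1).mul_left _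
  have hbd : ∀ (j : ℤ) t, a ≤ t → t ≤ b → t ^ j * |c j| ≤
      M * (((j.natAbs : ℝ) + 1) * q ^ j.natAbs) := by
    intro j t h1 h2
    have h3 := hM j t h1 h2
    have hM0 : 0 ≤ M * q ^ j.natAbs := le_trans (by positivity [ha0.trans_le h1]) h3
    rw [Real.norm_eq_abs] at h3
    nlinarith [mul_nonneg (Nat.cast_nonneg (α := ℝ) j.natAbs) hM0]
  -- the strip on which the complexified series converges
  set S : Set ℂ := Complex.re ⁻¹' Set.Ioo (Real.log a) (Real.log b) with hS
  have hSo : IsOpen S := isOpen_Ioo.preimage Complex.continuous_re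
  have hSc : IsPreconnected S :=
    ((convex_Ioo _ _).linear_preimage Complex.reLm).isPreconnected
  -- The substitution `ρ = exp w` turns the annulus into a strip. The sum is holomorphic there and
  -- vanishes on a real segment, hence everywhere, in particular on the line `Re w = log r`, which
  -- covers the circle of radius `r`.
  set G : ℤ → ℂ → ℂ := fun j w ↦ (c j : ℂ) * Complex.exp (j * w) with hG
  have hGn : ∀ j w, ‖G j w‖ = Real.exp w.re ^ j * |c j| := by
    intro j w
    rw [hG]
    simp only [norm_mul, Complex.norm_real, Complex.norm_exp, Real.norm_eq_abs]
    rw [mul_comm, ← Real.rpow_intCast, ← Real.exp_mul]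
    simp [mul_comm]
  have hGb : ∀ j, ∀ w ∈ S, ‖G j w‖ ≤ M * (((j.natAbs : ℝ) + 1) * q ^ j.natAbs) := by
    intro j w hw
    rw [hGn]
    refine hbd j _ ?_ ?_
    · rw [← Real.exp_log ha0]; exact Real.exp_le_exp.2 hw.1.le
    · rw [← Real.exp_log hb0]; exact Real.exp_le_exp.2 hw.2.le
  have hdiff := Complex.differentiableOn_tsum_of_summable_norm (F := G) hu
    (fun j ↦ (by rw [hG]; fun_prop)) hSo hGb
  have hlog : ((Real.log r : ℝ) : ℂ) ∈ S := by
    simp only [hS, Set.mem_preimage, Complex.ofReal_re, Set.mem_Ioo]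
    exact ⟨Real.log_lt_log ha0 (by linarith), Real.log_lt_log hr (by linarith)⟩
  have hzero : ∀ x : ℝ, (x : ℂ) ∈ S → ∑' j, G j x = 0 := by
    intro x hx
    simp only [hS, Set.mem_preimage, Complex.ofReal_re, Set.mem_Ioo] at hx
    have h1 : a < Real.exp x := by rw [← Real.log_lt_iff_lt_exp ha0]; exact hx.1
    have h2 : Real.exp x < b := by rw [← Real.lt_log_iff_exp_lt hb0]; exact hx.2
    have h3 := h (Real.exp x) (by rw [abs_lt]; constructor <;> linarith)
    have h4 := (Complex.hasSum_ofReal.2 h3).tsum_eq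
    rw [← Complex.ofReal_zero, ← h4]
    refine tsum_congr fun j ↦ ?_
    rw [hG]
    push_cast
    rw [← Complex.exp_int_mul, mul_comm]
  have hfreq : ∃ᶠ z in 𝓝[≠] ((Real.log r : ℝ) : ℂ), ∑' j, G j z = 0 := by
    have h1 : Filter.Tendsto (fun x : ℝ ↦ (x : ℂ)) (𝓝[≠] (Real.log r))
        (𝓝[≠] ((Real.log r : ℝ) : ℂ)) := by
      refine (Complex.continuous_ofReal.tendsto _).inf ?_
      rw [Filter.tendsto_principal_principal]
      intro x hx
      simpa using hx
    refine h1.frequently (Filter.Eventually.frequently ?_)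
    filter_upwards [mem_nhdsWithin_of_mem_nhds
      (Complex.continuous_ofReal.continuousAt.preimage_mem_nhds (hSo.mem_nhds hlog))] with x hx
    exact hzero x hx
  have hall := (hdiff.analyticOnNhd hSo).eqOn_zero_of_preconnected_of_frequently_eq_zero hSc hlog
    hfreq
  -- Fourier coefficients on the circle of radius `r`
  have : Fact (0 < 2 * Real.pi) := ⟨Real.two_pi_pos⟩
  set d : ℤ → ℂ := fun j ↦ (c j : ℂ) * (r : ℂ) ^ j with hd
  have hdn : Summable fun j ↦ ‖d j‖ := by
    refine Summable.of_nonneg_of_le (fun _ ↦ norm_nonneg _) (fun j ↦ ?_) hu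
    rw [hd]
    simp only [norm_mul, Complex.norm_real, norm_zpow, Real.norm_eq_abs, abs_of_pos hr]
    rw [mul_comm]
    exact hbd j r (by linarith) (by linarith)
  have hsum : Summable fun j ↦ d j • (fourier j : C(AddCircle (2 * Real.pi), ℂ)) := by
    refine Summable.of_norm (hdn.congr fun j ↦ ?_)
    rw [norm_smul, fourier_norm, mul_one]
  have hsum0 : HasSum (fun j ↦ d j • (fourier j : C(AddCircle (2 * Real.pi), ℂ))) 0 := by
    convert hsum.hasSum
    ext x
    induction x using QuotientAddGroup.induction_on with | H x => ?_
    have h1 := (ContinuousMap.hasSum_apply hsum.hasSum (x : AddCircle (2 * Real.pi))).tsum_eq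
    have h2 := hall (show ((Real.log r : ℂ) + x * Complex.I) ∈ S by
      simp only [hS, Set.mem_preimage, Complex.add_re, Complex.ofReal_re, Complex.mul_I_re,
        Complex.ofReal_im, neg_zero, add_zero]
      exact hlog)
    erw [← h1]
    rw [ContinuousMap.zero_apply, ← show _ = (0 : ℂ) from h2]
    refine tsum_congr fun j ↦ ?_
    simp only [hG, hd, ContinuousMap.smul_apply, smul_eq_mul]
    erw [fourier_coe_apply]
    rw [mul_add, Complex.exp_add, mul_assoc, Complex.exp_int_mul, ← Complex.ofReal_exp,
      Real.exp_log hr]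
    congr 3
    push_cast
    have : (Real.pi : ℂ) ≠ 0 := by exact_mod_cast Real.pi_ne_zero
    field_simp
  -- The Fourier series with coefficients `c j * r ^ j` is zero; pairing it in `L²` with the `k`-th
  -- exponential isolates the `k`-th coefficient.
  have h1 := (ContinuousMap.toLp (E := ℂ) 2 AddCircle.haarAddCircle ℂ).hasSum hsum0
  have h2 := (innerSL ℂ (fourierLp (T := 2 * Real.pi) 2 k)).hasSum h1
  have h3 := h2.unique (hasSum_single (f := fun j ↦ innerSL ℂ (fourierLp (T := 2 * Real.pi) 2 k)
    (ContinuousMap.toLp (E := ℂ) 2 AddCircle.haarAddCircle ℂ (d j • fourier j))) k ?_)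
  · have h4 : (innerSL ℂ (fourierLp (T := 2 * Real.pi) 2 k))
        (ContinuousMap.toLp (E := ℂ) 2 AddCircle.haarAddCircle ℂ (d k • fourier k)) = d k := by
      rw [map_smul, map_smul]
      change d k • inner ℂ (fourierLp (T := 2 * Real.pi) 2 k) (fourierLp 2 k) = _
      rw [orthonormal_iff_ite.1 orthonormal_fourier, if_pos rfl, smul_eq_mul, mul_one]
    rw [h4, map_zero, map_zero] at h3
    have := h3.symm
    rw [hd] at this
    simp only [mul_eq_zero, Complex.ofReal_eq_zero] at this
    rcases this with h | h
    · exact h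
    · exact absurd h (zpow_ne_zero _ (by exact_mod_cast hr.ne'))
  · intro j hj
    rw [map_smul, map_smul]
    change d j • inner ℂ (fourierLp (T := 2 * Real.pi) 2 k) (fourierLp 2 j) = _
    rw [orthonormal_iff_ite.1 orthonormal_fourier, if_neg hj.symm, smul_zero]

end RealLaurent

end BeltramiSoliton

namespace BeltramiSoliton

/-! ### Cauchy's formula in a polydisc, and analyticity of maps to spaces of continuous functions.
-/

section SeveralComplexVariables

open MeasureTheory

lemma continuous_torusMap {n : ℕ} (c : Fin n → ℂ) (R : Fin n → ℝ) : Continuous (torusMap c R) := by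
  unfold torusMap
  fun_prop

lemma torusMap_mem_sphere {n : ℕ} (c : Fin n → ℂ) {R : Fin n → ℝ} (hR : ∀ i, 0 < R i)
    (θ : Fin n → ℝ) (i : Fin n) : torusMap c R θ i ∈ Metric.sphere (c i) (R i) := by
  simp [torusMap, abs_of_pos (hR i)]

/-- The Cauchy integral formula in a polydisc. -/
lemma torusIntegral_cauchy {n : ℕ} {f : (Fin n → ℂ) → ℂ} {c : Fin n → ℂ} {R : Fin n → ℝ}
    (hR : ∀ i, 0 < R i) {D : Set (Fin n → ℂ)} (hD : IsOpen D) (hf : DifferentiableOn ℂ f D)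
    (hs : ∀ w : Fin n → ℂ, (∀ i, w i ∈ Metric.closedBall (c i) (R i)) → w ∈ D) {z : Fin n → ℂ}
    (hz : ∀ i, z i ∈ Metric.ball (c i) (R i)) :
    (∯ w in T(c, R), (∏ i, (w i - z i)⁻¹) * f w) = (2 * Real.pi * Complex.I) ^ n * f z := by
  induction n with
  | zero =>
    rw [torusIntegral_dim0]
    simp [Subsingleton.elim c z]
  | succ n ih =>
    have hint : TorusIntegrable (fun w ↦ (∏ i, (w i - z i)⁻¹) * f w) c R := by
      refine ContinuousOn.integrableOn_compact isCompact_Icc (Continuous.continuousOn ?_)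
      have hc := continuous_torusMap c R
      refine Continuous.mul (continuous_finsetProd _ fun i _ ↦ Continuous.inv₀ (by fun_prop)
        fun θ h0 ↦ ?_) (hf.continuousOn.comp_continuous hc fun θ ↦ hs _ fun i ↦
          Metric.sphere_subset_closedBall (torusMap_mem_sphere c hR θ i))
      have h1 := torusMap_mem_sphere c hR θ i
      have h2 := hz i
      rw [sub_eq_zero.1 h0] at h1
      rw [Metric.mem_sphere] at h1
      rw [Metric.mem_ball] at h2
      exact h2.ne h1
    rw [torusIntegral_succ hint]
    have hcons : ∀ x : ℂ, Differentiable ℂ fun y : Fin n → ℂ ↦ (Fin.cons x y : Fin (n + 1) → ℂ) := by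
      intro x
      rw [differentiable_pi]
      intro i
      refine Fin.cases ?_ (fun i ↦ ?_) i
      · simp
      · simp only [Fin.cons_succ]; fun_prop
    have hcons' : ∀ y : Fin n → ℂ, Differentiable ℂ fun x : ℂ ↦ (Fin.cons x y : Fin (n + 1) → ℂ) := by
      intro y
      rw [differentiable_pi]
      intro i
      refine Fin.cases ?_ (fun i ↦ ?_) i
      · simp only [Fin.cons_zero]; fun_prop
      · simp
    -- For a fixed first variable on its circle, the inner integral is the formula in `n` variables;
    -- the outer one is then the classical formula in one variable.
    have key : Set.EqOn (fun x ↦ ∯ y in T(c ∘ Fin.succ, R ∘ Fin.succ),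
        (∏ i, ((Fin.cons x y : Fin (n + 1) → ℂ) i - z i)⁻¹) * f (Fin.cons x y))
        (fun x ↦ (x - z 0)⁻¹ • ((2 * Real.pi * Complex.I) ^ n * f (Fin.cons x (Fin.tail z))))
        (Metric.sphere (c 0) (R 0)) := by
      intro x hx
      have h1 : DifferentiableOn ℂ (fun y : Fin n → ℂ ↦ f (Fin.cons x y))
          ((fun y : Fin n → ℂ ↦ (Fin.cons x y : Fin (n + 1) → ℂ)) ⁻¹' D) :=
        hf.comp (hcons x).differentiableOn fun _ hy ↦ hy
      have h2 := ih (fun i ↦ hR i.succ) (hD.preimage (hcons x).continuous) h1 (c := c ∘ Fin.succ)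
        (R := R ∘ Fin.succ) (z := Fin.tail z) (fun w hw ↦ hs _ fun i ↦ by
          refine Fin.cases ?_ (fun i ↦ ?_) i
          · exact Metric.sphere_subset_closedBall hx
          · simpa using hw i) (fun i ↦ hz i.succ)
      simp only [smul_eq_mul]
      rw [← h2, ← torusIntegral_const_mul]
      congr 1
      ext y
      rw [Fin.prod_univ_succ]
      simp only [Fin.cons_zero, Fin.cons_succ, Fin.tail]
      ring
    rw [circleIntegral.integral_congr (hR 0).le key]
    have hd : DifferentiableOn ℂ (fun x ↦ (2 * Real.pi * Complex.I) ^ n *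
        f (Fin.cons x (Fin.tail z))) (Metric.closedBall (c 0) (R 0)) := by
      refine DifferentiableOn.const_mul (hf.comp (hcons' _).differentiableOn fun x hx ↦
        hs _ fun i ↦ ?_) _
      refine Fin.cases ?_ (fun i ↦ ?_) i
      · exact hx
      · exact Metric.ball_subset_closedBall (hz i.succ)
    rw [DiffContOnCl.circleIntegral_sub_inv_smul (f := fun x ↦ (2 * Real.pi * Complex.I) ^ n *
      f (Fin.cons x (Fin.tail z))) (hd.diffContOnCl_ball subset_rfl) (hz 0)]
    rw [Fin.cons_self_tail, smul_eq_mul]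
    ring

/-- The function `θ ↦ t exp(s θᵢ √-1)`. -/
def expBCF {n : ℕ} (i : Fin n) (t : ℂ) (s : ℝ) : BoundedContinuousFunction (Fin n → ℝ) ℂ :=
  BoundedContinuousFunction.ofNormedAddCommGroup
    (fun θ ↦ t * Complex.exp ((s * θ i : ℝ) * Complex.I)) (by fun_prop) ‖t‖
    (fun θ ↦ by rw [norm_mul, Complex.norm_exp_ofReal_mul_I, mul_one])

lemma expBCF_apply {n : ℕ} (i : Fin n) (t : ℂ) (s : ℝ) (θ : Fin n → ℝ) :
    expBCF i t s θ = t * Complex.exp ((s * θ i : ℝ) * Complex.I) := rfl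

/-- Makes `θ ↦ δ exp(θᵢ √-1)` a unit of the Banach algebra of bounded continuous functions, so that
the Cauchy kernel can be defined by inversion in this algebra. -/
lemma expBCF_mul {n : ℕ} (i : Fin n) (t t' : ℂ) (s : ℝ) (h : t * t' = 1) :
    expBCF i t s * expBCF i t' (-s) = 1 := by
  ext θ
  rw [BoundedContinuousFunction.mul_apply, expBCF_apply, expBCF_apply, mul_mul_mul_comm, h,
    ← Complex.exp_add]
  simp

/-- Integration on the box `[0, 2π]ⁿ` against a continuous function. -/
def boxIntegral {n : ℕ} {X : Type*} [NormedAddCommGroup X] [NormedSpace ℂ X]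
    (g : (Fin n → ℝ) → X) (hg : Continuous g) : BoundedContinuousFunction (Fin n → ℝ) ℂ →L[ℂ] X :=
  LinearMap.mkContinuous
    { toFun := fun x ↦ ∫ θ in Set.Icc (0 : Fin n → ℝ) (fun _ ↦ 2 * Real.pi), x θ • g θ
      map_add' := fun x y ↦ by
        simp only [BoundedContinuousFunction.add_apply, add_smul]
        exact integral_add ((x.continuous.smul hg).continuousOn.integrableOn_compact isCompact_Icc)
          ((y.continuous.smul hg).continuousOn.integrableOn_compact isCompact_Icc)
      map_smul' := fun t x ↦ by
        simp only [BoundedContinuousFunction.smul_apply, smul_assoc, RingHom.id_apply]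
        exact integral_smul _ _ }
    (∫ θ in Set.Icc (0 : Fin n → ℝ) (fun _ ↦ 2 * Real.pi), ‖g θ‖) (fun x ↦ by
      refine (norm_integral_le_integral_norm _).trans ?_
      rw [mul_comm _ ‖x‖, ← integral_const_mul]
      refine integral_mono ((x.continuous.smul hg).norm.continuousOn.integrableOn_compact
        isCompact_Icc) ((continuous_const.mul hg.norm).continuousOn.integrableOn_compact
          isCompact_Icc) fun θ ↦ ?_
      simp only [norm_smul]
      gcongr
      exact x.norm_coe_le_norm θ)

lemma boxIntegral_apply {n : ℕ} {X : Type*} [NormedAddCommGroup X] [NormedSpace ℂ X]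
    (g : (Fin n → ℝ) → X) (hg : Continuous g) (x : BoundedContinuousFunction (Fin n → ℝ) ℂ) :
    boxIntegral g hg x = ∫ θ in Set.Icc (0 : Fin n → ℝ) (fun _ ↦ 2 * Real.pi), x θ • g θ := rfl

/-- The Cauchy kernel of a polydisc of radius `δ`, as an analytic map to a Banach algebra. -/
def cauchyKernel {n : ℕ} (z₀ : Fin n → ℂ) (δ : ℝ) (z : Fin n → ℂ) :
    BoundedContinuousFunction (Fin n → ℝ) ℂ :=
  ∏ i, (((2 * Real.pi : ℂ)⁻¹ • expBCF i δ 1) *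
    Ring.inverse (expBCF i δ 1 - (z i - z₀ i) • (1 : BoundedContinuousFunction (Fin n → ℝ) ℂ)))

/-- Inversion is analytic at the units of a Banach algebra, and the denominators are affine in `z`.
Analyticity thus holds for the kernel as a whole, uniformly in the integration variable. -/
lemma contDiffAt_cauchyKernel {n : ℕ} (z₀ : Fin n → ℂ) {δ : ℝ} (hδ : 0 < δ) :
    ContDiffAt ℂ ω (cauchyKernel z₀ δ) z₀ := by
  unfold cauchyKernel
  refine contDiffAt_prod fun i _ ↦ contDiffAt_const.mul ?_
  have hδ' : (δ : ℂ) ≠ 0 := by exact_mod_cast hδ.ne'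
  let u : (BoundedContinuousFunction (Fin n → ℝ) ℂ)ˣ :=
    Units.mkOfMulEqOne (expBCF i δ 1) (expBCF i (δ : ℂ)⁻¹ (-1))
      (expBCF_mul i _ _ _ (mul_inv_cancel₀ hδ'))
  refine ContDiffAt.comp (g := Ring.inverse) z₀ ?_ ?_
  · have h0 : expBCF i (δ : ℂ) 1 - (z₀ i - z₀ i) •
        (1 : BoundedContinuousFunction (Fin n → ℝ) ℂ) = u := by
      rw [sub_self, zero_smul, sub_zero]; rfl
    rw [h0]
    exact contDiffAt_ringInverse ℂ u
  · have : ContDiff ℂ ω fun z : Fin n → ℂ ↦ z i - z₀ i := by fun_prop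
    exact contDiffAt_const.sub (this.contDiffAt.smul contDiffAt_const)

/-- Near `z₀` the denominators remain units, so `Ring.inverse` does not take its default value `0`
and evaluates to the pointwise inverse. The other factors are the Jacobian of `torusMap` and the
constant of Cauchy's formula. -/
lemma eventually_cauchyKernel_apply {n : ℕ} (z₀ : Fin n → ℂ) {δ : ℝ} (hδ : 0 < δ) :
    ∀ᶠ z in 𝓝 z₀, ∀ θ, cauchyKernel z₀ δ z θ = ((2 * Real.pi * Complex.I) ^ n)⁻¹ *
      ((∏ i, δ * Complex.exp (θ i * Complex.I) * Complex.I) *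
        ∏ i, (torusMap z₀ (fun _ ↦ δ) θ i - z i)⁻¹) := by
  have hδ' : (δ : ℂ) ≠ 0 := by exact_mod_cast hδ.ne'
  have h1 : ∀ᶠ z in 𝓝 z₀, ∀ i : Fin n, IsUnit (expBCF i δ 1 - (z i - z₀ i) •
      (1 : BoundedContinuousFunction (Fin n → ℝ) ℂ)) := by
    rw [Filter.eventually_all]
    intro i
    have hc : ContinuousAt (fun z : Fin n → ℂ ↦ expBCF i δ 1 - (z i - z₀ i) •
        (1 : BoundedContinuousFunction (Fin n → ℝ) ℂ)) z₀ :=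
      continuousAt_const.sub
        (((continuous_apply i).sub continuous_const).continuousAt.smul continuousAt_const)
    refine hc.eventually_mem (Units.isOpen.mem_nhds ?_)
    simp only [sub_self, zero_smul, sub_zero]
    exact ⟨Units.mkOfMulEqOne (expBCF i δ 1) (expBCF i (δ : ℂ)⁻¹ (-1))
      (expBCF_mul i _ _ _ (mul_inv_cancel₀ hδ')), rfl⟩
  filter_upwards [h1] with z hz θ
  have h2 : ∀ i, Ring.inverse (expBCF i δ 1 - (z i - z₀ i) •
      (1 : BoundedContinuousFunction (Fin n → ℝ) ℂ)) θ =
      (torusMap z₀ (fun _ ↦ δ) θ i - z i)⁻¹ := by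
    intro i
    have h3 := congrArg (fun x : BoundedContinuousFunction (Fin n → ℝ) ℂ ↦ x θ)
      (Ring.inverse_mul_cancel _ (hz i))
    simp only [BoundedContinuousFunction.mul_apply, BoundedContinuousFunction.sub_apply,
      BoundedContinuousFunction.smul_apply, BoundedContinuousFunction.coe_one, Pi.one_apply, expBCF_apply] at h3
    rw [eq_inv_of_mul_eq_one_left h3]
    simp only [torusMap, smul_eq_mul, mul_one, one_mul]
    ring
  simp only [cauchyKernel]
  have h4 : ∀ (s : Finset (Fin n)) (x : Fin n → BoundedContinuousFunction (Fin n → ℝ) ℂ),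
      (∏ i ∈ s, x i) θ = ∏ i ∈ s, x i θ := fun s x ↦ by
    induction s using Finset.cons_induction with
    | empty => simp
    | cons a s ha ih => rw [Finset.prod_cons, Finset.prod_cons, BoundedContinuousFunction.mul_apply, ih]
  rw [h4]
  simp only [BoundedContinuousFunction.mul_apply, BoundedContinuousFunction.smul_apply, h2,
    expBCF_apply, one_mul, smul_eq_mul]
  rw [← Fin.prod_const, ← Finset.prod_inv_distrib, ← Finset.prod_mul_distrib,
    ← Finset.prod_mul_distrib]
  refine Finset.prod_congr rfl fun i _ ↦ ?_
  have : (Real.pi : ℂ) ≠ 0 := by exact_mod_cast Real.pi_ne_zero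
  have := Complex.I_ne_zero
  field_simp

/-- A continuous map to a space of continuous functions, all of whose evaluations are holomorphic,
is analytic. -/
lemma contDiffAt_of_eval_differentiableOn {n : ℕ} {K : Type*} [TopologicalSpace K] [CompactSpace K]
    {D : Set (Fin n → ℂ)} (hD : IsOpen D) {F : (Fin n → ℂ) → C(K, ℂ)} (hF : ContinuousOn F D)
    (hd : ∀ κ, DifferentiableOn ℂ (fun z ↦ F z κ) D) {z₀ : Fin n → ℂ} (hz₀ : z₀ ∈ D) :
    ContDiffAt ℂ ω F z₀ := by
  obtain ⟨δ, hδ, hδD⟩ := Metric.nhds_basis_closedBall.mem_iff.1 (hD.mem_nhds hz₀)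
  have hsub : ∀ w : Fin n → ℂ, (∀ i, w i ∈ Metric.closedBall (z₀ i) δ) → w ∈ D := fun w hw ↦
    hδD (by rw [Metric.mem_closedBall, dist_pi_le_iff hδ.le]; exact hw)
  set g : (Fin n → ℝ) → C(K, ℂ) := fun θ ↦ F (torusMap z₀ (fun _ ↦ δ) θ) with hg
  have hgc : Continuous g := hF.comp_continuous (continuous_torusMap _ _) fun θ ↦ hsub _ fun i ↦
    Metric.sphere_subset_closedBall (torusMap_mem_sphere z₀ (fun _ ↦ hδ) θ i)
  -- Near `z₀`, `F` is a continuous linear map, integration against its values on the torus, applied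
  -- to the analytic kernel. This vector-valued Cauchy formula is verified by evaluation at each
  -- `κ`.
  refine ((boxIntegral g hgc).contDiff.contDiffAt.comp z₀
    (contDiffAt_cauchyKernel z₀ hδ)).congr_of_eventuallyEq ?_
  filter_upwards [eventually_cauchyKernel_apply z₀ hδ, Metric.ball_mem_nhds z₀ hδ] with z hz hzb
  ext κ
  have hint : Integrable (fun θ ↦ cauchyKernel z₀ δ z θ • g θ)
      (volume.restrict (Set.Icc (0 : Fin n → ℝ) (fun _ ↦ 2 * Real.pi))) :=
    ((cauchyKernel z₀ δ z).continuous.smul hgc).continuousOn.integrableOn_compact isCompact_Icc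
  have h1 := torusIntegral_cauchy (R := fun _ ↦ δ) (fun _ ↦ hδ) hD (hd κ) hsub (z := z)
    ((dist_pi_lt_iff hδ).1 hzb)
  have h2 : (boxIntegral g hgc (cauchyKernel z₀ δ z)) κ =
      ∫ θ in Set.Icc (0 : Fin n → ℝ) (fun _ ↦ 2 * Real.pi), cauchyKernel z₀ δ z θ * g θ κ := by
    rw [boxIntegral_apply]
    exact ((ContinuousMap.evalCLM ℂ κ).integral_comp_comm hint).symm
  rw [Function.comp_apply, h2]
  have h3 : ((2 * Real.pi * Complex.I) ^ n : ℂ) ≠ 0 := pow_ne_zero _ (by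
    simp [Real.pi_ne_zero])
  rw [← mul_right_inj' h3, ← h1, torusIntegral, ← integral_const_mul]
  congr 1
  ext θ
  have h4 : ∀ P Q X c : ℂ, c ≠ 0 → P * (Q * X) = c * ((c⁻¹ * (P * Q)) * X) := fun P Q X c hc ↦ by
    field_simp
  rw [hz θ, smul_eq_mul]
  exact h4 _ _ _ _ h3

end SeveralComplexVariables

end BeltramiSoliton

namespace BeltramiSoliton

/-! ### Laurent coefficients on an annulus as continuous linear functionals. -/

section ComplexLaurent

open MeasureTheory

lemma fact_two_pi_pos : Fact (0 < 2 * Real.pi) := ⟨Real.two_pi_pos⟩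

attribute [local instance] fact_two_pi_pos

/-- The closed annulus `r - δ ≤ |ζ| ≤ r + δ`. -/
def annulus (r δ : ℝ) : Set ℂ := {ζ | r - δ ≤ ‖ζ‖ ∧ ‖ζ‖ ≤ r + δ}

lemma isCompact_annulus (r δ : ℝ) : IsCompact (annulus r δ) := by
  refine Metric.isCompact_of_isClosed_isBounded ?_ ?_
  · exact (isClosed_le continuous_const continuous_norm).inter
      (isClosed_le continuous_norm continuous_const)
  · exact (Metric.isBounded_closedBall (x := (0 : ℂ)) (r := r + δ)).subset fun ζ hζ ↦ by
      simpa using hζ.2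

instance (r δ : ℝ) : CompactSpace (annulus r δ) := isCompact_iff_compactSpace.1 (isCompact_annulus r δ)

/-- The circle of radius `ρ`, as a map to the annulus. -/
def circleInAnnulus {r δ ρ : ℝ} (hρ : 0 < ρ) (h : |ρ - r| ≤ δ) :
    C(AddCircle (2 * Real.pi), annulus r δ) where
  toFun x := ⟨ρ * (AddCircle.toCircle x : ℂ), by
    rw [abs_le] at h
    simp only [annulus, Set.mem_ofPred_eq, norm_mul, Complex.norm_real, Circle.norm_coe, mul_one,
      Real.norm_eq_abs, abs_of_pos hρ]
    constructor <;> linarith⟩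
  continuous_toFun := by
    refine Continuous.subtype_mk (continuous_const.mul ?_) _
    exact continuous_subtype_val.comp AddCircle.continuous_toCircle

/-- Fourier coefficients, as continuous linear functionals. -/
def fourierCoeffCLM (j : ℤ) : C(AddCircle (2 * Real.pi), ℂ) →L[ℂ] ℂ :=
  (innerSL ℂ (fourierLp (T := 2 * Real.pi) 2 j)).comp
    (ContinuousMap.toLp (E := ℂ) 2 AddCircle.haarAddCircle ℂ)

lemma fourierCoeffCLM_apply (j : ℤ) (x : C(AddCircle (2 * Real.pi), ℂ)) :
    fourierCoeffCLM j x = fourierCoeff x j := by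
  rw [← fourierCoeff_toLp, ← fourierBasis_repr, HilbertBasis.repr_apply_apply, coe_fourierBasis]
  rfl

lemma norm_fourierCoeff_le (x : C(AddCircle (2 * Real.pi), ℂ)) (j : ℤ) :
    ‖fourierCoeff x j‖ ≤ ‖x‖ := by
  rw [fourierCoeff]
  have h := norm_integral_le_of_norm_le_const (μ := AddCircle.haarAddCircle (T := 2 * Real.pi))
    (f := fun t ↦ (fourier (-j)) t • x t) (C := ‖x‖) (Filter.Eventually.of_forall fun t ↦ by
      rw [norm_smul]
      rw [fourier_apply, Circle.norm_coe, one_mul]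
      exact x.norm_coe_le_norm t)
  simpa using h

/-- The `j`-th Laurent coefficient of a function on the annulus, computed on the circle of
radius `ρ`. -/
def laurentCoeff {r δ ρ : ℝ} (hρ : 0 < ρ) (h : |ρ - r| ≤ δ) (j : ℤ) : C(annulus r δ, ℂ) →L[ℂ] ℂ :=
  ((ρ : ℂ) ^ j)⁻¹ • (fourierCoeffCLM j).comp
    (ContinuousMap.compCLM ℂ ℂ (circleInAnnulus hρ h))

lemma laurentCoeff_apply {r δ ρ : ℝ} (hρ : 0 < ρ) (h : |ρ - r| ≤ δ) (j : ℤ) (x : C(annulus r δ, ℂ)) :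
    laurentCoeff hρ h j x = ((ρ : ℂ) ^ j)⁻¹ * fourierCoeff (x.comp (circleInAnnulus hρ h)) j := by
  rw [← fourierCoeffCLM_apply]
  rfl

/-- The Fourier coefficients of the restriction to a circle, rewritten as contour integrals so that
Cauchy's theorem can compare different radii. -/
lemma laurentCoeff_eq_circleIntegral {r δ ρ : ℝ} (hρ : 0 < ρ) (h : |ρ - r| ≤ δ) (j : ℤ)
    {x : C(annulus r δ, ℂ)} {f : ℂ → ℂ} (hx : ∀ κ : annulus r δ, x κ = f κ) :
    laurentCoeff hρ h j x = (2 * Real.pi * Complex.I)⁻¹ * ∮ ζ in C(0, ρ), ζ ^ (-j - 1) * f ζ := by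
  rw [laurentCoeff_apply, fourierCoeff_eq_intervalIntegral _ _ 0, circleIntegral, zero_add]
  have h1 : ∀ θ : ℝ, deriv (circleMap 0 ρ) θ • ((circleMap 0 ρ θ) ^ (-j - 1) * f (circleMap 0 ρ θ)) =
      (Complex.I * ((ρ : ℂ) ^ j)⁻¹) * (fourier (-j) (θ : AddCircle (2 * Real.pi)) •
        (x.comp (circleInAnnulus hρ h)) (θ : AddCircle (2 * Real.pi))) := by
    intro θ
    have h2 : (x.comp (circleInAnnulus hρ h)) (θ : AddCircle (2 * Real.pi)) =
        f (circleMap 0 ρ θ) := by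
      rw [ContinuousMap.comp_apply, hx]
      congr 1
      simp only [circleInAnnulus, ContinuousMap.coe_mk, AddCircle.toCircle_apply_mk, circleMap,
        zero_add, Circle.coe_exp]
      congr 3
      rw [div_self Real.two_pi_pos.ne', one_mul]
    have hρ' : (ρ : ℂ) ≠ 0 := by exact_mod_cast hρ.ne'
    have hp : (Real.pi : ℂ) ≠ 0 := by exact_mod_cast Real.pi_ne_zero
    have h3 : (fourier (-j) (θ : AddCircle (2 * Real.pi)) : ℂ) = (Complex.exp (θ * Complex.I) ^ j)⁻¹ := by
      rw [fourier_coe_apply, ← zpow_neg, ← Complex.exp_int_mul]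
      congr 1
      push_cast
      field_simp
    rw [h2, h3, deriv_circleMap, circleMap_zero, smul_eq_mul, smul_eq_mul,
      zpow_sub_one₀ (mul_ne_zero hρ' (Complex.exp_ne_zero _)), zpow_neg, mul_zpow, mul_inv]
    have := Complex.exp_ne_zero (θ * Complex.I)
    field_simp
  simp_rw [h1]
  rw [intervalIntegral.integral_const_mul, Complex.real_smul]
  have := Complex.I_ne_zero
  have hp : (Real.pi : ℂ) ≠ 0 := by exact_mod_cast Real.pi_ne_zero
  push_cast
  field_simp

/-- The Laurent coefficients of a holomorphic function do not depend on the radius. -/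
lemma laurentCoeff_eq_of_differentiableOn {r δ : ℝ} {S : Set ℂ} (hS : IsOpen S)
    (hsub : annulus r δ ⊆ S) {f : ℂ → ℂ} (hf : DifferentiableOn ℂ f S) {x : C(annulus r δ, ℂ)}
    (hx : ∀ κ : annulus r δ, x κ = f κ) {ρ ρ' : ℝ} (hρ : 0 < ρ) (h : |ρ - r| ≤ δ) (hρ' : 0 < ρ')
    (h' : |ρ' - r| ≤ δ) (j : ℤ) : laurentCoeff hρ h j x = laurentCoeff hρ' h' j x := by
  wlog hle : ρ' ≤ ρ generalizing ρ ρ'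
  · exact (this hρ' h' hρ h (le_of_not_ge hle)).symm
  rw [laurentCoeff_eq_circleIntegral hρ h j hx, laurentCoeff_eq_circleIntegral hρ' h' j hx]
  congr 1
  rw [abs_le] at h h'
  have hd : ∀ ζ ∈ Metric.closedBall (0 : ℂ) ρ \ Metric.ball 0 ρ',
      DifferentiableAt ℂ (fun ζ : ℂ ↦ ζ ^ (-j - 1) * f ζ) ζ := by
    intro ζ hζ
    simp only [Set.mem_sdiff, Metric.mem_closedBall, dist_zero_right, Metric.mem_ball, not_lt] at hζ
    refine DifferentiableAt.mul (differentiableAt_zpow.2 (Or.inl ?_)) (hf.differentiableAt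
      (hS.mem_nhds (hsub ⟨by linarith, by linarith⟩)))
    rintro rfl
    rw [norm_zero] at hζ
    linarith
  refine Complex.circleIntegral_eq_of_differentiable_on_annulus_off_countable hρ' hle
    Set.countable_empty (fun ζ hζ ↦ (hd ζ hζ).continuousAt.continuousWithinAt) fun ζ hζ ↦ hd ζ ?_
  exact ⟨Metric.ball_subset_closedBall hζ.1.1, fun h ↦ hζ.1.2 (Metric.ball_subset_closedBall h)⟩

/-- The real points of the annulus. -/
def realInAnnulus {r δ ρ : ℝ} (hρ : 0 < ρ) (h : |ρ - r| ≤ δ) : annulus r δ :=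
  ⟨ρ, by
    rw [abs_le] at h
    simp only [annulus, Set.mem_ofPred_eq, Complex.norm_real, Real.norm_eq_abs, abs_of_pos hρ]
    constructor <;> linarith⟩

/-- A function whose Laurent coefficients do not depend on the radius is the sum of its Laurent
series. -/
lemma hasSum_laurentCoeff {r δ : ℝ} (hδ : δ < r) (hδ0 : 0 < δ) (hr : 0 < r) (hr' : |r - r| ≤ δ)
    {x : C(annulus r δ, ℂ)} (hx : ∀ (ρ : ℝ) (hρ : 0 < ρ) (h : |ρ - r| ≤ δ) (j : ℤ),
      laurentCoeff hρ h j x = laurentCoeff hr hr' j x) {ρ : ℝ} (hρ : 0 < ρ) (h : |ρ - r| < δ) :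
    HasSum (fun j : ℤ ↦ (ρ : ℂ) ^ j * laurentCoeff hr hr' j x) (x (realInAnnulus hρ h.le)) := by
  have hfc : ∀ (t : ℝ) (ht : 0 < t) (h : |t - r| ≤ δ) (j : ℤ),
      fourierCoeff (x.comp (circleInAnnulus ht h)) j = (t : ℂ) ^ j * laurentCoeff hr hr' j x := by
    intro t ht h j
    have : (t : ℂ) ^ j ≠ 0 := zpow_ne_zero _ (by exact_mod_cast ht.ne')
    rw [← hx t ht h, laurentCoeff_apply, mul_inv_cancel_left₀ this]
  have hbd : ∀ (t : ℝ) (ht : 0 < t) (h : |t - r| ≤ δ) (j : ℤ),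
      t ^ j * ‖laurentCoeff hr hr' j x‖ ≤ ‖x‖ := by
    intro t ht h j
    have h1 := norm_fourierCoeff_le (x.comp (circleInAnnulus ht h)) j
    rw [hfc t ht h j, norm_mul, norm_zpow, Complex.norm_real, Real.norm_eq_abs, abs_of_pos ht] at h1
    refine h1.trans ?_
    rw [ContinuousMap.norm_le _ (norm_nonneg _)]
    exact fun y ↦ x.norm_coe_le_norm _
  -- On every circle of the annulus a Fourier coefficient is bounded by the norm of `x`. The bounds
  -- at the extreme radii `r - δ` and `r + δ` give geometric decay at `ρ`, which lies strictly
  -- between.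
  have hsum : Summable (fourierCoeff (x.comp (circleInAnnulus hρ h.le))) := by
    have h' := h
    rw [abs_lt] at h'
    have hs1 : 0 < r - δ := by linarith
    have hs2 : 0 < r + δ := by linarith
    have hq0 : 0 ≤ max ((r - δ) / ρ) (ρ / (r + δ)) := by positivity
    have hq1 : max ((r - δ) / ρ) (ρ / (r + δ)) < 1 :=
      max_lt ((div_lt_one hρ).2 (by linarith)) ((div_lt_one hs2).2 (by linarith))
    refine Summable.of_norm_bounded ((summable_natAbs_geometric hq0 hq1).mul_left ‖x‖) fun j ↦ ?_
    rw [hfc ρ hρ h.le j, norm_mul, norm_zpow, Complex.norm_real, Real.norm_eq_abs, abs_of_pos hρ]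
    have hle : ∀ q : ℝ, 0 ≤ q → ‖x‖ * q ^ j.natAbs ≤ ‖x‖ * (((j.natAbs : ℝ) + 1) * q ^ j.natAbs) := by
      intro q hq
      have h5 : 0 ≤ q ^ j.natAbs := by positivity
      have h6 : q ^ j.natAbs ≤ ((j.natAbs : ℝ) + 1) * q ^ j.natAbs := by
        nlinarith [mul_nonneg (Nat.cast_nonneg (α := ℝ) j.natAbs) h5]
      gcongr
    refine le_trans ?_ (hle _ hq0)
    rcases Int.eq_nat_or_neg j with ⟨n, rfl | rfl⟩
    · have h4 := hbd (r + δ) hs2 (by rw [add_sub_cancel_left, abs_of_pos hδ0]) n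
      simp only [Int.natAbs_natCast, zpow_natCast] at h4 ⊢
      calc ρ ^ n * ‖laurentCoeff hr hr' n x‖
          = ((r + δ) ^ n * ‖laurentCoeff hr hr' n x‖) * (ρ / (r + δ)) ^ n := by
            rw [div_pow]; field_simp
        _ ≤ _ := by
            gcongr
            exact le_max_right _ _
    · have h4 := hbd (r - δ) hs1 (by rw [sub_sub_cancel_left, abs_neg, abs_of_pos hδ0]) (-n)
      simp only [Int.natAbs_neg, Int.natAbs_natCast, zpow_neg, zpow_natCast] at h4 ⊢
      calc (ρ ^ n)⁻¹ * ‖laurentCoeff hr hr' (-n) x‖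
          = (((r - δ) ^ n)⁻¹ * ‖laurentCoeff hr hr' (-n) x‖) * ((r - δ) / ρ) ^ n := by
            rw [div_pow]; field_simp
        _ ≤ _ := by
            gcongr
            exact le_max_left _ _
  -- The angle `0` corresponds to the positive real point `ρ` of the circle, where every exponential
  -- equals `1`.
  have h1 := has_pointwise_sum_fourier_series_of_summable hsum 0
  have h2 : (x.comp (circleInAnnulus hρ h.le)) 0 = x (realInAnnulus hρ h.le) := by
    rw [ContinuousMap.comp_apply]
    congr 1
    ext
    simp [circleInAnnulus, realInAnnulus]
  rw [h2] at h1
  refine h1.congr_fun ?_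
  intro j
  rw [hfc ρ hρ h.le j]
  simp

end ComplexLaurent

end BeltramiSoliton

namespace BeltramiSoliton

/-! ### Laurent expansions depending analytically on parameters. -/

section LaurentWithParameters

lemma exists_annulus_subset {v : Set ℂ} (hv : IsOpen v) {r : ℝ} (hr : 0 < r)
    (h : Metric.sphere (0 : ℂ) r ⊆ v) : ∃ δ, 0 < δ ∧ δ < r ∧ annulus r δ ⊆ v := by
  obtain ⟨η, hη, hηv⟩ := (isCompact_sphere (0 : ℂ) r).exists_thickening_subset_open hv h
  refine ⟨min η r / 2, by positivity, ?_, fun ζ hζ ↦ hηv ?_⟩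
  · have := min_le_right η r
    linarith
  have h1 := min_le_right η r
  have h2 := min_le_left η r
  have h3 : 0 < min η r := by positivity
  have hζ0 : 0 < ‖ζ‖ := by linarith [hζ.1]
  rw [Metric.mem_thickening_iff]
  -- The radial projection of `ζ` to the circle, at distance `|‖ζ‖ - r|`.
  refine ⟨(r / ‖ζ‖ : ℝ) • ζ, ?_, ?_⟩
  · rw [mem_sphere_zero_iff_norm, norm_smul, Real.norm_eq_abs, abs_of_pos (by positivity)]
    field_simp
  · have h4 : ζ - (r / ‖ζ‖ : ℝ) • ζ = ((‖ζ‖ - r) / ‖ζ‖ : ℝ) • ζ := by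
      rw [sub_div, div_self hζ0.ne', sub_smul, one_smul]
    rw [dist_eq_norm, h4, norm_smul, norm_div, norm_norm, div_mul_cancel₀ _ hζ0.ne',
      Real.norm_eq_abs, abs_lt]
    constructor <;> linarith [hζ.1, hζ.2]

/-- Laurent expansion, in the last variable, of a function holomorphic near `{z₀} × {|ζ| = r}`. -/
theorem exists_laurent_expansion {n : ℕ} {φ : (Fin n → ℂ) × ℂ → ℂ} {D : Set ((Fin n → ℂ) × ℂ)}
    (hD : IsOpen D) (hφ : DifferentiableOn ℂ φ D) {z₀ : Fin n → ℂ} {r : ℝ} (hr : 0 < r)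
    (h : ∀ ζ ∈ Metric.sphere (0 : ℂ) r, (z₀, ζ) ∈ D) :
    ∃ δ, 0 < δ ∧ δ < r ∧ ∃ c : ℤ → (Fin n → ℂ) → ℂ, ∀ᶠ z in 𝓝 z₀,
      (∀ j, ContDiffAt ℂ ω (c j) z) ∧ ∀ ρ : ℝ, |ρ - r| < δ → (z, (ρ : ℂ)) ∈ D ∧
        HasSum (fun j : ℤ ↦ (ρ : ℂ) ^ j * c j z) (φ (z, ρ)) ∧
        ∀ v, HasSum (fun j : ℤ ↦ (ρ : ℂ) ^ j * fderiv ℂ (c j) z v)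
          (fderiv ℂ (fun z' ↦ φ (z', (ρ : ℂ))) z v) := by
  obtain ⟨u, v, hu, hv, hzu, hsv, huv⟩ := generalized_tube_lemma (isCompact_singleton (x := z₀))
    (isCompact_sphere (0 : ℂ) r) hD (by
      rintro ⟨a, b⟩ ⟨ha, hb⟩
      obtain rfl : a = z₀ := ha
      exact h b hb)
  obtain ⟨δ, hδ, hδr, hδv⟩ := exists_annulus_subset hv hr hsv
  have hr' : |r - r| ≤ δ := by rw [sub_self, abs_zero]; exact hδ.le
  -- Currying `φ` on a product neighbourhood gives a map `F` to `C(annulus r δ, ℂ)` whose continuity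
  -- is automatic; its value `0` outside `u` plays no role.
  let Φ : C(u × annulus r δ, ℂ) :=
    ⟨fun p ↦ φ (p.1, p.2), hφ.continuousOn.comp_continuous (by fun_prop)
      fun p ↦ huv ⟨p.1.2, hδv p.2.2⟩⟩
  classical
  let F : (Fin n → ℂ) → C(annulus r δ, ℂ) := fun z ↦ if hz : z ∈ u then Φ.curry ⟨z, hz⟩ else 0
  have hFe : ∀ z ∈ u, ∀ κ : annulus r δ, F z κ = φ (z, (κ : ℂ)) := by
    intro z hz κ
    simp only [F, dif_pos hz]
    rfl
  have hFc : ContinuousOn F u := by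
    rw [continuousOn_iff_continuous_domRestrict]
    have : u.domRestrict F = Φ.curry := by
      ext1 z
      simp only [Set.domRestrict_apply, F, dif_pos z.2]
    rw [this]
    exact Φ.curry.continuous
  have hFd : ∀ κ, DifferentiableOn ℂ (fun z ↦ F z κ) u := by
    intro κ
    refine DifferentiableOn.congr (f := fun z ↦ φ (z, (κ : ℂ))) ?_ fun z hz ↦ hFe z hz κ
    exact hφ.comp (by fun_prop) fun z hz ↦ huv ⟨hz, hδv κ.2⟩
  have hFω : ∀ z ∈ u, ContDiffAt ℂ ω F z := fun z hz ↦
    contDiffAt_of_eval_differentiableOn hu hFc hFd hz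
  have hind : ∀ z ∈ u, ∀ (ρ : ℝ) (hρ : 0 < ρ) (h : |ρ - r| ≤ δ) (j : ℤ),
      laurentCoeff hρ h j (F z) = laurentCoeff hr hr' j (F z) := by
    intro z hz ρ hρ h j
    refine laurentCoeff_eq_of_differentiableOn hv hδv (f := fun ζ ↦ φ (z, ζ)) ?_ (hFe z hz) hρ h
      hr hr' j
    exact hφ.comp (by fun_prop) fun ζ hζ ↦ huv ⟨hz, hζ⟩
  refine ⟨δ, hδ, hδr, fun j z ↦ laurentCoeff hr hr' j (F z), ?_⟩
  filter_upwards [hu.mem_nhds (hzu rfl)] with z hz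
  have hFz := (hFω z hz).differentiableAt (by simp)
  refine ⟨fun j ↦ (laurentCoeff hr hr' j).contDiff.contDiffAt.comp z (hFω z hz), fun ρ hρ ↦ ?_⟩
  have hρ0 : 0 < ρ := by rw [abs_lt] at hρ; linarith
  refine ⟨huv ⟨hz, hδv (realInAnnulus hρ0 hρ.le).2⟩, ?_, fun w ↦ ?_⟩
  · have h1 := hasSum_laurentCoeff hδr hδ hr hr' (hind z hz) hρ0 hρ
    rwa [hFe z hz] at h1
  · have hcomp : ∀ L : C(annulus r δ, ℂ) →L[ℂ] ℂ,
        fderiv ℂ (fun z' ↦ L (F z')) z w = L (fderiv ℂ F z w) := by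
      intro L
      have h2 : HasFDerivAt (fun z' ↦ L (F z')) _ z := L.hasFDerivAt.comp z hFz.hasFDerivAt
      rw [h2.fderiv]
      rfl
    -- The coefficient functionals commute with the derivative of `F`, so the coefficients of this
    -- derivative are also independent of the radius. This is all that `hasSum_laurentCoeff`
    -- requires; holomorphy of the derivative in `ζ` need not be examined.
    have h1 := hasSum_laurentCoeff hδr hδ hr hr' (x := fderiv ℂ F z w) (fun t ht htr j ↦ by
      rw [← hcomp, ← hcomp]
      congr 1
      refine Filter.EventuallyEq.fderiv_eq ?_
      filter_upwards [hu.mem_nhds hz] with z' hz'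
      exact hind z' hz' t ht htr j) hρ0 hρ
    simp_rw [hcomp]
    convert h1 using 1
    rw [← ContinuousMap.evalCLM_apply (R := ℂ), ← hcomp]
    congr 1
    refine Filter.EventuallyEq.fderiv_eq ?_
    filter_upwards [hu.mem_nhds hz] with z' hz'
    exact (hFe z' hz' (realInAnnulus hρ0 hρ.le)).symm

end LaurentWithParameters

end BeltramiSoliton

namespace BeltramiSoliton

/-! ### Coordinate expressions of tensors under changes of charts. -/

section Charts

variable {W : Type*} [NormedAddCommGroup W] [NormedSpace ℝ W] {H : Type*} [TopologicalSpace H]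
  (I : ModelWithCorners ℝ W H) [I.Boundaryless] {M : Type*} [TopologicalSpace M] [ChartedSpace H M]
  [IsManifold I ω M]

/-- The change of coordinates from the chart at `x₀` to the chart at `y`. -/
def chartChange (x₀ y : M) (u : W) : W := extChartAt I y ((extChartAt I x₀).symm u)

/-- The coordinates, in the chart at `x₀`, of points in the domain of the chart at `y`. -/
def chartOverlap (x₀ y : M) : Set W :=
  (extChartAt I x₀).target ∩ (extChartAt I x₀).symm ⁻¹' (extChartAt I y).source

variable {I}

lemma mem_chartOverlap {x₀ : M} {u : W} (hu : u ∈ (extChartAt I x₀).target) :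
    u ∈ chartOverlap I x₀ ((extChartAt I x₀).symm u) := ⟨hu, mem_extChartAt_source _⟩

lemma isOpen_chartOverlap (x₀ y : M) : IsOpen (chartOverlap I x₀ y) :=
  (continuousOn_extChartAt_symm x₀).isOpen_inter_preimage (isOpen_extChartAt_target x₀)
    (isOpen_extChartAt_source y)

lemma symm_chartChange {x₀ y : M} {u : W} (hu : u ∈ chartOverlap I x₀ y) :
    (extChartAt I y).symm (chartChange I x₀ y u) = (extChartAt I x₀).symm u :=
  (extChartAt I y).left_inv hu.2

lemma chartChange_mem {x₀ y : M} {u : W} (hu : u ∈ chartOverlap I x₀ y) :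
    chartChange I x₀ y u ∈ chartOverlap I y x₀ :=
  ⟨(extChartAt I y).map_source hu.2, by
    rw [Set.mem_preimage, symm_chartChange hu]; exact (extChartAt I x₀).map_target hu.1⟩

lemma chartChange_chartChange {x₀ y : M} {u : W} (hu : u ∈ chartOverlap I x₀ y) :
    chartChange I y x₀ (chartChange I x₀ y u) = u := by
  rw [chartChange, symm_chartChange hu, (extChartAt I x₀).right_inv hu.1]

lemma contDiffAt_chartChange {x₀ y : M} {u : W} (hu : u ∈ chartOverlap I x₀ y) :
    ContDiffAt ℝ ω (chartChange I x₀ y) u := by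
  have := contDiffWithinAt_ext_coord_change (I := I) (n := ω) y x₀ (y := u) (by
    simpa [PartialEquiv.trans_source, chartOverlap] using hu)
  rwa [I.range_eq_univ, contDiffWithinAt_univ] at this

lemma chartFrame_eq (x₀ : M) (u : W) :
    chartFrame I x₀ u = mfderiv 𝓘(ℝ, W) I (extChartAt I x₀).symm u := by
  rw [chartFrame, I.range_eq_univ, mfderivWithin_univ]

lemma isInvertible_chartFrame {x₀ : M} {u : W} (hu : u ∈ (extChartAt I x₀).target) :
    (chartFrame I x₀ u).IsInvertible := isInvertible_mfderivWithin_extChartAt_symm hu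

variable (I) in
/-- The map `chartFrame`, with the tangent spaces identified with the model space. -/
def frameMap (x₀ : M) (u : W) : W →L[ℝ] W := chartFrame I x₀ u

lemma frameMap_self (x : M) (v : W) : frameMap I x (extChartAt I x x) v = v :=
  DFunLike.congr_fun (mfderivWithin_range_extChartAt_symm (I := I) (x := x)) v

lemma isInvertible_frameMap {x₀ : M} {u : W} (hu : u ∈ (extChartAt I x₀).target) :
    (frameMap I x₀ u).IsInvertible := isInvertible_chartFrame hu

lemma frameMap_injective {x₀ : M} {u : W} (hu : u ∈ (extChartAt I x₀).target) :
    Function.Injective (frameMap I x₀ u) := by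
  obtain ⟨e, he⟩ := isInvertible_frameMap (I := I) hu
  rw [← he]
  exact e.injective

/-- The chain rule for `chart⁻¹ = chart'⁻¹ ∘ (change of charts)`; all the transformation laws below
come from it. -/
lemma frameMap_chartChange {x₀ y : M} {u : W} (hu : u ∈ chartOverlap I x₀ y) (v : W) :
    frameMap I x₀ u v =
      frameMap I y (chartChange I x₀ y u) (fderiv ℝ (chartChange I x₀ y) u v) := by
  have h1 : MDifferentiableAt 𝓘(ℝ, W) I (extChartAt I y).symm (chartChange I x₀ y u) := by
    have := mdifferentiableWithinAt_extChartAt_symm (I := I) (chartChange_mem hu).1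
    rwa [I.range_eq_univ, mdifferentiableWithinAt_univ] at this
  have h2 : MDifferentiableAt 𝓘(ℝ, W) 𝓘(ℝ, W) (chartChange I x₀ y) u :=
    ((contDiffAt_chartChange hu).differentiableAt (by simp)).mdifferentiableAt
  have h3 := mfderiv_comp u h1 h2
  have h4 : (extChartAt I x₀).symm =ᶠ[𝓝 u] (extChartAt I y).symm ∘ chartChange I x₀ y := by
    filter_upwards [(isOpen_chartOverlap x₀ y).mem_nhds hu] with u' hu'
    exact (symm_chartChange hu').symm
  rw [frameMap, frameMap, chartFrame_eq, chartFrame_eq, h4.mfderiv_eq, h3, mfderiv_eq_fderiv]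
  rfl

lemma isInvertible_fderiv_chartChange {x₀ y : M} {u : W} (hu : u ∈ chartOverlap I x₀ y) :
    (fderiv ℝ (chartChange I x₀ y) u).IsInvertible := by
  have h1 : ∀ {x₀ y : M} {u : W}, u ∈ chartOverlap I x₀ y →
      (fderiv ℝ (chartChange I y x₀) (chartChange I x₀ y u)).comp
        (fderiv ℝ (chartChange I x₀ y) u) = ContinuousLinearMap.id ℝ W := by
    intro x₀ y u hu
    have h2 := ((contDiffAt_chartChange (chartChange_mem hu)).differentiableAt
      (by simp)).hasFDerivAt.comp u ((contDiffAt_chartChange hu).differentiableAt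
        (by simp)).hasFDerivAt
    refine h2.unique ((hasFDerivAt_id u).congr_of_eventuallyEq ?_)
    filter_upwards [(isOpen_chartOverlap x₀ y).mem_nhds hu] with u' hu'
    exact chartChange_chartChange hu'
  refine ContinuousLinearMap.IsInvertible.of_inverse
    (g := fderiv ℝ (chartChange I y x₀) (chartChange I x₀ y u)) ?_ (h1 hu)
  have := h1 (chartChange_mem hu)
  rwa [chartChange_chartChange hu] at this

lemma chartBilin_chartChange (g : ∀ x : M, TangentSpace I x →L[ℝ] TangentSpace I x →L[ℝ] ℝ)
    {x₀ y : M} {u : W} (hu : u ∈ chartOverlap I x₀ y) :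
    chartBilin I g x₀ u = pullBilin (chartBilin I g y (chartChange I x₀ y u))
      (fderiv ℝ (chartChange I x₀ y) u) := by
  ext v w
  let g' : M → W →L[ℝ] W →L[ℝ] ℝ := g
  change g' _ (frameMap I x₀ u v) (frameMap I x₀ u w) = g' _ _ _
  rw [frameMap_chartChange hu, frameMap_chartChange hu, ← symm_chartChange hu]
  rfl

lemma chartForm_chartChange (α : ∀ x : M, TangentSpace I x →L[ℝ] ℝ)
    {x₀ y : M} {u : W} (hu : u ∈ chartOverlap I x₀ y) :
    chartForm I α x₀ u = (chartForm I α y (chartChange I x₀ y u)).comp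
      (fderiv ℝ (chartChange I x₀ y) u) := by
  ext v
  let α' : M → W →L[ℝ] ℝ := α
  change α' _ (frameMap I x₀ u v) = α' _ _
  rw [frameMap_chartChange hu, ← symm_chartChange hu]
  rfl

lemma frameMap_chartField (E : ∀ x : M, TangentSpace I x) {x₀ : M} {u : W}
    (hu : u ∈ (extChartAt I x₀).target) :
    frameMap I x₀ u (chartField I E x₀ u) = E ((extChartAt I x₀).symm u) := by
  obtain ⟨e, he⟩ := isInvertible_chartFrame (I := I) hu
  rw [frameMap, chartField, ← he, ContinuousLinearMap.inverse_equiv]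
  exact e.apply_symm_apply _

lemma chartField_chartChange (E : ∀ x : M, TangentSpace I x) {x₀ y : M} {u : W}
    (hu : u ∈ chartOverlap I x₀ y) :
    fderiv ℝ (chartChange I x₀ y) u (chartField I E x₀ u) =
      chartField I E y (chartChange I x₀ y u) := by
  refine frameMap_injective (chartChange_mem hu).1 ?_
  let E' : M → W := E
  have h2 : frameMap I x₀ u (chartField I E x₀ u) = E' _ := frameMap_chartField E hu.1
  have h3 : frameMap I y (chartChange I x₀ y u) (chartField I E y _) = E' _ :=
    frameMap_chartField E (chartChange_mem hu).1
  rw [h3, symm_chartChange hu, ← h2, frameMap_chartChange hu]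

lemma contDiffAt_fderiv_chartChange {x₀ y : M} {u : W} (hu : u ∈ chartOverlap I x₀ y)
    (n : WithTop ℕ∞) : ContDiffAt ℝ n (fderiv ℝ (chartChange I x₀ y)) u :=
  ((contDiffAt_chartChange hu).fderiv_right (m := ω) (by simp)).of_le le_top

lemma contDiffAt_chartBilin_of_chartChange [FiniteDimensional ℝ W] {n : WithTop ℕ∞}
    {g : ∀ x : M, TangentSpace I x →L[ℝ] TangentSpace I x →L[ℝ] ℝ} {x₀ y : M} {u : W}
    (hu : u ∈ chartOverlap I x₀ y)
    (h : ContDiffAt ℝ n (chartBilin I g y) (chartChange I x₀ y u)) :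
    ContDiffAt ℝ n (chartBilin I g x₀) u := by
  refine (contDiffAt_pullBilin h ((contDiffAt_chartChange hu).of_le le_top)
    (contDiffAt_fderiv_chartChange hu n)).congr_of_eventuallyEq ?_
  filter_upwards [(isOpen_chartOverlap x₀ y).mem_nhds hu] with u' hu'
  exact chartBilin_chartChange g hu'

lemma contDiffAt_chartForm_of_chartChange {n : WithTop ℕ∞}
    {α : ∀ x : M, TangentSpace I x →L[ℝ] ℝ} {x₀ y : M} {u : W} (hu : u ∈ chartOverlap I x₀ y)
    (h : ContDiffAt ℝ n (chartForm I α y) (chartChange I x₀ y u)) :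
    ContDiffAt ℝ n (chartForm I α x₀) u := by
  refine ((h.comp u ((contDiffAt_chartChange hu).of_le le_top)).clm_comp
    (contDiffAt_fderiv_chartChange hu n)).congr_of_eventuallyEq ?_
  filter_upwards [(isOpen_chartOverlap x₀ y).mem_nhds hu] with u' hu'
  exact chartForm_chartChange α hu'

lemma contDiffAt_chartField_of_chartChange {n : WithTop ℕ∞}
    {E : ∀ x : M, TangentSpace I x} {x₀ y : M} {u : W} (hu : u ∈ chartOverlap I x₀ y)
    (h : ContDiffAt ℝ n (chartField I E y) (chartChange I x₀ y u)) :
    ContDiffAt ℝ n (chartField I E x₀) u := by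
  have hc : ContDiffAt ℝ n (chartChange I x₀ y) u := (contDiffAt_chartChange hu).of_le le_top
  refine (((contDiffAt_fderiv_chartChange (chartChange_mem hu) n).comp u hc).clm_apply
    (h.comp u hc)).congr_of_eventuallyEq ?_
  filter_upwards [(isOpen_chartOverlap x₀ y).mem_nhds hu] with u' hu'
  rw [Function.comp_apply, Function.comp_apply, chartField_chartChange E (chartChange_mem hu'),
    chartChange_chartChange hu']

section invariance

variable [FiniteDimensional ℝ W]

/-- The Ricci tensor may be computed in any chart. -/
lemma coordRicci_chart {g : ∀ x : M, TangentSpace I x →L[ℝ] TangentSpace I x →L[ℝ] ℝ}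
    {x₀ : M} {u : W} (hu : u ∈ (extChartAt I x₀).target)
    (hg : ContDiffAt ℝ ∞ (chartBilin I g x₀) u) (hi : (chartBilin I g x₀ u).IsInvertible)
    (hs : ∀ x v w, g x v w = g x w v) (v w : W) :
    coordRicci (chartBilin I g x₀) u v w =
      ricci I g ((extChartAt I x₀).symm u) (frameMap I x₀ u v) (frameMap I x₀ u w) := by
  set y := (extChartAt I x₀).symm u with hy
  have huy : u ∈ chartOverlap I x₀ y := mem_chartOverlap hu
  have hyu := chartChange_mem huy
  -- As `y` is the point itself, the change of charts lands at the centre of the chart at `y`. There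
  -- `ricci` is defined and `frameMap` is the identity.
  have hφu : chartChange I x₀ y u = extChartAt I y y := rfl
  have hg' : ContDiffAt ℝ ∞ (chartBilin I g y) (chartChange I x₀ y u) :=
    contDiffAt_chartBilin_of_chartChange hyu (by rwa [chartChange_chartChange huy])
  have hi' : (chartBilin I g y (chartChange I x₀ y u)).IsInvertible := by
    rw [chartBilin_chartChange g hyu, chartChange_chartChange huy]
    exact isInvertible_pullBilin hi (isInvertible_fderiv_chartChange hyu)
  rw [coordRicci_pullBilin ((contDiffAt_chartChange huy).of_le le_top)
    (isInvertible_fderiv_chartChange huy) hg' hi' (Filter.Eventually.of_forall fun _ _ _ ↦ hs _ _ _)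
    (by
      filter_upwards [(isOpen_chartOverlap x₀ y).mem_nhds huy] with u' hu'
      exact chartBilin_chartChange g hu')]
  change coordRicci (chartBilin I g y) _ _ _ = coordRicci (chartBilin I g y) _
    (frameMap I x₀ u v) (frameMap I x₀ u w)
  rw [frameMap_chartChange huy, frameMap_chartChange huy, hφu, frameMap_self, frameMap_self]

/-- The Lie derivative may be computed in any chart. -/
lemma coordLie_chart {g : ∀ x : M, TangentSpace I x →L[ℝ] TangentSpace I x →L[ℝ] ℝ}
    {E : ∀ x : M, TangentSpace I x} {x₀ : M} {u : W} (hu : u ∈ (extChartAt I x₀).target)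
    (hg : ContDiffAt ℝ 1 (chartBilin I g x₀) u) (hE : ContDiffAt ℝ 1 (chartField I E x₀) u)
    (v w : W) :
    coordLie (chartField I E x₀) (chartBilin I g x₀) u v w =
      lieDeriv I E g ((extChartAt I x₀).symm u) (frameMap I x₀ u v) (frameMap I x₀ u w) := by
  set y := (extChartAt I x₀).symm u with hy
  have huy : u ∈ chartOverlap I x₀ y := mem_chartOverlap hu
  have hyu := chartChange_mem huy
  have hφu : chartChange I x₀ y u = extChartAt I y y := rfl
  have hg' : ContDiffAt ℝ 1 (chartBilin I g y) (chartChange I x₀ y u) :=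
    contDiffAt_chartBilin_of_chartChange hyu (by rwa [chartChange_chartChange huy])
  have hE' : ContDiffAt ℝ 1 (chartField I E y) (chartChange I x₀ y u) :=
    contDiffAt_chartField_of_chartChange hyu (by rwa [chartChange_chartChange huy])
  rw [coordLie_pullBilin ((contDiffAt_chartChange huy).of_le le_top)
    (hg'.differentiableAt (by simp)) (hg.differentiableAt (by simp))
    (by
      filter_upwards [(isOpen_chartOverlap x₀ y).mem_nhds huy] with u' hu'
      exact chartBilin_chartChange g hu') (hE'.differentiableAt (by simp))
    (hE.differentiableAt (by simp))
    (by
      filter_upwards [(isOpen_chartOverlap x₀ y).mem_nhds huy] with u' hu'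
      exact chartField_chartChange E hu')]
  change coordLie (chartField I E y) (chartBilin I g y) _ _ _ =
    coordLie (chartField I E y) (chartBilin I g y) _
    (frameMap I x₀ u v) (frameMap I x₀ u w)
  rw [frameMap_chartChange huy, frameMap_chartChange huy, hφu, frameMap_self, frameMap_self]

/-- The exterior derivative may be computed in any chart. -/
lemma coordExtDeriv_chart {α : ∀ x : M, TangentSpace I x →L[ℝ] ℝ}
    {x₀ : M} {u : W} (hu : u ∈ (extChartAt I x₀).target)
    (hα : ContDiffAt ℝ 1 (chartForm I α x₀) u) (v w : W) :
    coordExtDeriv (chartForm I α x₀) u v w =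
      extDerivForm I α ((extChartAt I x₀).symm u) (frameMap I x₀ u v) (frameMap I x₀ u w) := by
  set y := (extChartAt I x₀).symm u with hy
  have huy : u ∈ chartOverlap I x₀ y := mem_chartOverlap hu
  have hyu := chartChange_mem huy
  have hφu : chartChange I x₀ y u = extChartAt I y y := rfl
  have hα' : ContDiffAt ℝ 1 (chartForm I α y) (chartChange I x₀ y u) :=
    contDiffAt_chartForm_of_chartChange hyu (by rwa [chartChange_chartChange huy])
  rw [coordExtDeriv_pull ((contDiffAt_chartChange huy).of_le le_top)
    (hα'.differentiableAt (by simp))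
    (by
      filter_upwards [(isOpen_chartOverlap x₀ y).mem_nhds huy] with u' hu'
      exact chartForm_chartChange α hu')]
  change coordExtDeriv (chartForm I α y) _ _ _ = coordExtDeriv (chartForm I α y) _
    (frameMap I x₀ u v) (frameMap I x₀ u w)
  rw [frameMap_chartChange huy, frameMap_chartChange huy, hφu, frameMap_self, frameMap_self]

end invariance

end Charts

end BeltramiSoliton

namespace BeltramiSoliton

/-! ### Smooth sections of bundles versus smooth coordinate expressions. -/

section Smoothness

variable {W : Type*} [NormedAddCommGroup W] [NormedSpace ℝ W] {H : Type*} [TopologicalSpace H]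
  {I : ModelWithCorners ℝ W H} [I.Boundaryless] {M : Type*} [TopologicalSpace M] [ChartedSpace H M]
  [IsManifold I ω M] {n : WithTop ℕ∞}

lemma contDiffAt_comp_extChartAt_symm {F : Type*} [NormedAddCommGroup F] [NormedSpace ℝ F]
    {f : M → F} {x₀ : M} {u : W} (hu : u ∈ (extChartAt I x₀).target)
    (hf : ContMDiffAt I 𝓘(ℝ, F) n f ((extChartAt I x₀).symm u)) :
    ContDiffAt ℝ n (fun u' ↦ f ((extChartAt I x₀).symm u')) u := by
  rw [← contMDiffAt_iff_contDiffAt]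
  exact hf.comp u ((contMDiffOn_extChartAt_symm (I := I) (n := n) x₀).contMDiffAt
    ((isOpen_extChartAt_target x₀).mem_nhds hu))

lemma contMDiffAt_of_contDiffAt_symm {F : Type*} [NormedAddCommGroup F] [NormedSpace ℝ F]
    {f : M → F} {x₀ : M} {u : W} (hu : u ∈ (extChartAt I x₀).target)
    (hf : ContDiffAt ℝ n (fun u' ↦ f ((extChartAt I x₀).symm u')) u) :
    ContMDiffAt I 𝓘(ℝ, F) n f ((extChartAt I x₀).symm u) := by
  have hs := (extChartAt I x₀).map_target hu
  have h1 : ContMDiffAt I 𝓘(ℝ, W) n (extChartAt I x₀) ((extChartAt I x₀).symm u) :=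
    contMDiffAt_extChartAt' (by rwa [← extChartAt_source (I := I)])
  have h2 : ContMDiffAt 𝓘(ℝ, W) 𝓘(ℝ, F) n (fun u' ↦ f ((extChartAt I x₀).symm u'))
      (extChartAt I x₀ ((extChartAt I x₀).symm u)) := by
    rw [(extChartAt I x₀).right_inv hu]
    exact hf.contMDiffAt
  refine (h2.comp _ h1).congr_of_eventuallyEq ?_
  filter_upwards [(isOpen_extChartAt_source (I := I) x₀).mem_nhds hs] with q hq
  rw [Function.comp_apply, (extChartAt I x₀).left_inv hq]

lemma frameMap_eq_fderiv {x₀ : M} {u : W} (hu : u ∈ (extChartAt I x₀).target) :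
    frameMap I x₀ u = fderiv ℝ (chartChange I x₀ ((extChartAt I x₀).symm u)) u := by
  ext v
  rw [frameMap_chartChange (mem_chartOverlap hu)]
  exact frameMap_self _ _

lemma mem_baseSet {x₀ : M} {u : W} (hu : u ∈ (extChartAt I x₀).target) :
    (extChartAt I x₀).symm u ∈ (trivializationAt W (TangentSpace I) x₀).baseSet := by
  have hs := (extChartAt I x₀).map_target hu
  rw [extChartAt_source] at hs
  simpa using hs

/-- Identifies the local trivialization of the tangent bundle, in terms of which the smoothness of
sections is defined, with the derivative of the inverse chart, in terms of which tensors are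
expressed here. -/
lemma symmL_trivializationAt_eq_frameMap {x₀ : M} {u : W} (hu : u ∈ (extChartAt I x₀).target)
    (v : W) : (show W from (trivializationAt W (TangentSpace I) x₀).symm ((extChartAt I x₀).symm u) v) =
      frameMap I x₀ u v := by
  have hs := (extChartAt I x₀).map_target hu
  have h1 := TangentBundle.symmL_trivializationAt (I := I) (x₀ := x₀)
    (x := (extChartAt I x₀).symm u) (by rwa [← extChartAt_source (I := I)])
  rw [(extChartAt I x₀).right_inv hu] at h1
  have h2 := DFunLike.congr_fun h1 v
  rw [Trivialization.symmL_apply (hb := mem_baseSet hu)] at h2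
  exact h2

lemma contDiffAt_chartForm_self {α : ∀ x : M, TangentSpace I x →L[ℝ] ℝ} {x : M}
    (hα : ContMDiffAt I (I.prod 𝓘(ℝ, W →L[ℝ] ℝ)) n
      (fun p : M ↦ (TotalSpace.mk' (W →L[ℝ] ℝ)
        (E := fun p : M ↦ (TangentSpace I p →L[ℝ] Bundle.Trivial M ℝ p)) p (α p))) x) :
    ContDiffAt ℝ n (chartForm I α x) (extChartAt I x x) := by
  have h1 := ((contMDiffAt_hom_bundle _).1 hα).2
  have hx := mem_extChartAt_target (I := I) x
  have h2 := contDiffAt_comp_extChartAt_symm hx (by rwa [extChartAt_to_inv])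
  refine h2.congr_of_eventuallyEq ?_
  filter_upwards [(isOpen_extChartAt_target (I := I) x).mem_nhds hx] with u hu
  ext v
  rw [ContinuousLinearMap.inCoordinates_eq (mem_baseSet hu) (by simp)]
  simp only [ContinuousLinearMap.comp_apply]
  let α' : M → W →L[ℝ] ℝ := α
  change α' _ (frameMap I x u v) = _
  rw [← symmL_trivializationAt_eq_frameMap hu]
  rfl

lemma contDiffAt_chartBilin_self
    {g : ∀ x : M, TangentSpace I x →L[ℝ] TangentSpace I x →L[ℝ] ℝ} {x : M}
    (hg : ContMDiffAt I (I.prod 𝓘(ℝ, W →L[ℝ] W →L[ℝ] ℝ)) n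
      (fun p : M ↦ (TotalSpace.mk' (W →L[ℝ] W →L[ℝ] ℝ)
        (E := fun p : M ↦ (TangentSpace I p →L[ℝ] TangentSpace I p →L[ℝ] ℝ)) p (g p))) x) :
    ContDiffAt ℝ n (chartBilin I g x) (extChartAt I x x) := by
  have h1 := ((contMDiffAt_hom_bundle _).1 hg).2
  have hx := mem_extChartAt_target (I := I) x
  have h2 := contDiffAt_comp_extChartAt_symm hx (by rwa [extChartAt_to_inv])
  refine h2.congr_of_eventuallyEq ?_
  filter_upwards [(isOpen_extChartAt_target (I := I) x).mem_nhds hx] with u hu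
  ext v w
  erw [inCoordinates_apply_eq₂ (E₃ := Bundle.Trivial M ℝ) (mem_baseSet hu) (mem_baseSet hu)
    (by simp)]
  let g' : M → W →L[ℝ] W →L[ℝ] ℝ := g
  change g' _ (frameMap I x u v) (frameMap I x u w) = _
  rw [← symmL_trivializationAt_eq_frameMap hu, ← symmL_trivializationAt_eq_frameMap hu]
  simp
  rfl

lemma contDiffAt_chartField_self {E : ∀ x : M, TangentSpace I x} {x : M}
    (hE : ContMDiffAt I I.tangent n (fun p ↦ (⟨p, E p⟩ : TangentBundle I M)) x) :
    ContDiffAt ℝ n (chartField I E x) (extChartAt I x x) := by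
  have h1 := (contMDiffAt_section x).1 hE
  have hx := mem_extChartAt_target (I := I) x
  have h2 := contDiffAt_comp_extChartAt_symm hx (by rwa [extChartAt_to_inv])
  refine h2.congr_of_eventuallyEq ?_
  filter_upwards [(isOpen_extChartAt_target (I := I) x).mem_nhds hx] with u hu
  refine frameMap_injective hu ?_
  rw [frameMap_chartField E hu, ← symmL_trivializationAt_eq_frameMap hu]
  exact ((trivializationAt W (TangentSpace I) x).symm_proj_apply ⟨_, E _⟩ (mem_baseSet hu)).symm

lemma contMDiffAt_of_contDiffAt_chartField {E : ∀ x : M, TangentSpace I x} {x : M}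
    (hE : ContDiffAt ℝ n (chartField I E x) (extChartAt I x x)) :
    ContMDiffAt I I.tangent n (fun p ↦ (⟨p, E p⟩ : TangentBundle I M)) x := by
  refine (contMDiffAt_section x).2 ?_
  have hx := mem_extChartAt_target (I := I) x
  have h2 := contMDiffAt_of_contDiffAt_symm (f := fun p : M ↦
    (trivializationAt W (TangentSpace I) x ⟨p, E p⟩).2) hx (hE.congr_of_eventuallyEq ?_)
  · rwa [extChartAt_to_inv] at h2
  filter_upwards [(isOpen_extChartAt_target (I := I) x).mem_nhds hx] with u hu
  refine frameMap_injective hu ?_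
  rw [frameMap_chartField E hu, ← symmL_trivializationAt_eq_frameMap hu]
  exact ((trivializationAt W (TangentSpace I) x).symm_proj_apply ⟨_, E _⟩ (mem_baseSet hu))

end Smoothness

/-! ### Product charts of `N × ℝ`. -/

section Product

variable {N : Type*} [TopologicalSpace N] [ChartedSpace E3 N] [IsManifold 𝓘(ℝ, E3) ω N]

instance : IsManifold (J) ω (N × ℝ) := inferInstance

lemma extChartAt_J (x : N × ℝ) (y : N × ℝ) :
    extChartAt J x y = (extChartAt 𝓘(ℝ, E3) x.1 y.1, y.2) := by
  rw [extChartAt_prod]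
  rfl

lemma extChartAt_J_symm (x : N × ℝ) (w : E3 × ℝ) :
    (extChartAt J x).symm w = ((extChartAt 𝓘(ℝ, E3) x.1).symm w.1, w.2) := by
  rw [extChartAt_prod]
  rfl

lemma mem_extChartAt_J_target (x : N × ℝ) (w : E3 × ℝ) :
    w ∈ (extChartAt J x).target ↔ w.1 ∈ (extChartAt 𝓘(ℝ, E3) x.1).target := by
  rw [extChartAt_prod]
  simp [chartAt_self_eq]

lemma chartChange_J (x y : N × ℝ) (w : E3 × ℝ) :
    chartChange J x y w = (chartChange 𝓘(ℝ, E3) x.1 y.1 w.1, w.2) := by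
  rw [chartChange, extChartAt_J_symm, extChartAt_J]
  rfl

lemma frameMap_J (x : N × ℝ) {w : E3 × ℝ} (hw : w.1 ∈ (extChartAt 𝓘(ℝ, E3) x.1).target)
    (v : E3 × ℝ) : frameMap J x w v = (frameMap 𝓘(ℝ, E3) x.1 w.1 v.1, v.2) := by
  have hw' := (mem_extChartAt_J_target x w).2 hw
  rw [frameMap_eq_fderiv hw', frameMap_eq_fderiv hw]
  have h1 : chartChange J x ((extChartAt J x).symm w) =
      Prod.map (chartChange 𝓘(ℝ, E3) x.1 ((extChartAt 𝓘(ℝ, E3) x.1).symm w.1)) id := by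
    ext1 w'
    rw [chartChange_J, extChartAt_J_symm]
    rfl
  have h2 := ((contDiffAt_chartChange (mem_chartOverlap hw)).differentiableAt
    (by simp)).hasFDerivAt.prodMap w (hasFDerivAt_id (𝕜 := ℝ) w.2)
  rw [h1, h2.fderiv]
  rfl

end Product

end BeltramiSoliton

namespace BeltramiSoliton

/-! ### Orthonormal bases with a prescribed vector and orientation. -/

section OrthonormalBases

variable {V : Type*} [AddCommGroup V] [Module ℝ V] [TopologicalSpace V] [IsTopologicalAddGroup V]
  [ContinuousSMul ℝ V]

/-- `e` is an orthonormal basis for the bilinear form `b`. -/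
def IsOrthonormalFor {ι : Type*} [DecidableEq ι] (b : V →L[ℝ] V →L[ℝ] ℝ) (e : Module.Basis ι ℝ V) : Prop :=
  ∀ i j, b (e i) (e j) = if i = j then 1 else 0

lemma exists_isOrthonormalFor [FiniteDimensional ℝ V] {n : ℕ} (hn : Module.finrank ℝ V = n)
    {b : V →L[ℝ] V →L[ℝ] ℝ} (hs : ∀ v w, b v w = b w v) (hp : ∀ v, v ≠ 0 → 0 < b v v) :
    ∃ e : Module.Basis (Fin n) ℝ V, IsOrthonormalFor b e := by
  let B : LinearMap.BilinForm ℝ V := LinearMap.mk₂ ℝ (fun v w ↦ b v w) (by simp) (by simp)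
    (by simp) (by simp)
  have hB : ∀ v w, B v w = b v w := fun _ _ ↦ rfl
  obtain ⟨e, he⟩ := LinearMap.BilinForm.exists_orthogonal_basis (B := B) ⟨fun v w ↦ hs v w⟩
  subst hn
  have hpos : ∀ i, 0 < b (e i) (e i) := fun i ↦ hp _ (e.ne_zero i)
  refine ⟨e.unitsSMul fun i ↦ Units.mk0 (Real.sqrt (b (e i) (e i)))⁻¹
    (inv_ne_zero (Real.sqrt_pos.2 (hpos i)).ne'), fun i j ↦ ?_⟩
  simp only [Module.Basis.unitsSMul_apply, Units.smul_mk0, map_smul, smul_apply, smul_eq_mul]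
  split_ifs with hij
  · subst hij
    have h1 := (Real.sqrt_pos.2 (hpos i)).ne'
    have h2 := Real.mul_self_sqrt (hpos i).le
    field_simp
    rw [sq, h2]
  · have : b (e i) (e j) = 0 := he hij
    rw [this, mul_zero, mul_zero]

variable {b : V →L[ℝ] V →L[ℝ] ℝ}

lemma IsOrthonormalFor.eq_sum {ι : Type*} [Fintype ι] [DecidableEq ι] {e : Module.Basis ι ℝ V}
    (he : IsOrthonormalFor b e) (v : V) : v = ∑ i, b v (e i) • e i := by
  have h1 : ∀ i, e.repr v i = b v (e i) := by
    intro i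
    conv_rhs => rw [← e.sum_repr v]
    simp only [map_sum, map_smul, sum_apply, smul_apply, he _ i, smul_eq_mul]
    simp
  conv_lhs => rw [← e.sum_repr v]
  simp_rw [h1]

lemma IsOrthonormalFor.repr_apply {ι : Type*} [Fintype ι] [DecidableEq ι] {e : Module.Basis ι ℝ V}
    (he : IsOrthonormalFor b e) (v : V) (i : ι) : e.repr v i = b v (e i) := by
  conv_rhs => rw [← e.sum_repr v]
  simp only [map_sum, map_smul, sum_apply, smul_apply, he _ i, smul_eq_mul]
  simp

/-- An orthonormal basis may be chosen with a prescribed vector. -/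
lemma IsOrthonormalFor.exists_apply_eq {n : ℕ} {e : Module.Basis (Fin n) ℝ V}
    (he : IsOrthonormalFor b e) {v : V} (hv : b v v = 1) (k : Fin n) :
    ∃ e' : Module.Basis (Fin n) ℝ V, IsOrthonormalFor b e' ∧ e' k = v := by
  -- The isometry given by `e` transports the problem to Euclidean space, where a unit vector
  -- extends to an orthonormal basis.
  let T : EuclideanSpace ℝ (Fin n) ≃ₗ[ℝ] V :=
    (EuclideanSpace.basisFun (Fin n) ℝ).toBasis.equiv e (Equiv.refl _)
  have hT : ∀ i, T (EuclideanSpace.basisFun (Fin n) ℝ i) = e i := fun i ↦ by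
    have := (EuclideanSpace.basisFun (Fin n) ℝ).toBasis.equiv_apply i e (Equiv.refl _)
    simpa using this
  have hTi : ∀ x y, b (T x) (T y) = inner ℝ x y := by
    intro x y
    have hx : ∀ x, T x = ∑ i, x i • e i := fun x ↦ by
      conv_lhs => rw [← (EuclideanSpace.basisFun (Fin n) ℝ).sum_repr x]
      simp only [map_sum, map_smul, hT, EuclideanSpace.basisFun_repr]
    rw [hx, hx]
    simp only [map_sum, map_smul, sum_apply, smul_apply, he _ _, smul_eq_mul,
      PiLp.inner_apply, RCLike.inner_apply, conj_trivial]
    refine Finset.sum_congr rfl fun i _ ↦ ?_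
    simp [mul_comm]
  have ho : Orthonormal ℝ (Set.domRestrict {k} fun _ : Fin n ↦ T.symm v) := by
    rw [orthonormal_iff_ite]
    rintro ⟨i, hi⟩ ⟨j, hj⟩
    obtain rfl := Set.mem_singleton_iff.1 hi
    obtain rfl := Set.mem_singleton_iff.1 hj
    rw [if_pos rfl]
    exact (hTi _ _).symm.trans (by simp [hv])
  obtain ⟨B, hB⟩ := ho.exists_orthonormalBasis_extension_of_card_eq (by simp)
  refine ⟨B.toBasis.map T, fun i j ↦ ?_, ?_⟩
  · simp [hTi, orthonormal_iff_ite.1 B.orthonormal]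
  · simp [hB k rfl]

/-- An orthonormal basis of a three-dimensional space may be chosen in a given orientation, without
changing its last vector. -/
lemma IsOrthonormalFor.exists_orientation_eq {e : Module.Basis (Fin 3) ℝ V}
    (he : IsOrthonormalFor b e) (o : Orientation ℝ V (Fin 3)) :
    ∃ e' : Module.Basis (Fin 3) ℝ V, IsOrthonormalFor b e' ∧ e'.orientation = o ∧ e' 2 = e 2 := by
  rcases e.orientation_eq_or_eq_neg o with h | h
  · exact ⟨e, he, h.symm, rfl⟩
  -- Changing the sign of the first vector reverses the orientation and keeps the last vector.
  · refine ⟨e.unitsSMul (Function.update 1 0 (-1)), fun i j ↦ ?_, ?_, ?_⟩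
    · simp only [Module.Basis.unitsSMul_apply]
      fin_cases i <;> fin_cases j <;> simp [he _ _, Units.smul_def]
    · rw [Module.Basis.orientation_neg_single, h]
    · simp [Module.Basis.unitsSMul_apply]

/-- The basis `(e₁, e₂, e₀)`. -/
def cyclicBasis (e : Module.Basis (Fin 3) ℝ V) : Module.Basis (Fin 3) ℝ V :=
  e.reindex (finRotate 3).symm

lemma cyclicBasis_apply (e : Module.Basis (Fin 3) ℝ V) (i : Fin 3) :
    cyclicBasis e i = e (i + 1) := by
  simp [cyclicBasis]

/-- A cyclic permutation of three vectors is even. -/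
lemma orientation_cyclicBasis (e : Module.Basis (Fin 3) ℝ V) :
    (cyclicBasis e).orientation = e.orientation := by
  rw [eq_comm, Module.Basis.orientation_eq_iff_det_pos]
  have : (cyclicBasis e : Fin 3 → V) = e ∘ finRotate 3 := by
    ext i; simp [cyclicBasis]
  rw [this, AlternatingMap.map_perm, Module.Basis.det_self, sign_finRotate]
  norm_num

lemma IsOrthonormalFor.cyclicBasis {e : Module.Basis (Fin 3) ℝ V} (he : IsOrthonormalFor b e) :
    IsOrthonormalFor b (cyclicBasis e) := by
  intro i j
  rw [cyclicBasis_apply, cyclicBasis_apply, he]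
  simp

end OrthonormalBases

/-! ### The square of the Hodge dual of `A`. -/

section HodgeIdentity

variable {V : Type*} [NormedAddCommGroup V] [NormedSpace ℝ V]
  {h : V → V →L[ℝ] V →L[ℝ] ℝ} {A : V → V →L[ℝ] ℝ} {u : V}

lemma IsOrthonormalFor.apply_eq_sum {b : V →L[ℝ] V →L[ℝ] ℝ} {e : Module.Basis (Fin 3) ℝ V}
    (he : IsOrthonormalFor b e) (L : V →L[ℝ] ℝ) (v : V) :
    L v = b v (e 0) * L (e 0) + b v (e 1) * L (e 1) + b v (e 2) * L (e 2) := by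
  conv_lhs => rw [he.eq_sum v]
  simp [Fin.sum_univ_three]

/-- In a basis where `dA = -2 * A`, the endomorphism is `s ↦ A♯ × s`, and this is Lagrange's
identity `⟨a × s, a × t⟩ = |a|² ⟨s, t⟩ - ⟨a, s⟩ ⟨a, t⟩`. -/
lemma hodgeL_hodgeL (hi : (h u).IsInvertible) (hs : ∀ v w, h u v w = h u w v)
    {e : Module.Basis (Fin 3) ℝ V} (he : IsOrthonormalFor (h u) e)
    (h01 : coordExtDeriv A u (e 0) (e 1) = -2 * A u (e 2))
    (h12 : coordExtDeriv A u (e 1) (e 2) = -2 * A u (e 0))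
    (h20 : coordExtDeriv A u (e 2) (e 0) = -2 * A u (e 1)) (s t : V) :
    h u (hodgeL h A u s) (hodgeL h A u t) = A u (sharpL h A u) * h u s t - A u s * A u t := by
  have hd : ∀ s t, coordExtDeriv A u s t = -coordExtDeriv A u t s := fun s t ↦ by
    simp [coordExtDeriv]
  have hdd : ∀ s, coordExtDeriv A u s s = 0 := fun s ↦ by simp [coordExtDeriv]
  have hK : ∀ s t, h u (hodgeL h A u s) t = -(1 / 2) * (h u s (e 0) * coordExtDeriv A u (e 0) t +
      h u s (e 1) * coordExtDeriv A u (e 1) t + h u s (e 2) * coordExtDeriv A u (e 2) t) := by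
    intro s t
    rw [apply_hodgeL hi]
    have := he.apply_eq_sum ((fderiv ℝ A u).flip t - fderiv ℝ A u t) s
    simp only [sub_apply, ContinuousLinearMap.flip_apply] at this
    rw [coordExtDeriv, this]
    rfl
  have hb : ∀ x y, h u x y = h u x (e 0) * h u y (e 0) + h u x (e 1) * h u y (e 1) +
      h u x (e 2) * h u y (e 2) := by
    intro x y
    have := he.apply_eq_sum (h u y) x
    rw [hs x y, this]
  rw [hb (hodgeL h A u s), hK s, hK s, hK s, hK t, hK t, hK t, hb s t, he.apply_eq_sum (A u) s,
    he.apply_eq_sum (A u) t, he.apply_eq_sum (A u) (sharpL h A u), apply_sharpL hi,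
    apply_sharpL hi, apply_sharpL hi, hdd, hdd, hdd, hd (e 1) (e 0), hd (e 2) (e 1),
    hd (e 0) (e 2), h01, h12, h20]
  ring

end HodgeIdentity

end BeltramiSoliton

namespace BeltramiSoliton

/-! ### The Beltrami data in charts; adapted frames; the Ricci tensor in a product chart. -/

section BeltramiGeometry

variable {N : Type*} [TopologicalSpace N] [ChartedSpace E3 N] [IsManifold 𝓘(ℝ, E3) ω N]
  {h : AnalyticMetric N} {o : ManifoldOrientation N} {A : OneForm N}

/-- The metric `h` in the chart at `p`. -/
abbrev metricC (h : AnalyticMetric N) (p : N) : E3 → E3 →L[ℝ] E3 →L[ℝ] ℝ :=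
  chartBilin 𝓘(ℝ, E3) h.inner p

/-- The one-form `A` in the chart at `p`. -/
abbrev formC (A : OneForm N) (p : N) : E3 → E3 →L[ℝ] ℝ := chartForm 𝓘(ℝ, E3) A p

/-- The target of the chart at `p`. -/
abbrev targetC (p : N) : Set E3 := (extChartAt 𝓘(ℝ, E3) p).target

/-- The inverse of the chart at `p`. -/
abbrev symmC (p : N) (u : E3) : N := (extChartAt 𝓘(ℝ, E3) p).symm u

lemma contDiffAt_metricC (h : AnalyticMetric N) {p : N} {u : E3} (hu : u ∈ targetC p) :
    ContDiffAt ℝ ω (metricC h p) u :=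
  contDiffAt_chartBilin_of_chartChange (mem_chartOverlap hu)
    (contDiffAt_chartBilin_self (h.contMDiff _))

lemma contDiffAt_formC {n : WithTop ℕ∞} (hA : OneForm.IsContMDiff n A) {p : N} {u : E3}
    (hu : u ∈ targetC p) : ContDiffAt ℝ n (formC A p) u :=
  contDiffAt_chartForm_of_chartChange (mem_chartOverlap hu)
    (contDiffAt_chartForm_self (hA _))

lemma metricC_apply (h : AnalyticMetric N) (p : N) (u v w : E3) :
    metricC h p u v w = h.inner (symmC p u) (frameMap 𝓘(ℝ, E3) p u v) (frameMap 𝓘(ℝ, E3) p u w) := rfl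

lemma formC_apply (A : OneForm N) (p : N) (u v : E3) :
    formC A p u v = A (symmC p u) (frameMap 𝓘(ℝ, E3) p u v) := rfl

lemma metricC_symm (h : AnalyticMetric N) (p : N) (u v w : E3) :
    metricC h p u v w = metricC h p u w v := h.symm _ _ _

lemma metricC_pos (h : AnalyticMetric N) {p : N} {u : E3} (hu : u ∈ targetC p) {v : E3}
    (hv : v ≠ 0) : 0 < metricC h p u v v := by
  refine h.pos _ _ fun h0 ↦ hv ?_
  exact frameMap_injective hu (h0.trans (map_zero (frameMap 𝓘(ℝ, E3) p u)).symm)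

lemma isInvertible_metricC (h : AnalyticMetric N) {p : N} {u : E3} (hu : u ∈ targetC p) :
    (metricC h p u).IsInvertible := by
  refine isInvertible_of_nondegenerate fun v hv ↦ ?_
  by_contra hne
  exact (metricC_pos h hu hne).ne' (hv v)

/-- The coordinates of a basis of a tangent space. -/
def coordBasis {p : N} {u : E3} (hu : u ∈ targetC p)
    (e : Module.Basis (Fin 3) ℝ (TN (symmC p u))) : Module.Basis (Fin 3) ℝ E3 :=
  (show Module.Basis (Fin 3) ℝ E3 from e).map
    (isInvertible_frameMap hu).choose.symm.toLinearEquiv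

lemma frameMap_coordBasis {p : N} {u : E3} (hu : u ∈ targetC p)
    (e : Module.Basis (Fin 3) ℝ (TN (symmC p u))) (i : Fin 3) :
    frameMap 𝓘(ℝ, E3) p u (coordBasis hu e i) = e i := by
  have h1 := (isInvertible_frameMap hu).choose_spec
  rw [← h1, coordBasis, Module.Basis.map_apply]
  exact (isInvertible_frameMap hu).choose.apply_symm_apply _

lemma isOrthonormalFor_coordBasis {p : N} {u : E3} (hu : u ∈ targetC p)
    {e : Module.Basis (Fin 3) ℝ (TN (symmC p u))} (he : IsPositiveOrthonormal h o e) :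
    IsOrthonormalFor (metricC h p u) (coordBasis hu e) := by
  intro i j
  rw [metricC_apply, frameMap_coordBasis, frameMap_coordBasis]
  exact he.1 i j

lemma IsPositiveOrthonormal.cyclicBasis {q : N} {e : Module.Basis (Fin 3) ℝ (TN q)}
    (he : IsPositiveOrthonormal h o e) : IsPositiveOrthonormal h o (cyclicBasis e) :=
  ⟨IsOrthonormalFor.cyclicBasis (b := h.inner q) he.1, (orientation_cyclicBasis e).trans he.2⟩

lemma exists_isPositiveOrthonormal (h : AnalyticMetric N) (o : ManifoldOrientation N) (q : N) :
    ∃ e : Module.Basis (Fin 3) ℝ (TN q), IsPositiveOrthonormal h o e := by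
  have : FiniteDimensional ℝ (TN q) := inferInstanceAs (FiniteDimensional ℝ E3)
  have hd : Module.finrank ℝ (TN q) = 3 := finrank_euclideanSpace_fin (𝕜 := ℝ) (n := 3)
  obtain ⟨e, he⟩ := exists_isOrthonormalFor hd (h.symm q) (h.pos q)
  obtain ⟨e', he', ho, -⟩ := he.exists_orientation_eq (o.at_point q)
  exact ⟨e', he', ho⟩

lemma inner_sharp (h : AnalyticMetric N) (A : OneForm N) (q : N) (v : TN q) :
    h.inner q (sharp h A q) v = A q v := by
  have hi : (show E3 →L[ℝ] E3 →L[ℝ] ℝ from h.inner q).IsInvertible := by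
    refine isInvertible_of_nondegenerate fun v hv ↦ ?_
    by_contra hne
    exact (h.pos q v hne).ne' (hv v)
  exact apply_inverse hi _ _

lemma inner_sharp_pos (hA : IsBeltramiField h o A) (q : N) :
    0 < h.inner q (sharp h A q) (sharp h A q) := by
  refine h.pos q _ fun h0 ↦ hA.ne_zero q ?_
  ext v
  rw [← inner_sharp h A q v, h0, map_zero]

lemma formNorm_pos (hA : IsBeltramiField h o A) (q : N) : 0 < formNorm h A q :=
  Real.sqrt_pos.2 (inner_sharp_pos hA q)

lemma exists_isAdaptedFrame (hA : IsBeltramiField h o A) (q : N) :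
    ∃ e : Module.Basis (Fin 3) ℝ (TN q), IsAdaptedFrame h o A e := by
  obtain ⟨e, he⟩ := exists_isPositiveOrthonormal h o q
  have hn := formNorm_pos hA q
  have h1 : h.inner q ((formNorm h A q)⁻¹ • sharp h A q) ((formNorm h A q)⁻¹ • sharp h A q) = 1 := by
    have h2 : formNorm h A q * formNorm h A q = _ := Real.mul_self_sqrt (inner_sharp_pos hA q).le
    simp only [map_smul, smul_apply, smul_eq_mul, ← h2]
    field_simp
  obtain ⟨e₁, he₁, h2⟩ := IsOrthonormalFor.exists_apply_eq (b := h.inner q) he.1 h1 2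
  obtain ⟨e₂, he₂, ho, h3⟩ := he₁.exists_orientation_eq (o.at_point q)
  exact ⟨e₂, ⟨he₂, ho⟩, h3.trans h2⟩

lemma IsAdaptedFrame.form_apply {q : N} {e : Module.Basis (Fin 3) ℝ (TN q)} (hA : IsBeltramiField h o A)
    (he : IsAdaptedFrame h o A e) (i : Fin 3) :
    A q (e i) = if 2 = i then formNorm h A q else 0 := by
  have hn := (formNorm_pos hA q).ne'
  have h1 : sharp h A q = formNorm h A q • e 2 := by
    rw [he.2, smul_smul, mul_inv_cancel₀ hn, one_smul]
  rw [← inner_sharp, h1, map_smul, smul_apply, he.1.1, smul_eq_mul]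
  simp

section chart

variable {p : N} {u : E3}

lemma formC_coordBasis (hu : u ∈ targetC p) (e : Module.Basis (Fin 3) ℝ (TN (symmC p u))) (i : Fin 3) :
    formC A p u (coordBasis hu e i) = A (symmC p u) (e i) := by
  rw [formC_apply, frameMap_coordBasis]

lemma coordExtDeriv_coordBasis (hA : IsBeltramiField h o A) (hu : u ∈ targetC p)
    {e : Module.Basis (Fin 3) ℝ (TN (symmC p u))} (he : IsPositiveOrthonormal h o e) :
    coordExtDeriv (formC A p) u (coordBasis hu e 0) (coordBasis hu e 1) =
      -2 * formC A p u (coordBasis hu e 2) := by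
  rw [coordExtDeriv_chart hu ((contDiffAt_formC hA.smooth hu).of_le one_le_infty),
    frameMap_coordBasis, frameMap_coordBasis, formC_coordBasis]
  exact hA.beltrami _ e he

lemma coordBasis_cyclicBasis (hu : u ∈ targetC p) (e : Module.Basis (Fin 3) ℝ (TN (symmC p u)))
    (i : Fin 3) : coordBasis hu (cyclicBasis e) i = coordBasis hu e (i + 1) := by
  refine frameMap_injective hu ?_
  rw [frameMap_coordBasis, frameMap_coordBasis]
  exact cyclicBasis_apply e i

/-- The Beltrami equation is stated for the first two vectors of positive orthonormal bases; cyclic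
permutation of the basis yields the remaining components of `dA`. -/
lemma coordExtDeriv_coordBasis_one_two (hA : IsBeltramiField h o A) (hu : u ∈ targetC p)
    {e : Module.Basis (Fin 3) ℝ (TN (symmC p u))} (he : IsPositiveOrthonormal h o e) :
    coordExtDeriv (formC A p) u (coordBasis hu e 1) (coordBasis hu e 2) =
      -2 * formC A p u (coordBasis hu e 0) := by
  have := coordExtDeriv_coordBasis hA hu he.cyclicBasis
  simp only [coordBasis_cyclicBasis] at this
  exact this

lemma coordExtDeriv_coordBasis_two_zero (hA : IsBeltramiField h o A) (hu : u ∈ targetC p)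
    {e : Module.Basis (Fin 3) ℝ (TN (symmC p u))} (he : IsPositiveOrthonormal h o e) :
    coordExtDeriv (formC A p) u (coordBasis hu e 2) (coordBasis hu e 0) =
      -2 * formC A p u (coordBasis hu e 1) := by
  have := coordExtDeriv_coordBasis_one_two hA hu he.cyclicBasis
  simp only [coordBasis_cyclicBasis] at this
  exact this

lemma hodgeL_formC (hA : IsBeltramiField h o A) (hu : u ∈ targetC p) (s t : E3) :
    metricC h p u (hodgeL (metricC h p) (formC A p) u s) (hodgeL (metricC h p) (formC A p) u t) =
      formC A p u (sharpL (metricC h p) (formC A p) u) * metricC h p u s t -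
        formC A p u s * formC A p u t := by
  obtain ⟨e, he⟩ := exists_isPositiveOrthonormal h o (symmC p u)
  exact hodgeL_hodgeL (isInvertible_metricC h hu) (metricC_symm h p u)
    (isOrthonormalFor_coordBasis hu he) (coordExtDeriv_coordBasis hA hu he)
    (coordExtDeriv_coordBasis_one_two hA hu he) (coordExtDeriv_coordBasis_two_zero hA hu he) s t

lemma coordRicci_liftMetric_chart (hA : IsBeltramiField h o A) {w : E3 × ℝ} (hw : w.1 ∈ targetC p)
    (hρ : w.2 ≠ 0) (x y : E3 × ℝ) :
    coordRicci (liftMetric (metricC h p) (formC A p)) w x y =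
      coordRicci (metricC h p) w.1 x.1 y.1 - 2 * metricC h p w.1 x.1 y.1 := by
  obtain ⟨e, he⟩ := exists_isAdaptedFrame hA (symmC p w.1)
  have h1 := fun i ↦ (formC_coordBasis (A := A) hw e i).trans (he.form_apply hA i)
  have hev : ∀ᶠ u in 𝓝 w.1, u ∈ targetC p := (isOpen_extChartAt_target p).mem_nhds hw
  refine coordRicci_liftMetric hρ ((contDiffAt_metricC h hw).of_le le_top)
    (contDiffAt_formC hA.smooth hw) (isInvertible_metricC h hw)
    (Filter.Eventually.of_forall fun u ↦ metricC_symm h p u)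
    (hev.mono fun u hu ↦ hodgeL_formC hA hu) (coordBasis hw e)
    (isOrthonormalFor_coordBasis hw he.1) (formNorm_pos hA (symmC p w.1)).ne' ?_ ?_ ?_ ?_ x y
  · rw [h1]; simp
  · rw [h1]; simp
  · rw [h1]; simp
  · rw [coordExtDeriv_coordBasis hA hw he.1, h1]; simp

end chart

section product

variable {x : N × ℝ} {w : E3 × ℝ}

lemma dproj_eq_fst (y : N × ℝ) (v : TM y) : dproj y v = (show E3 × ℝ from v).1 :=
  dproj_mkTangent y (show E3 × ℝ from v).1 (show E3 × ℝ from v).2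

lemma drho_eq_snd (y : N × ℝ) (v : TM y) : drho y v = (show E3 × ℝ from v).2 :=
  drho_mkTangent y (show E3 × ℝ from v).1 (show E3 × ℝ from v).2

lemma theta_apply (A : OneForm N) (y : N × ℝ) (v : TM y) :
    theta A y v = y.2 * (show E3 × ℝ from v).2 + A y.1 (show E3 × ℝ from v).1 := by
  simp only [theta, add_apply, smul_apply, ContinuousLinearMap.comp_apply, dproj_eq_fst,
    drho_eq_snd, smul_eq_mul]

lemma theta_frameMap (hw : w.1 ∈ targetC x.1) (v : E3 × ℝ) :
    theta A ((extChartAt J x).symm w) (frameMap J x w v) = thetaL (formC A x.1) w v := by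
  let A' : N → E3 →L[ℝ] ℝ := A
  refine (theta_apply A _ _).trans ?_
  change ((extChartAt J x).symm w).2 * (frameMap J x w v).2 +
    A' ((extChartAt J x).symm w).1 (frameMap J x w v).1 = _
  rw [frameMap_J x hw, extChartAt_J_symm]
  rfl

lemma beltramiMetric_apply (y : N × ℝ) (v v' : TM y) :
    beltramiMetric h A y v v' = y.2 ^ 2 * h.inner y.1 (show E3 × ℝ from v).1
      (show E3 × ℝ from v').1 + (y.2 ^ 2)⁻¹ * (theta A y v * theta A y v') := by
  rw [beltramiMetric]
  change _ * h.inner y.1 (dproj y v) (dproj y v') + _ = _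
  rw [dproj_eq_fst, dproj_eq_fst]
  rfl

/-- In a product chart, whose last coordinate is `ρ` itself, the metric of `M` is the local model
`liftMetric`, so the computations on `V × ℝ` apply. -/
lemma beltramiMetric_frameMap (hw : w.1 ∈ targetC x.1) (v v' : E3 × ℝ) :
    beltramiMetric h A ((extChartAt J x).symm w) (frameMap J x w v) (frameMap J x w v') =
      liftMetric (metricC h x.1) (formC A x.1) w v v' := by
  let h' : N → E3 →L[ℝ] E3 →L[ℝ] ℝ := h.inner
  refine (beltramiMetric_apply _ _ _).trans ?_
  rw [liftMetric_apply, ← theta_frameMap hw, ← theta_frameMap hw]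
  change ((extChartAt J x).symm w).2 ^ 2 * h' ((extChartAt J x).symm w).1 (frameMap J x w v).1
    (frameMap J x w v').1 + (((extChartAt J x).symm w).2 ^ 2)⁻¹ * _ = _
  rw [frameMap_J x hw, frameMap_J x hw, extChartAt_J_symm]
  rfl

lemma chartBilin_beltramiMetric (hw : w.1 ∈ targetC x.1) :
    chartBilin J (beltramiMetric h A) x w = liftMetric (metricC h x.1) (formC A x.1) w := by
  exact ContinuousLinearMap.ext fun v ↦ ContinuousLinearMap.ext fun v' ↦
    beltramiMetric_frameMap (h := h) (A := A) (x := x) (w := w) hw v v'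

lemma chartBilin_beltramiMetric_eventuallyEq (hw : w.1 ∈ targetC x.1) :
    chartBilin J (beltramiMetric h A) x =ᶠ[𝓝 w] liftMetric (metricC h x.1) (formC A x.1) := by
  filter_upwards [continuous_fst.continuousAt.preimage_mem_nhds
    ((isOpen_extChartAt_target x.1).mem_nhds hw)] with w' hw'
  exact chartBilin_beltramiMetric hw'

end product

end BeltramiGeometry

end BeltramiSoliton

namespace BeltramiSoliton

/-! ### The soliton equation in a product chart. -/

section SolitonInCharts

lemma coordRicci_congr {W : Type*} [NormedAddCommGroup W] [NormedSpace ℝ W] [FiniteDimensional ℝ W]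
    {G G' : W → W →L[ℝ] W →L[ℝ] ℝ} {u : W} (h : G =ᶠ[𝓝 u] G') (v w : W) :
    coordRicci G u v w = coordRicci G' u v w := by
  have h1 : ∀ x y, (fun u' ↦ christoffel G u' x y) =ᶠ[𝓝 u] fun u' ↦ christoffel G' u' x y := by
    intro x y
    filter_upwards [h.eventually_nhds] with u' hu'
    have h2 : G =ᶠ[𝓝 u'] G' := hu'
    rw [christoffel, christoffel, christoffelFirst, christoffelFirst, h2.fderiv_eq,
      h2.self_of_nhds]
  simp only [coordRicci, curvature, (h1 _ _).fderiv_eq, (h1 _ _).self_of_nhds]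

lemma coordLie_congr {W : Type*} [NormedAddCommGroup W] [NormedSpace ℝ W]
    {G G' : W → W →L[ℝ] W →L[ℝ] ℝ} {E E' : W → W} {u : W} (h : G =ᶠ[𝓝 u] G') (hE : E =ᶠ[𝓝 u] E')
    (v w : W) : coordLie E G u v w = coordLie E' G' u v w := by
  simp only [coordLie, h.fderiv_eq, hE.fderiv_eq, h.self_of_nhds, hE.self_of_nhds]

variable {N : Type*} [TopologicalSpace N] [ChartedSpace E3 N] [IsManifold 𝓘(ℝ, E3) ω N]
  {h : AnalyticMetric N} {o : ManifoldOrientation N} {A : OneForm N} {E : ∀ x : N × ℝ, TM x}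

lemma contDiffAt_fieldC (hE : ContMDiffOn J J.tangent ω
      (fun x ↦ (⟨x, E x⟩ : TangentBundle J (N × ℝ))) (cylinder Set.univ))
    {x : N × ℝ} {w : E3 × ℝ} (hw : w.1 ∈ targetC x.1) (hρ : 0 < w.2) :
    ContDiffAt ℝ ω (chartField J E x) w := by
  have hw' := (mem_extChartAt_J_target x w).2 hw
  refine contDiffAt_chartField_of_chartChange (mem_chartOverlap hw') ?_
  refine contDiffAt_chartField_self (hE.contMDiffAt ?_)
  have h1 : IsOpen (cylinder (Set.univ : Set N)) := by
    have : cylinder (Set.univ : Set N) = Prod.snd ⁻¹' Set.Ioi 0 := by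
      ext y; simp [cylinder]
    rw [this]
    exact isOpen_Ioi.preimage continuous_snd
  refine h1.mem_nhds ?_
  rw [extChartAt_J_symm]
  exact ⟨trivial, hρ⟩

/-- The soliton equation at a point, in a product chart. -/
lemma soliton_equation_frameMap (hA : IsBeltramiField h o A) (hE : ContMDiffOn J J.tangent ω
      (fun x ↦ (⟨x, E x⟩ : TangentBundle J (N × ℝ))) (cylinder Set.univ))
    (a : ℝ) {x : N × ℝ} {w : E3 × ℝ} (hw : w.1 ∈ targetC x.1) (hρ : 0 < w.2) (v v' : E3 × ℝ) :
    ricci J (beltramiMetric h A) ((extChartAt J x).symm w) (frameMap J x w v) (frameMap J x w v')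
      + a * beltramiMetric h A ((extChartAt J x).symm w) (frameMap J x w v) (frameMap J x w v')
      + (1 / 2) * lieDeriv J E (beltramiMetric h A) ((extChartAt J x).symm w) (frameMap J x w v)
        (frameMap J x w v') =
    coordRicci (metricC h x.1) w.1 v.1 v'.1 - 2 * metricC h x.1 w.1 v.1 v'.1
      + a * liftMetric (metricC h x.1) (formC A x.1) w v v'
      + (1 / 2) * coordLie (chartField J E x) (liftMetric (metricC h x.1) (formC A x.1)) w v v' := by
  have hw' := (mem_extChartAt_J_target x w).2 hw
  have he := chartBilin_beltramiMetric_eventuallyEq (h := h) (A := A) (x := x) hw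
  have hg : ContDiffAt ℝ ∞ (chartBilin J (beltramiMetric h A) x) w :=
    (contDiffAt_liftMetric ((contDiffAt_metricC h hw).of_le le_top) (contDiffAt_formC hA.smooth hw)
      hρ.ne').congr_of_eventuallyEq he
  have hi : (chartBilin J (beltramiMetric h A) x w).IsInvertible := by
    rw [he.self_of_nhds]
    exact isInvertible_liftMetric (isInvertible_metricC h hw) hρ.ne'
  have hs : ∀ (y : N × ℝ) (v v' : TM y), beltramiMetric h A y v v' = beltramiMetric h A y v' v := by
    intro y v v'
    refine (beltramiMetric_apply y v v').trans (Eq.trans ?_ (beltramiMetric_apply y v' v).symm)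
    exact congrArg₂ (· + ·) (congrArg (y.2 ^ 2 * ·) (h.symm y.1 _ _))
      (congrArg ((y.2 ^ 2)⁻¹ * ·) (mul_comm _ _))
  have e1 := coordRicci_chart hw' hg hi hs v v'
  have e2 := coordLie_chart hw' (hg.of_le one_le_infty)
    ((contDiffAt_fieldC hE hw hρ).of_le le_top) v v'
  rw [coordRicci_congr he, coordRicci_liftMetric_chart hA hw hρ.ne'] at e1
  rw [coordLie_congr he (Filter.EventuallyEq.refl _ _)] at e2
  rw [e1, e2, ← beltramiMetric_frameMap hw]

/-- Passing to coordinates loses nothing because `frameMap` is onto the tangent space. The Ricci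
term has already been replaced by that of `h` minus `2 h`. -/
lemma soliton_at_iff (hA : IsBeltramiField h o A) (hE : ContMDiffOn J J.tangent ω
      (fun x ↦ (⟨x, E x⟩ : TangentBundle J (N × ℝ))) (cylinder Set.univ))
    (a : ℝ) {x : N × ℝ} {w : E3 × ℝ} (hw : w.1 ∈ targetC x.1) (hρ : 0 < w.2) :
    (∀ v v' : TM ((extChartAt J x).symm w), ricci J (beltramiMetric h A) ((extChartAt J x).symm w) v v'
      + a * beltramiMetric h A ((extChartAt J x).symm w) v v'
      + (1 / 2) * lieDeriv J E (beltramiMetric h A) ((extChartAt J x).symm w) v v' = 0) ↔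
    ∀ v v', coordRicci (metricC h x.1) w.1 v.1 v'.1 - 2 * metricC h x.1 w.1 v.1 v'.1
      + a * liftMetric (metricC h x.1) (formC A x.1) w v v'
      + (1 / 2) * coordLie (chartField J E x) (liftMetric (metricC h x.1) (formC A x.1)) w v v'
        = 0 := by
  have hw' := (mem_extChartAt_J_target x w).2 hw
  constructor
  · intro H v v'
    rw [← soliton_equation_frameMap hA hE a hw hρ]
    exact H _ _
  · intro H v v'
    obtain ⟨e, he⟩ := isInvertible_frameMap (I := J) hw'
    obtain ⟨v₁, h1⟩ := e.surjective (show E3 × ℝ from v)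
    obtain ⟨v₂, h2⟩ := e.surjective (show E3 × ℝ from v')
    have h3 := H v₁ v₂
    rw [← soliton_equation_frameMap hA hE a hw hρ, ← he] at h3
    erw [h1, h2] at h3
    exact h3

end SolitonInCharts

end BeltramiSoliton

namespace BeltramiSoliton

/-! ### Laurent expansion of the complexified vector field in a product chart. -/

section LocalLaurent

lemma exists_pos_le_all {ι : Type*} [Finite ι] (δ : ι → ℝ) (hδ : ∀ i, 0 < δ i) :
    ∃ d, 0 < d ∧ ∀ i, d ≤ δ i := by
  have h1 : ∀ᶠ d in 𝓝[>] (0 : ℝ), ∀ i, d ≤ δ i := by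
    rw [Filter.eventually_all]
    intro i
    filter_upwards [mem_nhdsWithin_of_mem_nhds (Iic_mem_nhds (hδ i))] with d hd using hd
  obtain ⟨d, hd, hd0⟩ := (h1.and self_mem_nhdsWithin).exists
  exact ⟨d, hd0, hd⟩

/-- The vector-valued version of `exists_laurent_expansion`. -/
theorem exists_laurent_expansion_prod {n m : ℕ} {Φ : (Fin n → ℂ) × ℂ → (Fin m → ℂ) × ℂ}
    {D : Set ((Fin n → ℂ) × ℂ)} (hD : IsOpen D) (hΦ : DifferentiableOn ℂ Φ D) {z₀ : Fin n → ℂ} {r : ℝ}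
    (hr : 0 < r) (h : ∀ ζ ∈ Metric.sphere (0 : ℂ) r, (z₀, ζ) ∈ D) :
    ∃ δ, 0 < δ ∧ δ < r ∧ ∃ c : ℤ → (Fin n → ℂ) → (Fin m → ℂ) × ℂ, ∀ᶠ z in 𝓝 z₀,
      (∀ j, ContDiffAt ℂ ω (c j) z) ∧ ∀ ρ : ℝ, |ρ - r| < δ → (z, (ρ : ℂ)) ∈ D ∧
        HasSum (fun j : ℤ ↦ (ρ : ℂ) ^ j • c j z) (Φ (z, ρ)) ∧
        ∀ v, HasSum (fun j : ℤ ↦ (ρ : ℂ) ^ j • fderiv ℂ (c j) z v)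
          (fderiv ℂ (fun z' ↦ Φ (z', (ρ : ℂ))) z v) := by
  have h1 := fun i : Fin m ↦ exists_laurent_expansion hD (φ := fun x ↦ (Φ x).1 i) (by fun_prop) hr h
  obtain ⟨δ', hδ', hδr', c', hc'⟩ := exists_laurent_expansion hD (φ := fun x ↦ (Φ x).2)
    (by fun_prop) hr h
  choose δ hδ hδr c hc using h1
  obtain ⟨d, hd, hdδ⟩ := exists_pos_le_all δ hδ
  refine ⟨min d δ', lt_min hd hδ', (min_le_right _ _).trans_lt hδr',
    fun j z ↦ (fun i ↦ c i j z, c' j z), ?_⟩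
  filter_upwards [Filter.eventually_all.2 hc, hc'] with z hz hz'
  have hcd : ∀ j, HasFDerivAt (fun z ↦ ((fun i ↦ c i j z, c' j z) : (Fin m → ℂ) × ℂ)) _ z := fun j ↦
    (hasFDerivAt_pi.2 fun i ↦ (((hz i).1 j).differentiableAt (by simp)).hasFDerivAt).prodMk
      ((hz'.1 j).differentiableAt (by simp)).hasFDerivAt
  refine ⟨fun j ↦ (contDiffAt_pi.2 fun i ↦ (hz i).1 j).prodMk (hz'.1 j), fun ρ hρ ↦ ?_⟩
  have h2 := fun i ↦ (hz i).2 ρ (hρ.trans_le ((min_le_left _ _).trans (hdδ i)))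
  have h3 := hz'.2 ρ (hρ.trans_le (min_le_right _ _))
  have hΦz : HasFDerivAt (fun z' ↦ Φ (z', (ρ : ℂ))) _ z :=
    ((hΦ.differentiableAt (hD.mem_nhds h3.1)).comp z
      (by fun_prop : DifferentiableAt ℂ (fun z' : Fin n → ℂ ↦ (z', (ρ : ℂ))) z)).hasFDerivAt
  refine ⟨h3.1, ?_, fun v ↦ ?_⟩
  · exact HasSum.prodMk (Pi.hasSum.2 fun i ↦ (h2 i).2.1) h3.2.1
  · have h4 : ∀ i, fderiv ℂ (fun z' ↦ (Φ (z', (ρ : ℂ))).1 i) z v =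
        (fderiv ℂ (fun z' ↦ Φ (z', (ρ : ℂ))) z v).1 i := by
      intro i
      have := ((((ContinuousLinearMap.proj (R := ℂ) (φ := fun _ : Fin m ↦ ℂ) i).comp
        (ContinuousLinearMap.fst ℂ (Fin m → ℂ) ℂ)).hasFDerivAt).comp z hΦz)
      have h5 : HasFDerivAt (fun z' ↦ (Φ (z', (ρ : ℂ))).1 i) _ z := this
      rw [h5.fderiv, hΦz.fderiv]
      rfl
    have h4' : fderiv ℂ (fun z' ↦ (Φ (z', (ρ : ℂ))).2) z v =
        (fderiv ℂ (fun z' ↦ Φ (z', (ρ : ℂ))) z v).2 := by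
      have := ((ContinuousLinearMap.snd ℂ (Fin m → ℂ) ℂ).hasFDerivAt).comp z hΦz
      have h5 : HasFDerivAt (fun z' ↦ (Φ (z', (ρ : ℂ))).2) _ z := this
      rw [h5.fderiv, hΦz.fderiv]
      rfl
    have h6 := HasSum.prodMk (Pi.hasSum.2 fun i ↦ by
      have := (h2 i).2.2 v
      rw [h4 i] at this
      exact this) (by
        have := h3.2.2 v
        rw [h4'] at this
        exact this)
    convert h6 using 1
    ext1 j
    rw [(hcd j).fderiv]
    rfl

/-- The inclusion of `ℝ³` in its complexification. -/
def complexInclusion : E3 →L[ℝ] (Fin 3 → ℂ) :=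
  ContinuousLinearMap.pi fun i ↦ Complex.ofRealCLM.comp (EuclideanSpace.proj i)

/-- The real part of a complex vector. -/
def realPart : (Fin 3 → ℂ) × ℂ →L[ℝ] E3 × ℝ :=
  ((EuclideanSpace.equiv (Fin 3) ℝ).symm.toContinuousLinearMap.comp
    (ContinuousLinearMap.pi fun i ↦ Complex.reCLM.comp
      ((ContinuousLinearMap.proj (R := ℝ) (φ := fun _ : Fin 3 ↦ ℂ) i).comp
        (ContinuousLinearMap.fst ℝ (Fin 3 → ℂ) ℂ)))).prod
    (Complex.reCLM.comp (ContinuousLinearMap.snd ℝ (Fin 3 → ℂ) ℂ))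

lemma realPart_toComplex (w : E3 × ℝ) : realPart (toComplex w) = w := by
  ext <;> simp [realPart, toComplex]

lemma toComplex_eq (u : E3) (ρ : ℝ) : toComplex (u, ρ) = (complexInclusion u, (ρ : ℂ)) := rfl

lemma realPart_smul (ρ : ℝ) (j : ℤ) (y : (Fin 3 → ℂ) × ℂ) :
    realPart ((ρ : ℂ) ^ j • y) = ρ ^ j • realPart y := by
  rw [← Complex.ofReal_zpow, Complex.coe_smul, map_smul]

variable {N : Type*} [TopologicalSpace N] [ChartedSpace E3 N] [IsManifold 𝓘(ℝ, E3) ω N]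
  {E : ∀ x : N × ℝ, TM x}

/-- The data of a Laurent expansion with respect to `ρ`, at the point `u`, of a vector field `Y` on
`ℝ³ × ℝ`: the coefficients are the germs at `u` of the `c j`. -/
structure HasLaurentExpansionAt (Y : E3 × ℝ → E3 × ℝ) (c : ℤ → E3 → E3 × ℝ) (r δ : ℝ) (u : E3) :
    Prop where
  pos : 0 < δ
  lt : δ < r
  contDiffAt : ∀ j, ContDiffAt ℝ ω (c j) u
  contDiffAt_field : ∀ ρ, 0 < ρ → ContDiffAt ℝ ω Y (u, ρ)
  hasSum : ∀ ρ : ℝ, |ρ - r| < δ → HasSum (fun j : ℤ ↦ ρ ^ j • c j u) (Y (u, ρ))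
  hasSum_fderiv : ∀ ρ : ℝ, |ρ - r| < δ → ∀ s,
    HasSum (fun j : ℤ ↦ ρ ^ j • fderiv ℝ (c j) u s) (fderiv ℝ Y (u, ρ) (s, 0))

/-- The field is real at real points and real powers of `ρ` commute with `realPart`. So the real
parts of the complex coefficients, restricted to real `u`, expand the field, and the restriction of
the complex derivatives gives the termwise derivatives along the base. -/
theorem exists_hasLaurentExpansionAt (hE : ContMDiffOn J J.tangent ω
      (fun x ↦ (⟨x, E x⟩ : TangentBundle J (N × ℝ))) (cylinder Set.univ))
    {U : Set N} {r : ℝ} (hr : 0 < r) (hC : ComplexifiesAlong E U r) {p : N} (hp : p ∈ U) :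
    ∃ δ, ∃ c : ℤ → E3 → E3 × ℝ, ∀ᶠ u in 𝓝 (extChartAt 𝓘(ℝ, E3) p p),
      HasLaurentExpansionAt (chartField J E (p, r)) c r δ u := by
  obtain ⟨D, Φ, hD, hcirc, hΦ, heq⟩ := hC p hp
  set u₀ := extChartAt 𝓘(ℝ, E3) p p with hu₀
  have hz₀ : (toComplex (extChartAt J (p, r) (p, r))).1 = complexInclusion u₀ := by
    rw [extChartAt_J]; rfl
  rw [hz₀] at hcirc
  obtain ⟨δ, hδ, hδr, c, hc⟩ := exists_laurent_expansion_prod hD hΦ hr hcirc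
  refine ⟨δ, fun j u ↦ realPart (c j (complexInclusion u)), ?_⟩
  have h1 := complexInclusion.continuous.continuousAt.eventually hc
  filter_upwards [h1, (isOpen_extChartAt_target p).mem_nhds (mem_extChartAt_target p)] with u hu hut
  have hY : ∀ ρ, 0 < ρ → ContDiffAt ℝ ω (chartField J E (p, r)) (u, ρ) := fun ρ hρ ↦
    contDiffAt_fieldC hE (x := (p, r)) hut hρ
  have hpos : ∀ ρ : ℝ, |ρ - r| < δ → 0 < ρ := fun ρ hρ ↦ by rw [abs_lt] at hρ; linarith
  have hval : ∀ (u' : E3) (ρ : ℝ), u' ∈ targetC p → 0 < ρ → (complexInclusion u', (ρ : ℂ)) ∈ D →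
      chartField J E (p, r) (u', ρ) = realPart (Φ (complexInclusion u', (ρ : ℂ))) := by
    intro u' ρ hu' hρ hm
    have := heq (u', ρ) ((mem_extChartAt_J_target (p, r) (u', ρ)).2 hu') hρ hm
    rw [← toComplex_eq, this, realPart_toComplex]
  refine ⟨hδ, hδr, fun j ↦ ?_, hY, fun ρ hρ ↦ ?_, fun ρ hρ s ↦ ?_⟩
  · exact realPart.contDiff.contDiffAt.comp u (((hu.1 j).restrict_scalars ℝ).comp u
      complexInclusion.contDiff.contDiffAt)
  · obtain ⟨hm, hs, -⟩ := hu.2 ρ hρ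
    rw [hval u ρ hut (hpos ρ hρ) hm]
    have := realPart.hasSum hs
    simpa only [realPart_smul] using this
  · obtain ⟨hm, -, hs⟩ := hu.2 ρ hρ
    have h2 : HasFDerivAt (fun u' ↦ chartField J E (p, r) (u', ρ)) _ u :=
      HasFDerivAt.comp (g := chartField J E (p, r)) (f := fun u' : E3 ↦ (u', ρ)) u
        ((hY ρ (hpos ρ hρ)).differentiableAt (by simp)).hasFDerivAt
        ((hasFDerivAt_id (𝕜 := ℝ) u).prodMk (hasFDerivAt_const ρ u))
    have h3 : HasFDerivAt (fun z' ↦ Φ (z', (ρ : ℂ))) _ (complexInclusion u) :=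
      ((hΦ.differentiableAt (hD.mem_nhds hm)).comp (complexInclusion u)
        (by fun_prop : DifferentiableAt ℂ (fun z' : Fin 3 → ℂ ↦ (z', (ρ : ℂ)))
          (complexInclusion u))).hasFDerivAt
    have h4 := realPart.hasFDerivAt.comp u ((h3.restrictScalars ℝ).comp u
      complexInclusion.hasFDerivAt)
    have h5 : (fun u' ↦ chartField J E (p, r) (u', ρ)) =ᶠ[𝓝 u]
        fun u' ↦ realPart (Φ (complexInclusion u', (ρ : ℂ))) := by
      have hDo : ∀ᶠ u' in 𝓝 u, (complexInclusion u', (ρ : ℂ)) ∈ D :=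
        (complexInclusion.continuous.prodMk continuous_const).continuousAt.eventually
          (hD.mem_nhds hm)
      filter_upwards [hDo, (isOpen_extChartAt_target p).mem_nhds hut] with u' hu' hut'
      exact hval u' ρ hut' (hpos ρ hρ) hu'
    have h6 := DFunLike.congr_fun (h2.unique (h4.congr_of_eventuallyEq h5)) s
    have h7 : fderiv ℝ (chartField J E (p, r)) (u, ρ) (s, 0) =
        realPart (fderiv ℂ (fun z' ↦ Φ (z', (ρ : ℂ))) (complexInclusion u) (complexInclusion s)) := by
      rw [h3.fderiv]
      exact h6
    rw [h7]
    have h8 := realPart.hasSum (hs (complexInclusion s))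
    simp only [realPart_smul] at h8
    convert h8 using 1
    ext1 j
    congr 1
    have h9 : HasFDerivAt (fun u' ↦ realPart (c j (complexInclusion u'))) _ u :=
      realPart.hasFDerivAt.comp u ((((hu.1 j).differentiableAt
        (by simp)).hasFDerivAt.restrictScalars ℝ).comp u complexInclusion.hasFDerivAt)
    rw [h9.fderiv]
    rfl

end LocalLaurent

end BeltramiSoliton

namespace BeltramiSoliton

/-! ### Laurent coefficients of the components of the soliton equation. -/

section TermwiseSoliton

lemma hasSum_of_eq {ι : Type*} {f g : ι → ℝ} {a b : ℝ} (h : HasSum f a) (hb : b = a)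
    (hg : ∀ i, g i = f i) : HasSum g b := by
  rw [hb]
  exact h.congr_fun hg

lemma hasSum_zpow_shift {c : ℤ → ℝ} {S ρ : ℝ} (hρ : ρ ≠ 0) (h : HasSum (fun j : ℤ ↦ ρ ^ j * c j) S)
    (k : ℤ) : HasSum (fun j : ℤ ↦ ρ ^ j * c (j - k)) (ρ ^ k * S) := by
  have h1 := h.mul_left (ρ ^ k)
  rw [← (Equiv.subRight k).hasSum_iff] at h1
  refine h1.congr_fun fun j ↦ ?_
  simp only [Function.comp_apply, Equiv.subRight_apply]
  rw [← mul_assoc, ← zpow_add₀ hρ, add_sub_cancel]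

lemma hasSum_zpow_single (k : ℤ) (a ρ : ℝ) :
    HasSum (fun j : ℤ ↦ ρ ^ j * (if j = k then a else 0)) (ρ ^ k * a) := by
  have := hasSum_ite_eq k (ρ ^ k * a)
  refine this.congr_fun fun j ↦ ?_
  split_ifs with h
  · rw [h]
  · rw [mul_zero]

lemma fderiv_thetaL_apply {A : E3 → E3 →L[ℝ] ℝ} {Y : E3 × ℝ → E3 × ℝ} {w : E3 × ℝ}
    (hA : DifferentiableAt ℝ A w.1) (hY : DifferentiableAt ℝ Y w) (v : E3 × ℝ) :
    fderiv ℝ (fun w' ↦ thetaL A w' (Y w')) w v =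
      v.2 * (Y w).2 + w.2 * (fderiv ℝ Y w v).2 + fderiv ℝ A w.1 v.1 (Y w).1
        + A w.1 (fderiv ℝ Y w v).1 := by
  have h1 : HasFDerivAt (fun w' : E3 × ℝ ↦ A w'.1) _ w :=
    HasFDerivAt.comp (g := A) w hA.hasFDerivAt hasFDerivAt_fst
  have h2 : HasFDerivAt (fun w' ↦ (Y w').1) _ w := hY.hasFDerivAt.fst
  have h3 : HasFDerivAt (fun w' ↦ (Y w').2) _ w := hY.hasFDerivAt.snd
  have h4 : HasFDerivAt (fun w' ↦ thetaL A w' (Y w')) _ w :=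
    (hasFDerivAt_snd.mul h3).add (h1.clm_apply h2)
  rw [h4.fderiv]
  simp
  ring

lemma fderiv_fst_apply {Y : E3 × ℝ → E3 × ℝ} {w : E3 × ℝ} (hY : DifferentiableAt ℝ Y w) (v : E3 × ℝ) :
    fderiv ℝ (fun w' ↦ (Y w').1) w v = (fderiv ℝ Y w v).1 := by
  rw [hY.hasFDerivAt.fst.fderiv]
  rfl

/-- The coefficients of the base component. -/
def baseCoeff (c : ℤ → E3 → E3 × ℝ) (j : ℤ) (u : E3) : E3 := (c j u).1

/-- The coefficients of the vertical part `θ(Y) = ρ Y_ρ + A(Y)`. -/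
def verticalCoeff (A : E3 → E3 →L[ℝ] ℝ) (c : ℤ → E3 → E3 × ℝ) (j : ℤ) (u : E3) : ℝ :=
  (c (j - 1) u).2 + A u (c j u).1

/-- The coefficient of `ρʲ` in `solitonVV`. -/
def coeffVV (A : E3 → E3 →L[ℝ] ℝ) (a : ℝ) (f : ℤ → E3 → ℝ) (F : ℤ → E3 → E3) (j : ℤ) (u : E3) : ℝ :=
  (if j = 2 then a else 0) + ((j : ℝ) - 1) * f j u + A u (F j u)

/-- The coefficient of `ρʲ` in `solitonHV`. -/
def coeffHV (h : E3 → E3 →L[ℝ] E3 →L[ℝ] ℝ) (A : E3 → E3 →L[ℝ] ℝ) (f : ℤ → E3 → ℝ) (F : ℤ → E3 → E3)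
    (j : ℤ) (u s : E3) : ℝ :=
  ((j : ℝ) - 2) * h u s (F (j - 2) u) + fderiv ℝ (f j) u s - ((j : ℝ) + 2) * A u s * f (j + 2) u
    + coordExtDeriv A u (F j u) s

/-- The coefficient of `ρʲ` in `solitonHH`. -/
def coeffHH (R : E3 → E3 → ℝ) (h : E3 → E3 →L[ℝ] E3 →L[ℝ] ℝ) (A : E3 → E3 →L[ℝ] ℝ) (a : ℝ)
    (f : ℤ → E3 → ℝ) (F : ℤ → E3 → E3) (j : ℤ) (u s t : E3) : ℝ :=
  (if j = 0 then 2 * R s t - 4 * h u s t else 0) + (if j = 2 then 2 * a * h u s t else 0)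
    + 2 * (f j u - A u (F j u)) * h u s t + coordLie (F (j - 2)) h u s t
    - (j : ℝ) * (A u s * h u (F j u) t + A u t * h u s (F j u))

namespace HasLaurentExpansionAt

variable {h : E3 → E3 →L[ℝ] E3 →L[ℝ] ℝ} {A : E3 → E3 →L[ℝ] ℝ} {Y : E3 × ℝ → E3 × ℝ}
  {c : ℤ → E3 → E3 × ℝ} {r δ : ℝ} {u : E3}

lemma radius_pos (H : HasLaurentExpansionAt Y c r δ u) {ρ : ℝ} (hρ : |ρ - r| < δ) : 0 < ρ := by
  rw [abs_lt] at hρ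
  linarith [H.lt]

lemma differentiableAt_field (H : HasLaurentExpansionAt Y c r δ u) {ρ : ℝ} (hρ : 0 < ρ) :
    DifferentiableAt ℝ Y (u, ρ) := (H.contDiffAt_field ρ hρ).differentiableAt (by simp)

lemma hasDerivAt_field (H : HasLaurentExpansionAt Y c r δ u) {ρ : ℝ} (hρ : 0 < ρ) :
    HasDerivAt (fun ρ ↦ Y (u, ρ)) (fderiv ℝ Y (u, ρ) (0, 1)) ρ :=
  HasFDerivAt.comp_hasDerivAt (f := fun ρ : ℝ ↦ (u, ρ)) ρ (H.differentiableAt_field hρ).hasFDerivAt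
    ((hasDerivAt_const ρ u).prodMk (hasDerivAt_id ρ))

lemma hasSum_base (H : HasLaurentExpansionAt Y c r δ u) {ρ : ℝ} (hρ : |ρ - r| < δ) (L : E3 →L[ℝ] ℝ) :
    HasSum (fun j : ℤ ↦ ρ ^ j * L (baseCoeff c j u)) (L (Y (u, ρ)).1) := by
  have := (L.comp (ContinuousLinearMap.fst ℝ E3 ℝ)).hasSum (H.hasSum ρ hρ)
  simpa [baseCoeff] using this

lemma hasSum_base_fderiv (H : HasLaurentExpansionAt Y c r δ u) {ρ : ℝ} (hρ : |ρ - r| < δ)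
    (L : E3 →L[ℝ] ℝ) (s : E3) :
    HasSum (fun j : ℤ ↦ ρ ^ j * L (fderiv ℝ (baseCoeff c j) u s)) (L (fderiv ℝ Y (u, ρ) (s, 0)).1) := by
  have := (L.comp (ContinuousLinearMap.fst ℝ E3 ℝ)).hasSum (H.hasSum_fderiv ρ hρ s)
  have h1 : ∀ j, fderiv ℝ (baseCoeff c j) u s = (fderiv ℝ (c j) u s).1 := fun j ↦ by
    have : HasFDerivAt (baseCoeff c j) _ u := ((H.contDiffAt j).differentiableAt (by simp)).hasFDerivAt.fst
    rw [this.fderiv]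
    rfl
  simp_rw [h1]
  simpa using this

lemma hasSum_vertical (H : HasLaurentExpansionAt Y c r δ u) {ρ : ℝ} (hρ : |ρ - r| < δ) :
    HasSum (fun j : ℤ ↦ ρ ^ j * verticalCoeff A c j u) (thetaL A (u, ρ) (Y (u, ρ))) := by
  have h1 := (ContinuousLinearMap.snd ℝ E3 ℝ).hasSum (H.hasSum ρ hρ)
  simp only [ContinuousLinearMap.coe_snd', Prod.smul_snd, smul_eq_mul] at h1
  have h2 := (hasSum_zpow_shift (H.radius_pos hρ).ne' h1 1).add (H.hasSum_base hρ (A u))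
  rw [zpow_one] at h2
  refine h2.congr_fun fun j ↦ ?_
  simp only [verticalCoeff, baseCoeff]
  ring

lemma hasSum_vertical_fderiv (H : HasLaurentExpansionAt Y c r δ u) (hA : DifferentiableAt ℝ A u) {ρ : ℝ}
    (hρ : |ρ - r| < δ) (s : E3) : HasSum (fun j : ℤ ↦ ρ ^ j * fderiv ℝ (verticalCoeff A c j) u s)
      (fderiv ℝ (fun w' ↦ thetaL A w' (Y w')) (u, ρ) (s, 0)) := by
  have hρ0 := H.radius_pos hρ
  rw [fderiv_thetaL_apply hA (H.differentiableAt_field hρ0)]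
  have h1 := (ContinuousLinearMap.snd ℝ E3 ℝ).hasSum (H.hasSum_fderiv ρ hρ s)
  simp only [ContinuousLinearMap.coe_snd', Prod.smul_snd, smul_eq_mul] at h1
  have h2 := ((hasSum_zpow_shift hρ0.ne' h1 1).add (H.hasSum_base hρ (fderiv ℝ A u s))).add
    (H.hasSum_base_fderiv hρ (A u) s)
  have h3 : ∀ j, fderiv ℝ (verticalCoeff A c j) u s = (fderiv ℝ (c (j - 1)) u s).2 +
      (fderiv ℝ A u s (baseCoeff c j u) + A u (fderiv ℝ (baseCoeff c j) u s)) := fun j ↦ by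
    have e1 : HasFDerivAt (baseCoeff c j) _ u :=
      ((H.contDiffAt j).differentiableAt (by simp)).hasFDerivAt.fst
    have e2 : HasFDerivAt (verticalCoeff A c j) _ u :=
      ((H.contDiffAt (j - 1)).differentiableAt (by simp)).hasFDerivAt.snd.add
        (hA.hasFDerivAt.clm_apply e1)
    rw [e2.fderiv, e1.fderiv]
    simp [baseCoeff]
    ring
  refine hasSum_of_eq h2 (by simp) fun j ↦ ?_
  rw [h3]
  ring

/-- The Euler operator `ρ ∂/∂ρ` multiplies the coefficient of `ρʲ` by `j`; this is the source of all
the factors `j` in the relations. -/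
lemma hasSum_base_deriv (H : HasLaurentExpansionAt Y c r δ u) {ρ : ℝ} (hρ : |ρ - r| < δ)
    (L : E3 →L[ℝ] ℝ) : HasSum (fun j : ℤ ↦ ρ ^ j * ((j : ℝ) * L (baseCoeff c j u)))
      (ρ * L (fderiv ℝ Y (u, ρ) (0, 1)).1) := by
  have hρ0 := H.radius_pos hρ
  obtain ⟨g', h1, h2⟩ := hasDerivAt_of_hasSum_zpow (c := fun j ↦ L (baseCoeff c j u))
    (g := fun ρ ↦ L (Y (u, ρ)).1) H.lt.le (fun t ht ↦ H.hasSum_base ht L) hρ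
  have h3 : HasDerivAt (fun ρ ↦ L (Y (u, ρ)).1) (L (fderiv ℝ Y (u, ρ) (0, 1)).1) ρ :=
    (L.comp (ContinuousLinearMap.fst ℝ E3 ℝ)).hasFDerivAt.comp_hasDerivAt ρ (H.hasDerivAt_field hρ0)
  rw [← h1.unique h3]
  refine (h2.mul_left ρ).congr_fun fun j ↦ ?_
  rw [zpow_sub_one₀ hρ0.ne', smul_eq_mul]
  field_simp

lemma hasSum_vertical_deriv (H : HasLaurentExpansionAt Y c r δ u) (hA : DifferentiableAt ℝ A u) {ρ : ℝ}
    (hρ : |ρ - r| < δ) : HasSum (fun j : ℤ ↦ ρ ^ j * ((j : ℝ) * verticalCoeff A c j u))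
      (ρ * fderiv ℝ (fun w' ↦ thetaL A w' (Y w')) (u, ρ) (0, 1)) := by
  have hρ0 := H.radius_pos hρ
  obtain ⟨g', h1, h2⟩ := hasDerivAt_of_hasSum_zpow (c := fun j ↦ verticalCoeff A c j u)
    (g := fun ρ ↦ thetaL A (u, ρ) (Y (u, ρ))) H.lt.le (fun t ht ↦ H.hasSum_vertical ht) hρ
  have h3 : HasDerivAt (fun ρ ↦ thetaL A (u, ρ) (Y (u, ρ)))
      (fderiv ℝ (fun w' ↦ thetaL A w' (Y w')) (u, ρ) (0, 1)) ρ := by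
    have e1 := H.hasDerivAt_field hρ0
    have e2 := (ContinuousLinearMap.fst ℝ E3 ℝ).hasFDerivAt.comp_hasDerivAt ρ e1
    have e3 := (ContinuousLinearMap.snd ℝ E3 ℝ).hasFDerivAt.comp_hasDerivAt ρ e1
    have e4 : HasDerivAt (fun ρ ↦ thetaL A (u, ρ) (Y (u, ρ))) _ ρ :=
      ((hasDerivAt_id ρ).mul e3).add ((A u).hasFDerivAt.comp_hasDerivAt ρ e2)
    rw [fderiv_thetaL_apply hA (H.differentiableAt_field hρ0)]
    convert e4 using 1
    simp
  rw [← h1.unique h3]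
  refine (h2.mul_left ρ).congr_fun fun j ↦ ?_
  rw [zpow_sub_one₀ hρ0.ne', smul_eq_mul]
  field_simp

lemma hasSum_solitonVV (H : HasLaurentExpansionAt Y c r δ u) (hA : DifferentiableAt ℝ A u) (a : ℝ) {ρ : ℝ}
    (hρ : |ρ - r| < δ) : HasSum (fun j : ℤ ↦ ρ ^ j * coeffVV A a (verticalCoeff A c) (baseCoeff c) j u)
      (solitonVV A a Y (u, ρ)) := by
  have h1 := (((hasSum_zpow_single 2 a ρ).add (H.hasSum_vertical_deriv hA hρ)).sub
    (H.hasSum_vertical (A := A) hρ)).add (H.hasSum_base hρ (A u))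
  refine hasSum_of_eq h1 ?_ fun j ↦ ?_
  · unfold solitonVV
    rw [mul_comm a]
    norm_cast
  · unfold coeffVV
    ring

lemma hasSum_solitonHV (H : HasLaurentExpansionAt Y c r δ u) (hA : DifferentiableAt ℝ A u) (s : E3) {ρ : ℝ}
    (hρ : |ρ - r| < δ) : HasSum (fun j : ℤ ↦ ρ ^ j * coeffHV h A (verticalCoeff A c) (baseCoeff c) j u s)
      (solitonHV h A Y (u, ρ) s) := by
  have hρ0 := H.radius_pos hρ
  -- Here `ρ³ ∂/∂ρ = ρ² (ρ ∂/∂ρ)` shifts the index by `2`, and `ρ⁻¹ ∂/∂ρ = ρ⁻² (ρ ∂/∂ρ)` shifts it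
  -- by `-2`: hence the factors `j - 2` and `j + 2`.
  have h1 := (((hasSum_zpow_shift hρ0.ne' (H.hasSum_base_deriv hρ (h u s)) 2).add
    (H.hasSum_vertical_fderiv hA hρ s)).sub
    ((hasSum_zpow_shift hρ0.ne' (H.hasSum_vertical_deriv hA hρ) (-2)).mul_left (A u s))).add
    (H.hasSum_base hρ ((fderiv ℝ A u).flip s - fderiv ℝ A u s))
  refine hasSum_of_eq h1 ?_ fun j ↦ ?_
  rotate_left
  · unfold coeffHV coordExtDeriv
    rw [sub_neg_eq_add]
    simp only [sub_apply, ContinuousLinearMap.flip_apply]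
    push_cast
    ring
  · unfold solitonHV coordExtDeriv
    rw [fderiv_fst_apply (H.differentiableAt_field hρ0)]
    simp only [sub_apply, ContinuousLinearMap.flip_apply, zpow_neg]
    norm_cast
    field_simp

lemma hasSum_solitonHH (H : HasLaurentExpansionAt Y c r δ u) (R : E3 → E3 → ℝ) (a : ℝ) (s t : E3) {ρ : ℝ}
    (hρ : |ρ - r| < δ) :
    HasSum (fun j : ℤ ↦ ρ ^ j * coeffHH R h A a (verticalCoeff A c) (baseCoeff c) j u s t)
      (solitonHH R h A a Y (u, ρ) s t) := by
  have hρ0 := H.radius_pos hρ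
  have e1 := hasSum_zpow_single 0 (2 * R s t - 4 * h u s t) ρ
  have e2 := hasSum_zpow_single 2 (2 * a * h u s t) ρ
  have e3 := ((H.hasSum_vertical (A := A) hρ).sub (H.hasSum_base hρ (A u))).mul_left (2 * h u s t)
  have e4 := hasSum_zpow_shift (c := fun j ↦ coordLie (baseCoeff c j) h u s t) hρ0.ne'
    (((((H.hasSum_base hρ (((fderiv ℝ h u).flip s).flip t)).add
    (H.hasSum_base_fderiv hρ ((h u).flip t) s)).add (H.hasSum_base_fderiv hρ (h u s) t))).congr_fun
    fun j ↦ by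
      simp only [coordLie, ContinuousLinearMap.flip_apply]
      ring) 2
  have e5 := ((H.hasSum_base_deriv hρ ((h u).flip t)).mul_left (A u s)).add
    ((H.hasSum_base_deriv hρ (h u s)).mul_left (A u t))
  refine hasSum_of_eq ((((e1.add e2).add e3).add e4).sub e5) ?_ fun j ↦ ?_
  rotate_left
  · unfold coeffHH
    simp only [ContinuousLinearMap.flip_apply]
    ring
  · unfold solitonHH
    rw [fderiv_fst_apply (H.differentiableAt_field hρ0),
      fderiv_fst_apply (H.differentiableAt_field hρ0), fderiv_fst_apply (H.differentiableAt_field hρ0)]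
    simp only [ContinuousLinearMap.flip_apply, zpow_zero]
    norm_cast
    ring

lemma eventually_analyticAt (H : HasLaurentExpansionAt Y c r δ u) {ρ : ℝ} (hρ : 0 < ρ) :
    ContDiffAt ℝ ω (fun ρ ↦ Y (u, ρ)) ρ ∧ ∀ v, ContDiffAt ℝ ω (fun ρ ↦ fderiv ℝ Y (u, ρ) v) ρ := by
  have h0 : ContDiffAt ℝ ω (fun ρ : ℝ ↦ (u, ρ)) ρ := contDiffAt_const.prodMk contDiffAt_id
  refine ⟨ContDiffAt.comp (g := Y) ρ (H.contDiffAt_field ρ hρ) h0, fun v ↦ ?_⟩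
  have h1 : ContDiffAt ℝ ω (fderiv ℝ Y) (u, ρ) :=
    (H.contDiffAt_field ρ hρ).fderiv_right (m := ω) (by simp)
  exact (ContDiffAt.comp (g := fderiv ℝ Y) ρ h1 h0).clm_apply contDiffAt_const

/-- The series represents `T` near `r` only. Uniqueness of its coefficients gives one implication;
for the other, `T` vanishes near `r`, hence on the whole ray by the identity theorem for
real-analytic functions. -/
lemma eq_zero_of_coeff (H : HasLaurentExpansionAt Y c r δ u) {T : ℝ → ℝ} {b : ℤ → ℝ}
    (hT : ∀ ρ, 0 < ρ → ContDiffAt ℝ ω T ρ)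
    (hs : ∀ ρ, |ρ - r| < δ → HasSum (fun j : ℤ ↦ ρ ^ j * b j) (T ρ)) :
    (∀ ρ, 0 < ρ → T ρ = 0) ↔ ∀ j, b j = 0 := by
  have hr : 0 < r := H.pos.trans H.lt
  constructor
  · intro h0 j
    refine eq_zero_of_hasSum_zpow hr H.pos (fun t ht ↦ ?_) j
    rw [← h0 t (H.radius_pos ht)]
    exact hs t ht
  · intro hb ρ hρ
    have h1 : AnalyticOnNhd ℝ T (Set.Ioi 0) := fun ρ hρ ↦ (hT ρ hρ).analyticAt
    refine h1.eqOn_zero_of_preconnected_of_eventuallyEq_zero isPreconnected_Ioi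
      (show r ∈ Set.Ioi (0 : ℝ) from hr) ?_ hρ
    filter_upwards [Metric.ball_mem_nhds r H.pos] with t ht
    refine (hs t (by simpa [Real.dist_eq] using ht)).unique ?_
    simp only [hb, mul_zero]
    exact hasSum_zero

/-- The soliton equations hold above `u` if and only if all the coefficients vanish. -/
theorem soliton_iff_coeff (H : HasLaurentExpansionAt Y c r δ u) (hA : DifferentiableAt ℝ A u)
    (R : E3 → E3 → ℝ) (a : ℝ) :
    (∀ ρ, 0 < ρ → solitonVV A a Y (u, ρ) = 0 ∧ (∀ s, solitonHV h A Y (u, ρ) s = 0) ∧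
      ∀ s t, solitonHH R h A a Y (u, ρ) s t = 0) ↔
    (∀ j, coeffVV A a (verticalCoeff A c) (baseCoeff c) j u = 0) ∧
    (∀ j s, coeffHV h A (verticalCoeff A c) (baseCoeff c) j u s = 0) ∧
    ∀ j s t, coeffHH R h A a (verticalCoeff A c) (baseCoeff c) j u s t = 0 := by
  -- With `u` fixed, `A`, `h` and their derivatives at `u` are constants, so each component is
  -- analytic in `ρ` as soon as the field is; no analyticity of `A` in `u` enters.
  have hid : ∀ ρ, ContDiffAt ℝ ω (fun ρ : ℝ ↦ ρ) ρ := fun ρ ↦ contDiffAt_id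
  have a0 : ∀ ρ, 0 < ρ → ContDiffAt ℝ ω (fun ρ ↦ thetaL A (u, ρ) (Y (u, ρ))) ρ := by
    intro ρ hρ
    have h1 := (H.eventually_analyticAt hρ).1
    simp only [thetaL_apply]
    exact ((hid ρ).mul h1.snd).add ((A u).contDiff.contDiffAt.comp ρ h1.fst)
  have a1 : ∀ v ρ, 0 < ρ → ContDiffAt ℝ ω
      (fun ρ ↦ fderiv ℝ (fun w' ↦ thetaL A w' (Y w')) (u, ρ) v) ρ := by
    intro v ρ hρ
    have h1 := (H.eventually_analyticAt hρ).1
    have h2 := (H.eventually_analyticAt hρ).2 v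
    refine ContDiffAt.congr_of_eventuallyEq (f := fun ρ ↦ v.2 * (Y (u, ρ)).2 +
      ρ * (fderiv ℝ Y (u, ρ) v).2 + fderiv ℝ A u v.1 (Y (u, ρ)).1 +
        A u (fderiv ℝ Y (u, ρ) v).1) ?_ ?_
    · exact (((contDiffAt_const.mul h1.snd).add ((hid ρ).mul h2.snd)).add
        ((fderiv ℝ A u v.1).contDiff.contDiffAt.comp ρ h1.fst)).add
        ((A u).contDiff.contDiffAt.comp ρ h2.fst)
    · filter_upwards [Ioi_mem_nhds hρ] with t ht
      exact fderiv_thetaL_apply hA (H.differentiableAt_field ht) v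
  have a2 : ∀ v ρ, 0 < ρ → ContDiffAt ℝ ω (fun ρ ↦ fderiv ℝ (fun w' ↦ (Y w').1) (u, ρ) v) ρ := by
    intro v ρ hρ
    refine ((H.eventually_analyticAt hρ).2 v).fst.congr_of_eventuallyEq ?_
    filter_upwards [Ioi_mem_nhds hρ] with t ht
    exact fderiv_fst_apply (H.differentiableAt_field ht) v
  have a3 : ∀ (L : E3 →L[ℝ] ℝ) (g : ℝ → E3) ρ, ContDiffAt ℝ ω g ρ →
      ContDiffAt ℝ ω (fun ρ ↦ L (g ρ)) ρ := fun L g ρ hg ↦ L.contDiff.contDiffAt.comp ρ hg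
  have aY : ∀ ρ, 0 < ρ → ContDiffAt ℝ ω (fun ρ ↦ (Y (u, ρ)).1) ρ := fun ρ hρ ↦
    (H.eventually_analyticAt hρ).1.fst
  rw [← H.eq_zero_of_coeff (T := fun ρ ↦ solitonVV A a Y (u, ρ)) (fun ρ hρ ↦ by
      unfold solitonVV
      exact (((contDiffAt_const.mul ((hid ρ).pow 2)).add ((hid ρ).mul (a1 (0, 1) ρ hρ))).sub
        (a0 ρ hρ)).add (a3 (A u) _ ρ (aY ρ hρ)))
    fun ρ hρ ↦ H.hasSum_solitonVV hA a hρ]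
  have hHV : ∀ s, (∀ ρ, 0 < ρ → solitonHV h A Y (u, ρ) s = 0) ↔
      ∀ j, coeffHV h A (verticalCoeff A c) (baseCoeff c) j u s = 0 := by
    intro s
    refine H.eq_zero_of_coeff (T := fun ρ ↦ solitonHV h A Y (u, ρ) s) (fun ρ hρ ↦ ?_)
      fun ρ hρ ↦ H.hasSum_solitonHV hA s hρ
    have b1 : ContDiffAt ℝ ω (fun ρ ↦ h u s (fderiv ℝ (fun w' ↦ (Y w').1) (u, ρ) (0, 1))) ρ :=
      a3 (h u s) _ ρ (a2 (0, 1) ρ hρ)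
    have b2 : ContDiffAt ℝ ω (fun ρ ↦ coordExtDeriv A u (Y (u, ρ)).1 s) ρ :=
      a3 ((fderiv ℝ A u).flip s - fderiv ℝ A u s) _ ρ (aY ρ hρ)
    have b3 : ContDiffAt ℝ ω (fun ρ : ℝ ↦ ρ⁻¹ * A u s) ρ :=
      (contDiffAt_inv ℝ hρ.ne').mul contDiffAt_const
    exact (((((hid ρ).pow 3).mul b1).add (a1 (s, 0) ρ hρ)).sub (b3.mul (a1 (0, 1) ρ hρ))).add b2
  have hHH : ∀ s t, (∀ ρ, 0 < ρ → solitonHH R h A a Y (u, ρ) s t = 0) ↔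
      ∀ j, coeffHH R h A a (verticalCoeff A c) (baseCoeff c) j u s t = 0 := by
    intro s t
    refine H.eq_zero_of_coeff (T := fun ρ ↦ solitonHH R h A a Y (u, ρ) s t) (fun ρ hρ ↦ ?_)
      fun ρ hρ ↦ H.hasSum_solitonHH R a s t hρ
    have b0 : ContDiffAt ℝ ω (fun ρ : ℝ ↦ 2 * R s t - 4 * h u s t + 2 * a * ρ ^ 2 * h u s t) ρ :=
      contDiffAt_const.add ((contDiffAt_const.mul ((hid ρ).pow 2)).mul contDiffAt_const)
    have b1 : ContDiffAt ℝ ω (fun ρ ↦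
        2 * (thetaL A (u, ρ) (Y (u, ρ)) - A u (Y (u, ρ)).1) * h u s t) ρ :=
      (contDiffAt_const.mul ((a0 ρ hρ).sub (a3 (A u) _ ρ (aY ρ hρ)))).mul contDiffAt_const
    have b2 : ContDiffAt ℝ ω (fun ρ ↦ fderiv ℝ h u (Y (u, ρ)).1 s t) ρ :=
      a3 (((fderiv ℝ h u).flip s).flip t) _ ρ (aY ρ hρ)
    have b3 : ∀ v, ContDiffAt ℝ ω (fun ρ ↦ h u (fderiv ℝ (fun w' ↦ (Y w').1) (u, ρ) v) t) ρ :=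
      fun v ↦ a3 ((h u).flip t) _ ρ (a2 v ρ hρ)
    have b4 : ∀ v, ContDiffAt ℝ ω (fun ρ ↦ h u s (fderiv ℝ (fun w' ↦ (Y w').1) (u, ρ) v)) ρ :=
      fun v ↦ a3 (h u s) _ ρ (a2 v ρ hρ)
    have b5 : ContDiffAt ℝ ω (fun ρ ↦ A u s * h u (fderiv ℝ (fun w' ↦ (Y w').1) (u, ρ) (0, 1)) t
        + A u t * h u s (fderiv ℝ (fun w' ↦ (Y w').1) (u, ρ) (0, 1))) ρ :=
      (contDiffAt_const.mul (b3 (0, 1))).add (contDiffAt_const.mul (b4 (0, 1)))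
    exact ((b0.add b1).add (((hid ρ).pow 2).mul ((b2.add (b3 (s, 0))).add (b4 (t, 0))))).sub
      ((hid ρ).mul b5)
  constructor
  · rintro H1
    exact ⟨fun ρ hρ ↦ (H1 ρ hρ).1, fun j s ↦ (hHV s).1 (fun ρ hρ ↦ (H1 ρ hρ).2.1 s) j,
      fun j s t ↦ (hHH s t).1 (fun ρ hρ ↦ (H1 ρ hρ).2.2 s t) j⟩
  · rintro ⟨h1, h2, h3⟩ ρ hρ
    exact ⟨h1 ρ hρ, fun s ↦ (hHV s).2 (fun j ↦ h2 j s) ρ hρ,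
      fun s t ↦ (hHH s t).2 (fun j ↦ h3 j s t) ρ hρ⟩

end HasLaurentExpansionAt

end TermwiseSoliton

end BeltramiSoliton

namespace BeltramiSoliton

/-! ### The coefficients in an adapted orthonormal frame. -/

section CoefficientRelations

variable {h : E3 → E3 →L[ℝ] E3 →L[ℝ] ℝ} {A : E3 → E3 →L[ℝ] ℝ} {u : E3}

lemma coordExtDeriv_eq_sum {e : Module.Basis (Fin 3) ℝ E3} (he : IsOrthonormalFor (h u) e) (X s : E3) :
    coordExtDeriv A u X s = e.repr X 0 * coordExtDeriv A u (e 0) s +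
      e.repr X 1 * coordExtDeriv A u (e 1) s + e.repr X 2 * coordExtDeriv A u (e 2) s := by
  have := he.apply_eq_sum ((fderiv ℝ A u).flip s - fderiv ℝ A u s) X
  simp only [← he.repr_apply, sub_apply, ContinuousLinearMap.flip_apply] at this
  exact this

lemma forall_coeffHV_iff {e : Module.Basis (Fin 3) ℝ E3} (f : ℤ → E3 → ℝ) (F : ℤ → E3 → E3) (j : ℤ) :
    (∀ s, coeffHV h A f F j u s = 0) ↔ ∀ i, coeffHV h A f F j u (e i) = 0 := by
  refine ⟨fun H i ↦ H _, fun H s ↦ ?_⟩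
  let L : E3 →L[ℝ] ℝ := ((j : ℝ) - 2) • (h u).flip (F (j - 2) u) + fderiv ℝ (f j) u
    - (((j : ℝ) + 2) * f (j + 2) u) • A u + (fderiv ℝ A u (F j u) - (fderiv ℝ A u).flip (F j u))
  have hL : ∀ s, coeffHV h A f F j u s = L s := fun s ↦ by
    simp only [coeffHV, L, coordExtDeriv, sub_apply, add_apply, smul_apply,
      ContinuousLinearMap.flip_apply, smul_eq_mul]
    ring
  rw [hL, ← e.sum_repr s, map_sum]
  refine Finset.sum_eq_zero fun i _ ↦ ?_
  rw [map_smul, ← hL, H, smul_zero]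

variable {e : Module.Basis (Fin 3) ℝ E3} {n : ℝ}

lemma coeffVV_eq (he : IsOrthonormalFor (h u) e) (hA : ∀ i, A u (e i) = if 2 = i then n else 0)
    (a : ℝ) (f : ℤ → E3 → ℝ) (F : ℤ → E3 → E3) (j : ℤ) :
    coeffVV A a f F j u = (if j = 2 then a else 0) + ((j : ℝ) - 1) * f j u + e.repr (F j u) 2 * n := by
  rw [coeffVV, he.apply_eq_sum (A u) (F j u), hA, hA, hA, ← he.repr_apply, ← he.repr_apply,
    ← he.repr_apply]
  simp

/-- Evaluation of the mixed coefficient on the frame. The terms `± 2 y n` and `± 2 x n` are the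
components of `dA(F j, ·)`, and `A` is nonzero only on the last vector, which explains why `f (j +
2)` occurs in the third line alone. -/
lemma coeffHV_eq (he : IsOrthonormalFor (h u) e) (hs : ∀ v w, h u v w = h u w v)
    (hA : ∀ i, A u (e i) = if 2 = i then n else 0)
    (h01 : coordExtDeriv A u (e 0) (e 1) = -2 * A u (e 2))
    (h12 : coordExtDeriv A u (e 1) (e 2) = -2 * A u (e 0))
    (h20 : coordExtDeriv A u (e 2) (e 0) = -2 * A u (e 1))
    (f : ℤ → E3 → ℝ) (F : ℤ → E3 → E3) (j : ℤ) :
    coeffHV h A f F j u (e 0) =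
        fderiv ℝ (f j) u (e 0) + 2 * e.repr (F j u) 1 * n + ((j : ℝ) - 2) * e.repr (F (j - 2) u) 0 ∧
    coeffHV h A f F j u (e 1) =
        fderiv ℝ (f j) u (e 1) - 2 * e.repr (F j u) 0 * n + ((j : ℝ) - 2) * e.repr (F (j - 2) u) 1 ∧
    coeffHV h A f F j u (e 2) = -((j : ℝ) + 2) * n * f (j + 2) u
        + fderiv ℝ (f j) u (e 2) + ((j : ℝ) - 2) * e.repr (F (j - 2) u) 2 := by
  have hd : ∀ s t, coordExtDeriv A u s t = -coordExtDeriv A u t s := fun s t ↦ by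
    simp [coordExtDeriv]
  have hdd : ∀ s, coordExtDeriv A u s s = 0 := fun s ↦ by simp [coordExtDeriv]
  simp only [coeffHV, coordExtDeriv_eq_sum he (F j u), he.repr_apply, hdd, hd (e 1) (e 0),
    hd (e 2) (e 1), hd (e 0) (e 2), h01, h12, h20, hA, hs (e _) (F (j - 2) u)]
  refine ⟨?_, ?_, ?_⟩ <;> simp <;> ring

lemma coeffHH_eq (he : IsOrthonormalFor (h u) e) (hs : ∀ v w, h u v w = h u w v)
    (hA : ∀ i, A u (e i) = if 2 = i then n else 0) (R : E3 → E3 → ℝ) (a : ℝ)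
    (f : ℤ → E3 → ℝ) (F : ℤ → E3 → E3) (j : ℤ) (s t : E3) :
    coeffHH R h A a f F j u s t =
      (if j = 0 then 2 * R s t - 4 * h u s t else 0) + (if j = 2 then 2 * a * h u s t else 0)
      + 2 * (f j u - e.repr (F j u) 2 * n) * h u s t + coordLie (F (j - 2)) h u s t
      - (j : ℝ) * (A u s * h u (F j u) t + A u t * h u (F j u) s) := by
  rw [coeffHH, he.apply_eq_sum (A u) (F j u), hA, hA, hA, ← he.repr_apply, ← he.repr_apply,
    ← he.repr_apply]
  simp [hs s (F j u)]

end CoefficientRelations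

/-! ### The stated relations as the vanishing of the coefficients. -/

section RelationsAtCenter

variable {N : Type*} [TopologicalSpace N] [ChartedSpace E3 N] [IsManifold 𝓘(ℝ, E3) ω N]
  {h : AnalyticMetric N} {o : ManifoldOrientation N} {A : OneForm N}

lemma formC_self (A : OneForm N) (q : N) (v : E3) :
    formC A q (extChartAt 𝓘(ℝ, E3) q q) v = A q v := by
  rw [formC_apply, frameMap_self]
  have : ∀ q' : N, q' = q → (show E3 →L[ℝ] ℝ from A q') v = (show E3 →L[ℝ] ℝ from A q) v := by
    rintro _ rfl; rfl
  exact this _ (extChartAt_to_inv q)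

lemma metricC_self (h : AnalyticMetric N) (q : N) (v w : E3) :
    metricC h q (extChartAt 𝓘(ℝ, E3) q q) v w = h.inner q v w := by
  rw [metricC_apply, frameMap_self, frameMap_self]
  have : ∀ q' : N, q' = q → (show E3 →L[ℝ] E3 →L[ℝ] ℝ from h.inner q') v w =
      (show E3 →L[ℝ] E3 →L[ℝ] ℝ from h.inner q) v w := by
    rintro _ rfl; rfl
  exact this _ (extChartAt_to_inv q)

lemma chartField_self (F : ∀ q : N, TN q) (q : N) :
    chartField 𝓘(ℝ, E3) F q (extChartAt 𝓘(ℝ, E3) q q) = F q := by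
  have h1 := frameMap_chartField F (mem_extChartAt_target (I := 𝓘(ℝ, E3)) q)
  rw [frameMap_self] at h1
  refine h1.trans ?_
  have : ∀ q' : N, q' = q → (show E3 from F q') = (show E3 from F q) := by
    rintro _ rfl; rfl
  exact this _ (extChartAt_to_inv q)

/-- Differentiability in the chart also yields the continuity of `f` at `q`, so that `mfderiv` is
not at its default value `0`. -/
lemma dirDeriv_eq_fderiv {f : N → ℝ} {q : N}
    (hf : DifferentiableAt ℝ (fun u ↦ f (symmC q u)) (extChartAt 𝓘(ℝ, E3) q q)) (v : TN q) :
    dirDeriv f q v = fderiv ℝ (fun u ↦ f (symmC q u)) (extChartAt 𝓘(ℝ, E3) q q) v := by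
  have hc : ContinuousAt f q := by
    have h1 : ContinuousAt (fun q' ↦ f (symmC q (extChartAt 𝓘(ℝ, E3) q q'))) q :=
      ContinuousAt.comp (g := fun u ↦ f (symmC q u)) hf.continuousAt (continuousAt_extChartAt q)
    refine h1.congr ?_
    filter_upwards [(isOpen_extChartAt_source (I := 𝓘(ℝ, E3)) q).mem_nhds (mem_extChartAt_source q)]
      with q' hq'
    rw [symmC, (extChartAt 𝓘(ℝ, E3) q).left_inv hq']
  have hm : MDifferentiableAt 𝓘(ℝ, E3) 𝓘(ℝ, ℝ) f q := by
    rw [mdifferentiableAt_iff]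
    exact ⟨hc, hf.differentiableWithinAt⟩
  rw [dirDeriv, hm.mfderiv]
  simp only [mfld_simps, fderivWithin_univ]
  rfl

/-- At the centre of a chart, the relations say that the coefficients of the soliton equations
vanish. -/
lemma laurentRelationsAt_iff (hA : IsBeltramiField h o A) {q : N} {e : Module.Basis (Fin 3) ℝ (TN q)}
    (he : IsAdaptedFrame h o A e) (a : ℝ) {f : ℤ → N → ℝ} {F : ℤ → ∀ p : N, TN p}
    {fC : ℤ → E3 → ℝ} {FC : ℤ → E3 → E3}
    (hfC : ∀ j, ContDiffAt ℝ 1 (fC j) (extChartAt 𝓘(ℝ, E3) q q))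
    (hf : ∀ j, (fun u ↦ f j (symmC q u)) =ᶠ[𝓝 (extChartAt 𝓘(ℝ, E3) q q)] fC j)
    (hF : ∀ j, chartField 𝓘(ℝ, E3) (F j) q =ᶠ[𝓝 (extChartAt 𝓘(ℝ, E3) q q)] FC j) :
    LaurentRelationsAt h A a f F q (formNorm h A q) (e 0) (e 1) (e 2)
      (fun j ↦ e.repr (F j q) 0) (fun j ↦ e.repr (F j q) 1) (fun j ↦ e.repr (F j q) 2) ↔
    (∀ j, coeffVV (formC A q) a fC FC j (extChartAt 𝓘(ℝ, E3) q q) = 0) ∧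
    (∀ j s, coeffHV (metricC h q) (formC A q) fC FC j (extChartAt 𝓘(ℝ, E3) q q) s = 0) ∧
    ∀ j s t, coeffHH (fun s t ↦ coordRicci (metricC h q) (extChartAt 𝓘(ℝ, E3) q q) s t) (metricC h q)
      (formC A q) a fC FC j (extChartAt 𝓘(ℝ, E3) q q) s t = 0 := by
  set u := extChartAt 𝓘(ℝ, E3) q q with hu
  let b : Module.Basis (Fin 3) ℝ E3 := e
  have hb : IsOrthonormalFor (metricC h q u) b := fun i j ↦
    (metricC_self h q _ _).trans (he.1.1 i j)
  have hbA : ∀ i, formC A q u (b i) = if 2 = i then formNorm h A q else 0 := fun i ↦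
    (formC_self A q _).trans (he.form_apply hA i)
  have hc := he.1.cyclicBasis
  have hcc := hc.cyclicBasis
  have hd : ∀ {e' : Module.Basis (Fin 3) ℝ (TN q)}, IsPositiveOrthonormal h o e' →
      coordExtDeriv (formC A q) u (e' 0) (e' 1) = -2 * formC A q u (e' 2) := fun {e'} he' ↦
    (hA.beltrami q e' he').trans (congrArg (-2 * ·) (formC_self A q (e' 2)).symm)
  have h01 : coordExtDeriv (formC A q) u (b 0) (b 1) = -2 * formC A q u (b 2) := hd he.1
  have h12 : coordExtDeriv (formC A q) u (b 1) (b 2) = -2 * formC A q u (b 0) := by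
    have := hd hc
    simp only [cyclicBasis_apply] at this
    exact this
  have h20 : coordExtDeriv (formC A q) u (b 2) (b 0) = -2 * formC A q u (b 1) := by
    have := hd hcc
    simp only [cyclicBasis_apply] at this
    exact this
  have hs := metricC_symm h q u
  have f0 : ∀ j, f j q = fC j u := fun j ↦ by
    have := (hf j).self_of_nhds
    dsimp only [symmC] at this
    rwa [hu, extChartAt_to_inv] at this
  have F0 : ∀ j, F j q = FC j u := fun j ↦ (chartField_self (F j) q).symm.trans (hF j).self_of_nhds
  have r0 : ∀ j i, e.repr (F j q) i = b.repr (FC j u) i := fun j i ↦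
    congrArg (fun v : E3 ↦ b.repr v i) (F0 j)
  have d0 : ∀ j (v : TN q), dirDeriv (f j) q v = fderiv ℝ (fC j) u v := fun j v ↦ by
    rw [dirDeriv_eq_fderiv (((hfC j).differentiableAt (by simp)).congr_of_eventuallyEq (hf j)),
      (hf j).fderiv_eq]
  have l0 : ∀ j (v w : E3), lieDeriv 𝓘(ℝ, E3) (F j) h.inner q v w =
      coordLie (FC j) (metricC h q) u v w := fun j v w ↦
    coordLie_congr (Filter.EventuallyEq.refl _ _) (hF j) v w
  have s0 : ∀ j (v w : E3), symProd h A q (F j q) v w = 1 / 2 *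
      (formC A q u v * metricC h q u (FC j u) w + formC A q u w * metricC h q u (FC j u) v) := by
    intro j v w
    rw [formC_self, formC_self, metricC_self, metricC_self, ← F0]
    rfl
  have m0 : ∀ v w : E3, h.inner q v w = metricC h q u v w := fun v w ↦ (metricC_self h q v w).symm
  have ric : ∀ v w : E3, ricci 𝓘(ℝ, E3) h.inner q v w = coordRicci (metricC h q) u v w :=
    fun _ _ ↦ rfl
  have HV := coeffHV_eq hb hs hbA h01 h12 h20 fC FC
  constructor
  · intro H
    refine ⟨fun j ↦ ?_, fun j ↦ (forall_coeffHV_iff (e := b) fC FC j).2 fun i ↦ ?_,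
      fun j s t ↦ ?_⟩
    -- The first two relations are the vertical coefficients; for `j = 2` the factor `j - 1` is `1`
    -- and the constant `a` appears.
    · rw [coeffVV_eq hb hbA]
      split_ifs with hj
      · subst hj
        have := H.rel₂
        rw [f0, r0] at this
        push_cast
        linear_combination this
      · have := H.rel₁ j hj
        rw [f0, r0] at this
        linear_combination this
    · fin_cases i
      · have := H.rel₃ j
        rw [d0, r0, r0] at this
        exact (HV j).1.trans this
      · have := H.rel₄ j
        rw [d0, r0, r0] at this
        exact (HV j).2.1.trans this
      · have := H.rel₅ j
        rw [d0, f0, r0] at this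
        exact (HV j).2.2.trans this
    · rw [coeffHH_eq hb hs hbA]
      -- The Ricci term has degree `0` in `ρ` and the constant `a` enters in degree `2`, which
      -- singles out the last two relations. For `j = 0` the product `A ⊙ F₀♭` is absent because its
      -- factor is `j`.
      by_cases hj : j = 0
      · subst hj
        have := H.rel₇ s t
        rw [f0, r0] at this
        erw [l0, m0, ric] at this
        simp
        linear_combination this
      by_cases hj2 : j = 2
      · subst hj2
        have := H.rel₈ s t
        rw [f0, r0] at this
        erw [l0, m0, s0] at this
        simp
        linear_combination this
      · have := H.rel₆ j hj hj2 s t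
        rw [f0, r0] at this
        erw [l0, m0, s0] at this
        rw [if_neg hj, if_neg hj2]
        linear_combination this
  · rintro ⟨H1, H2, H3⟩
    refine ⟨fun j hj ↦ ?_, ?_, fun j ↦ ?_, fun j ↦ ?_, fun j ↦ ?_, fun j hj hj2 (s t : E3) ↦ ?_,
      fun (s t : E3) ↦ ?_, fun (s t : E3) ↦ ?_⟩
    · have := H1 j
      rw [coeffVV_eq hb hbA, if_neg hj] at this
      rw [f0, r0]
      linear_combination this
    · have := H1 2
      rw [coeffVV_eq hb hbA, if_pos rfl] at this
      rw [f0, r0]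
      push_cast at this
      linear_combination this
    · rw [d0, r0, r0]
      exact (HV j).1.symm.trans (H2 j _)
    · rw [d0, r0, r0]
      exact (HV j).2.1.symm.trans (H2 j _)
    · rw [d0, f0, r0]
      exact (HV j).2.2.symm.trans (H2 j _)
    · have := H3 j s t
      rw [coeffHH_eq hb hs hbA, if_neg hj, if_neg hj2] at this
      rw [f0, r0]
      erw [l0, m0, s0]
      linear_combination this
    · have := H3 0 s t
      rw [coeffHH_eq hb hs hbA] at this
      rw [f0, r0]
      erw [l0, m0, ric]
      simp at this
      linear_combination this
    · have := H3 2 s t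
      rw [coeffHH_eq hb hs hbA] at this
      rw [f0, r0]
      erw [l0, m0, s0]
      simp at this
      linear_combination this

end RelationsAtCenter

end BeltramiSoliton

namespace BeltramiSoliton

/-! ### Existence and uniqueness of the expansions of the vertical and horizontal parts. -/

section Expansions

variable {N : Type*} [TopologicalSpace N] [ChartedSpace E3 N] [IsManifold 𝓘(ℝ, E3) ω N]
  {A : OneForm N} {E : ∀ x : N × ℝ, TM x} {r : ℝ} {q : N}

lemma sub_smul_eq_lift (B : E3 →L[ℝ] ℝ) (Y : E3 × ℝ) {ρ : ℝ} (hρ : ρ ≠ 0) :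
    Y - (ρ * Y.2 + B Y.1) • ((0 : E3), ρ⁻¹) = (Y.1, -(B Y.1) * ρ⁻¹) := by
  refine Prod.ext ?_ ?_
  · simp
  · simp only [Prod.snd_sub, Prod.smul_snd, smul_eq_mul]
    field_simp
    ring

/-- Subtracting `θ(E) V` does not change the projection to `N`, and a horizontal vector is the lift
of its projection. -/
lemma horizontalPart_eq (A : OneForm N) (E : ∀ x : N × ℝ, TM x) {x : N × ℝ} (hx : 0 < x.2) :
    horizontalPart A E x = horizontalLift A x (show E3 × ℝ from E x).1 := by
  have h1 : (show E3 × ℝ from horizontalPart A E x) = (show E3 × ℝ from E x) -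
      verticalPart A E x • ((0 : E3), x.2⁻¹) := rfl
  refine h1.trans ?_
  rw [verticalPart, theta_apply]
  exact sub_smul_eq_lift (A x.1) (E x) hx.ne'

lemma hasSum_lift_iff {ι : Type*} (B : E3 →L[ℝ] ℝ) {s : ℝ} {c : ι → ℝ} {v : ι → E3} {Y : E3} :
    HasSum (fun j ↦ c j • ((v j, -(B (v j)) * s) : E3 × ℝ)) (Y, -(B Y) * s) ↔
      HasSum (fun j ↦ c j • v j) Y := by
  constructor
  · intro H
    exact (ContinuousLinearMap.fst ℝ E3 ℝ).hasSum H
  · intro H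
    have h1 := ((ContinuousLinearMap.id ℝ E3).prod ((-s) • B)).hasSum H
    have hT : ∀ v : E3, ((v, -(B v) * s) : E3 × ℝ) =
        ((ContinuousLinearMap.id ℝ E3).prod ((-s) • B)) v := fun v ↦ by
      refine Prod.ext rfl ?_
      simp [mul_comm]
    rw [hT]
    refine h1.congr_fun fun j ↦ ?_
    rw [hT, map_smul]

lemma hasSum_horizontalLift_iff {ρ : ℝ} (hρ : 0 < ρ) (v : ℤ → TN q) :
    HasSum (fun j : ℤ ↦ ρ ^ j • horizontalLift A (q, ρ) (v j)) (horizontalPart A E (q, ρ)) ↔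
      HasSum (fun j : ℤ ↦ ρ ^ j • (show E3 from v j)) (show E3 × ℝ from E (q, ρ)).1 := by
  rw [horizontalPart_eq A E (x := (q, ρ)) hρ]
  exact hasSum_lift_iff (A q)

/-- The numbers `φ j` and the vectors `v j` are the Laurent coefficients of the vertical and of the
horizontal part of `E` above `q`. -/
def IsLaurentSumAt (A : OneForm N) (E : ∀ x : N × ℝ, TM x) (r ε : ℝ) (q : N) (φ : ℤ → ℝ) (v : ℤ → E3) :
    Prop :=
  ∀ ρ : ℝ, |ρ - r| < ε → HasSum (fun j : ℤ ↦ ρ ^ j * φ j) (verticalPart A E (q, ρ)) ∧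
    HasSum (fun j : ℤ ↦ ρ ^ j • v j) (show E3 × ℝ from E (q, ρ)).1

/-- Two expansions agree on the smaller interval; `eq_zero_of_hasSum_zpow` is applied to the
differences of the coefficients, component by component for vectors. -/
lemma IsLaurentSumAt.unique {ε ε' : ℝ} {φ φ' : ℤ → ℝ} {v v' : ℤ → E3} (hr : 0 < r) (hε : 0 < ε)
    (hε' : 0 < ε') (H : IsLaurentSumAt A E r ε q φ v) (H' : IsLaurentSumAt A E r ε' q φ' v') :
    φ = φ' ∧ v = v' := by
  have h0 : 0 < min ε ε' := lt_min hε hε'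
  constructor
  · ext j
    refine sub_eq_zero.1 (eq_zero_of_hasSum_zpow (c := fun j ↦ φ j - φ' j) hr h0 (fun t ht ↦ ?_) j)
    have := (H t (ht.trans_le (min_le_left _ _))).1.sub (H' t (ht.trans_le (min_le_right _ _))).1
    rw [sub_self] at this
    exact this.congr_fun fun j ↦ mul_sub _ _ _
  · ext j i
    refine sub_eq_zero.1 (eq_zero_of_hasSum_zpow (c := fun j ↦ v j i - v' j i) hr h0
      (fun t ht ↦ ?_) j)
    have := (EuclideanSpace.proj (𝕜 := ℝ) i).hasSum
      ((H t (ht.trans_le (min_le_left _ _))).2.sub (H' t (ht.trans_le (min_le_right _ _))).2)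
    rw [sub_self, map_zero] at this
    refine this.congr_fun fun j ↦ ?_
    simp
    ring

lemma isLaurentExpansion_iff (hr : 0 < r) {U : Set N} {f : ℤ → N → ℝ} {F : ℤ → ∀ p : N, TN p} :
    IsLaurentExpansion A E U r f F ↔ ∀ p ∈ U, ∃ ε > 0, ∀ᶠ q in 𝓝 p,
      IsLaurentSumAt A E r ε q (fun j ↦ f j q) (fun j ↦ F j q) := by
  constructor
  · intro H p hp
    obtain ⟨ε, hε, h1⟩ := H p hp
    -- The interval is cut at `r` to keep `ρ` positive, since `V` and horizontal lifts have their
    -- meaning only there.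
    refine ⟨min ε r, lt_min hε hr, h1.mono fun q hq ρ hρ ↦ ?_⟩
    have hρ0 : 0 < ρ := by
      have := hρ.trans_le (min_le_right _ _)
      rw [abs_lt] at this
      linarith
    obtain ⟨h2, h3⟩ := hq ρ (hρ.trans_le (min_le_left _ _))
    exact ⟨h2, (hasSum_horizontalLift_iff hρ0 _).1 h3⟩
  · intro H p hp
    obtain ⟨ε, hε, h1⟩ := H p hp
    refine ⟨min ε r, lt_min hε hr, h1.mono fun q hq ρ hρ ↦ ?_⟩
    have hρ0 : 0 < ρ := by
      have := hρ.trans_le (min_le_right _ _)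
      rw [abs_lt] at this
      linarith
    obtain ⟨h2, h3⟩ := hq ρ (hρ.trans_le (min_le_left _ _))
    exact ⟨h2, (hasSum_horizontalLift_iff hρ0 _).2 h3⟩

lemma HasLaurentExpansionAt.isLaurentSumAt {c : ℤ → E3 → E3 × ℝ} {δ : ℝ} {u : E3}
    (H : HasLaurentExpansionAt (chartField J E (q, r)) c r δ u) (hu : u ∈ targetC q) :
    IsLaurentSumAt A E r δ (symmC q u) (fun j ↦ verticalCoeff (formC A q) c j u)
      (fun j ↦ frameMap 𝓘(ℝ, E3) q u (baseCoeff c j u)) := by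
  intro ρ hρ
  have hw : ((u, ρ) : E3 × ℝ).1 ∈ targetC ((q, r) : N × ℝ).1 := hu
  have h1 := frameMap_chartField E ((mem_extChartAt_J_target (q, r) (u, ρ)).2 hw)
  have h2 := theta_frameMap (A := A) hw (chartField J E (q, r) (u, ρ))
  have h3 := frameMap_J (q, r) hw (chartField J E (q, r) (u, ρ))
  rw [h1, extChartAt_J_symm] at h2
  rw [h1, extChartAt_J_symm] at h3
  constructor
  · have := H.hasSum_vertical (A := formC A q) hρ
    rw [← h2] at this
    exact this
  · have h4 := ((frameMap 𝓘(ℝ, E3) q u).comp (ContinuousLinearMap.fst ℝ E3 ℝ)).hasSum (H.hasSum ρ hρ)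
    have h5 : (show E3 × ℝ from E (symmC q u, ρ)).1 = _ := congrArg Prod.fst h3
    rw [h5]
    refine h4.congr_fun fun j ↦ ?_
    rw [map_smul]
    rfl

/-- By uniqueness, any expansion coincides near `q` with the coefficients found in the chart. Hence
the regularity of the latter, and the equivalence with the soliton equation, hold for every
expansion. -/
lemma eventually_eq_coeff (hr : 0 < r) {c : ℤ → E3 → E3 × ℝ} {δ : ℝ}
    (H : ∀ᶠ u in 𝓝 (extChartAt 𝓘(ℝ, E3) q q), HasLaurentExpansionAt (chartField J E (q, r)) c r δ u)
    {f : ℤ → N → ℝ} {F : ℤ → ∀ p : N, TN p} {ε : ℝ} (hε : 0 < ε)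
    (hf : ∀ᶠ q' in 𝓝 q, IsLaurentSumAt A E r ε q' (fun j ↦ f j q') (fun j ↦ F j q')) (j : ℤ) :
    (fun u ↦ f j (symmC q u)) =ᶠ[𝓝 (extChartAt 𝓘(ℝ, E3) q q)] verticalCoeff (formC A q) c j ∧
    chartField 𝓘(ℝ, E3) (F j) q =ᶠ[𝓝 (extChartAt 𝓘(ℝ, E3) q q)] baseCoeff c j := by
  have h1 : Filter.Tendsto (symmC q) (𝓝 (extChartAt 𝓘(ℝ, E3) q q)) (𝓝 q) := by
    have := continuousAt_extChartAt_symm (I := 𝓘(ℝ, E3)) q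
    rwa [ContinuousAt, extChartAt_to_inv] at this
  have h2 : ∀ᶠ u in 𝓝 (extChartAt 𝓘(ℝ, E3) q q), u ∈ targetC q :=
    (isOpen_extChartAt_target q).mem_nhds (mem_extChartAt_target q)
  have h3 : ∀ᶠ u in 𝓝 (extChartAt 𝓘(ℝ, E3) q q),
      f j (symmC q u) = verticalCoeff (formC A q) c j u ∧
        chartField 𝓘(ℝ, E3) (F j) q u = baseCoeff c j u := by
    filter_upwards [H, h1.eventually hf, h2] with u hu hfu hut
    obtain ⟨h4, h5⟩ := hfu.unique hr hε hu.pos (hu.isLaurentSumAt hut)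
    refine ⟨congrFun h4 j, frameMap_injective hut ?_⟩
    rw [frameMap_chartField (F j) hut]
    exact congrFun h5 j
  exact ⟨h3.mono fun _ h ↦ h.1, h3.mono fun _ h ↦ h.2⟩

theorem exists_isLaurentExpansion (hE : ContMDiffOn J J.tangent ω
      (fun x ↦ (⟨x, E x⟩ : TangentBundle J (N × ℝ))) (cylinder Set.univ))
    {U : Set N} (hU : IsOpen U) (hr : 0 < r) (hC : ComplexifiesAlong E U r) (A : OneForm N) :
    ∃ (f : ℤ → N → ℝ) (F : ℤ → ∀ p : N, TN p), IsLaurentExpansion A E U r f F := by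
  have h1 : ∀ p ∈ U, ∃ δ, ∃ c : ℤ → E3 → E3 × ℝ, 0 < δ ∧ ∀ᶠ q in 𝓝 p,
      IsLaurentSumAt A E r δ q (fun j ↦ verticalCoeff (formC A p) c j (extChartAt 𝓘(ℝ, E3) p q))
      (fun j ↦ frameMap 𝓘(ℝ, E3) p (extChartAt 𝓘(ℝ, E3) p q) (baseCoeff c j (extChartAt 𝓘(ℝ, E3) p q))) := by
    intro p hp
    obtain ⟨δ, c, hc⟩ := exists_hasLaurentExpansionAt hE hr hC hp
    refine ⟨δ, c, hc.self_of_nhds.pos, ?_⟩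
    filter_upwards [(continuousAt_extChartAt (I := 𝓘(ℝ, E3)) p).eventually hc,
      (isOpen_extChartAt_source (I := 𝓘(ℝ, E3)) p).mem_nhds (mem_extChartAt_source p)] with q hq hqs
    have := hq.isLaurentSumAt (A := A) ((extChartAt 𝓘(ℝ, E3) p).map_source hqs)
    rwa [symmC, (extChartAt 𝓘(ℝ, E3) p).left_inv hqs] at this
  -- Coefficients are chosen at each point independently; uniqueness forces them to agree with the
  -- local families, so there is nothing to glue.
  have h2 : ∀ p : N, ∃ φv : (ℤ → ℝ) × (ℤ → E3), p ∈ U →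
      ∃ ε > 0, IsLaurentSumAt A E r ε p φv.1 φv.2 := by
    intro p
    by_cases hp : p ∈ U
    · obtain ⟨δ, c, hδ, hc⟩ := h1 p hp
      exact ⟨(_, _), fun _ ↦ ⟨δ, hδ, hc.self_of_nhds⟩⟩
    · exact ⟨0, fun h ↦ absurd h hp⟩
  choose φv hφv using h2
  refine ⟨fun j p ↦ (φv p).1 j, fun j p ↦ (φv p).2 j, (isLaurentExpansion_iff hr).2 fun p hp ↦ ?_⟩
  obtain ⟨δ, c, hδ, hc⟩ := h1 p hp
  refine ⟨δ, hδ, ?_⟩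
  filter_upwards [hc, hU.mem_nhds hp] with q hq hqU
  obtain ⟨ε, hε, h3⟩ := hφv q hqU
  obtain ⟨h4, h5⟩ := h3.unique hr hε hδ hq
  change IsLaurentSumAt A E r δ q (φv q).1 (φv q).2
  rw [h4, h5]
  exact hq

end Expansions

/-! ### Regularity of the coefficients, and equivalence of the soliton equation with the relations.
-/

section Relations

variable {N : Type*} [TopologicalSpace N] [ChartedSpace E3 N] [IsManifold 𝓘(ℝ, E3) ω N]
  {h : AnalyticMetric N} {o : ManifoldOrientation N} {A : OneForm N} {E : ∀ x : N × ℝ, TM x}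
  {U : Set N} {r : ℝ} {f : ℤ → N → ℝ} {F : ℤ → ∀ p : N, TN p}

lemma contDiffAt_verticalCoeff {n : WithTop ℕ∞} {B : E3 → E3 →L[ℝ] ℝ} {Y : E3 × ℝ → E3 × ℝ} {c : ℤ → E3 → E3 × ℝ} {δ : ℝ}
    {u : E3} (H : HasLaurentExpansionAt Y c r δ u) (hB : ContDiffAt ℝ n B u) (j : ℤ) :
    ContDiffAt ℝ n (verticalCoeff B c j) u :=
  ((H.contDiffAt (j - 1)).of_le le_top).snd.add (hB.clm_apply ((H.contDiffAt j).of_le le_top).fst)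

/-- The coefficients in a chart are analytic, and the `F j` are their base components. The `f j`
contain in addition the values of `A` on these, and are therefore only smooth. -/
lemma IsLaurentExpansion.contMDiffOn (hf : IsLaurentExpansion A E U r f F)
    (hA : OneForm.IsContMDiff ∞ A) (hE : ContMDiffOn J J.tangent ω
      (fun x ↦ (⟨x, E x⟩ : TangentBundle J (N × ℝ))) (cylinder Set.univ))
    (hr : 0 < r) (hC : ComplexifiesAlong E U r) (j : ℤ) :
    ContMDiffOn 𝓘(ℝ, E3) 𝓘(ℝ, ℝ) ∞ (f j) U ∧
    ContMDiffOn 𝓘(ℝ, E3) 𝓘(ℝ, E3).tangent ω (fun p ↦ (⟨p, F j p⟩ : TangentBundle 𝓘(ℝ, E3) N)) U := by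
  have key : ∀ p ∈ U, ContMDiffAt 𝓘(ℝ, E3) 𝓘(ℝ, ℝ) ∞ (f j) p ∧
      ContMDiffAt 𝓘(ℝ, E3) 𝓘(ℝ, E3).tangent ω (fun p ↦ (⟨p, F j p⟩ : TangentBundle 𝓘(ℝ, E3) N)) p := by
    intro p hp
    obtain ⟨δ, c, hc⟩ := exists_hasLaurentExpansionAt hE hr hC hp
    obtain ⟨ε, hε, h1⟩ := (isLaurentExpansion_iff hr).1 hf p hp
    obtain ⟨h2, h3⟩ := eventually_eq_coeff hr hc hε h1 j
    have h0 := hc.self_of_nhds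
    have hp0 := mem_extChartAt_target (I := 𝓘(ℝ, E3)) p
    constructor
    · have h4 := contMDiffAt_of_contDiffAt_symm (f := f j) hp0
        ((contDiffAt_verticalCoeff h0 (contDiffAt_formC hA hp0) j).congr_of_eventuallyEq h2)
      rwa [extChartAt_to_inv] at h4
    · exact contMDiffAt_of_contDiffAt_chartField ((h0.contDiffAt j).fst.congr_of_eventuallyEq h3)
  exact ⟨fun p hp ↦ (key p hp).1.contMDiffWithinAt, fun p hp ↦ (key p hp).2.contMDiffWithinAt⟩

/-- The soliton equation at the point `x`. -/
def IsSolitonAt (h : AnalyticMetric N) (A : OneForm N) (E : ∀ x : N × ℝ, TM x) (a : ℝ) (x : N × ℝ) :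
    Prop :=
  ∀ v w : TM x, ricci J (beltramiMetric h A) x v w + a * beltramiMetric h A x v w
    + (1 / 2) * lieDeriv J E (beltramiMetric h A) x v w = 0

/-- The soliton equation above a point amounts to the relations at this point. -/
lemma forall_isSolitonAt_iff (hA : IsBeltramiField h o A) (hE : ContMDiffOn J J.tangent ω
      (fun x ↦ (⟨x, E x⟩ : TangentBundle J (N × ℝ))) (cylinder Set.univ))
    (hr : 0 < r) (hC : ComplexifiesAlong E U r) (hf : IsLaurentExpansion A E U r f F) (a : ℝ) {q : N}
    (hq : q ∈ U) {e : Module.Basis (Fin 3) ℝ (TN q)} (he : IsAdaptedFrame h o A e) :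
    (∀ ρ, 0 < ρ → IsSolitonAt h A E a (q, ρ)) ↔
      LaurentRelationsAt h A a f F q (formNorm h A q) (e 0) (e 1) (e 2)
        (fun j ↦ e.repr (F j q) 0) (fun j ↦ e.repr (F j q) 1) (fun j ↦ e.repr (F j q) 2) := by
  obtain ⟨δ, c, hc⟩ := exists_hasLaurentExpansionAt hE hr hC hq
  obtain ⟨ε, hε, h1⟩ := (isLaurentExpansion_iff hr).1 hf q hq
  have h2 := eventually_eq_coeff hr hc hε h1
  have h0 := hc.self_of_nhds
  have hq0 := mem_extChartAt_target (I := 𝓘(ℝ, E3)) q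
  have hA1 : ContDiffAt ℝ 1 (formC A q) (extChartAt 𝓘(ℝ, E3) q q) :=
    (contDiffAt_formC hA.smooth hq0).of_le one_le_infty
  rw [laurentRelationsAt_iff hA he a (fun j ↦ contDiffAt_verticalCoeff h0 hA1 j)
    (fun j ↦ (h2 j).1) (fun j ↦ (h2 j).2),
    ← h0.soliton_iff_coeff (hA1.differentiableAt (by simp))]
  refine forall₂_congr fun ρ hρ ↦ ?_
  have h3 := soliton_at_iff hA hE a (x := (q, r)) (w := (extChartAt 𝓘(ℝ, E3) q q, ρ)) hq0 hρ
  have h4 : IsSolitonAt h A E a ((extChartAt J (q, r)).symm (extChartAt 𝓘(ℝ, E3) q q, ρ)) ↔ _ := h3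
  rw [extChartAt_J_symm, extChartAt_to_inv] at h4
  rw [h4]
  exact soliton_iff (w := (extChartAt 𝓘(ℝ, E3) q q, ρ))
    ((contDiffAt_metricC h hq0).of_le le_top) hA1 hρ.ne' (metricC_symm h q _)
    (h0.differentiableAt_field hρ) a
    (fun s t ↦ coordRicci (metricC h q) (extChartAt 𝓘(ℝ, E3) q q) s t)

lemma isSolitonFlowOn_cylinder_iff {a : ℝ} {S : Set N} :
    IsSolitonFlowOn J (beltramiMetric h A) E a (cylinder S) ↔
      ∀ q ∈ S, ∀ ρ, 0 < ρ → IsSolitonAt h A E a (q, ρ) :=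
  ⟨fun H q hq ρ hρ ↦ H (q, ρ) ⟨hq, hρ⟩, fun H x hx ↦ H x.1 hx.1 x.2 hx.2⟩

theorem isSolitonFlowOn_iff_laurentRelations (hA : IsBeltramiField h o A) (hE : ContMDiffOn J J.tangent ω
      (fun x ↦ (⟨x, E x⟩ : TangentBundle J (N × ℝ))) (cylinder Set.univ))
    (hr : 0 < r) (hC : ComplexifiesAlong E U r) (hf : IsLaurentExpansion A E U r f F) (a : ℝ) :
    IsSolitonFlowOn J (beltramiMetric h A) E a (cylinder U) ↔ LaurentRelations h o A a f F U := by
  rw [isSolitonFlowOn_cylinder_iff]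
  constructor
  · intro H p hp e he
    exact (forall_isSolitonAt_iff hA hE hr hC hf a hp he).1 (H p hp)
  · intro H p hp
    -- The relations quantify over adapted frames; existence of one keeps them from being vacuous.
    obtain ⟨e, he⟩ := exists_isAdaptedFrame hA p
    exact (forall_isSolitonAt_iff hA hE hr hC hf a hp he).2 (H p hp e he)

end Relations

end BeltramiSoliton

namespace BeltramiSoliton

/-! ### Analyticity of the coordinate Ricci tensor and Lie derivative. -/

section CoordinateRegularity

variable {W : Type*} [NormedAddCommGroup W] [NormedSpace ℝ W] {G : W → W →L[ℝ] W →L[ℝ] ℝ} {u : W}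

lemma contDiffAt_coordLie {E : W → W} (hG : ContDiffAt ℝ ω G u) (hE : ContDiffAt ℝ ω E u) (v w : W) :
    ContDiffAt ℝ ω (fun u ↦ coordLie E G u v w) u := by
  have hG' : ContDiffAt ℝ ω (fderiv ℝ G) u := hG.fderiv_right (m := ω) (by simp)
  have hE' : ContDiffAt ℝ ω (fderiv ℝ E) u := hE.fderiv_right (m := ω) (by simp)
  unfold coordLie
  exact (((hG'.clm_apply hE).clm_apply contDiffAt_const).clm_apply contDiffAt_const).add
    ((hG.clm_apply (hE'.clm_apply contDiffAt_const)).clm_apply contDiffAt_const) |>.add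
    ((hG.clm_apply contDiffAt_const).clm_apply (hE'.clm_apply contDiffAt_const))

variable [FiniteDimensional ℝ W]

lemma contDiffAt_christoffel (hG : ContDiffAt ℝ ω G u) (hi : (G u).IsInvertible) {X Y : W → W}
    (hX : ContDiffAt ℝ ω X u) (hY : ContDiffAt ℝ ω Y u) :
    ContDiffAt ℝ ω (fun u ↦ christoffel G u (X u) (Y u)) u := by
  have h1 : ContDiffAt ℝ ω (christoffelL G) u := contDiffAt_christoffelL (by simp) hG hi
  simp only [← christoffelL_apply]
  exact (h1.clm_apply hX).clm_apply hY

lemma contDiffAt_coordRicci (hG : ContDiffAt ℝ ω G u) (hi : (G u).IsInvertible) (v w : W) :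
    ContDiffAt ℝ ω (fun u ↦ coordRicci G u v w) u := by
  have h0 : ∀ v : W, ContDiffAt ℝ ω (fun _ : W ↦ v) u := fun v ↦ contDiffAt_const
  have hd : ∀ v w z : W, ContDiffAt ℝ ω (fun u ↦ fderiv ℝ (fun u' ↦ christoffel G u' v w) u z) u :=
    fun v w z ↦ ((contDiffAt_christoffel hG hi (h0 v) (h0 w)).fderiv_right (m := ω)
      (by simp)).clm_apply contDiffAt_const
  have hc : ∀ z : W, ContDiffAt ℝ ω (fun u ↦ curvature G u z v w) u := by
    intro z
    unfold curvature
    exact (((hd _ _ _).sub (hd _ _ _)).add (contDiffAt_christoffel hG hi (h0 _)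
      (contDiffAt_christoffel hG hi (h0 _) (h0 _)))).sub (contDiffAt_christoffel hG hi (h0 _)
      (contDiffAt_christoffel hG hi (h0 _) (h0 _)))
  unfold coordRicci
  refine ContDiffAt.sum fun i _ ↦ ?_
  exact (LinearMap.toContinuousLinearMap ((Module.finBasis ℝ W).coord i)).contDiff.contDiffAt.comp u
    (hc _)

end CoordinateRegularity

/-! ### Propagation of the soliton equation over connected components. -/

section UniqueContinuation

variable {N : Type*} [TopologicalSpace N] [ChartedSpace E3 N] [IsManifold 𝓘(ℝ, E3) ω N]
  {h : AnalyticMetric N} {o : ManifoldOrientation N} {A : OneForm N} {E : ∀ x : N × ℝ, TM x}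

/-- If the soliton equation holds above a non-empty open subset of a ball in a chart, it holds above
this ball. -/
lemma isSolitonAt_of_eventually (hA : IsBeltramiField h o A) (hAω : OneForm.IsContMDiff ω A)
    (hE : ContMDiffOn J J.tangent ω
      (fun x ↦ (⟨x, E x⟩ : TangentBundle J (N × ℝ))) (cylinder Set.univ))
    {a : ℝ} {p : N} {B : Set E3} (hB : Convex ℝ B) (hBt : B ⊆ targetC p) {u₁ : E3} (hu₁ : u₁ ∈ B)
    (H : ∀ᶠ u in 𝓝 u₁, ∀ ρ, 0 < ρ → IsSolitonAt h A E a (symmC p u, ρ)) {u : E3} (hu : u ∈ B)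
    {ρ : ℝ} (hρ : 0 < ρ) : IsSolitonAt h A E a (symmC p u, ρ) := by
  -- The components of the soliton tensor, analytic on the connected set `B × (0, ∞)` because `A` is
  -- now analytic; they vanish near `(u₁, 1)`.
  let T : E3 × ℝ → E3 × ℝ → E3 × ℝ → ℝ := fun v v' w ↦
    coordRicci (metricC h p) w.1 v.1 v'.1 - 2 * metricC h p w.1 v.1 v'.1
      + a * liftMetric (metricC h p) (formC A p) w v v'
      + (1 / 2) * coordLie (chartField J E (p, 1)) (liftMetric (metricC h p) (formC A p)) w v v'
  have hiff : ∀ w : E3 × ℝ, w.1 ∈ targetC p → 0 < w.2 →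
      (IsSolitonAt h A E a (symmC p w.1, w.2) ↔ ∀ v v', T v v' w = 0) := fun w hw hw2 ↦ by
    have h3 := soliton_at_iff hA hE a (x := (p, 1)) (w := w) hw hw2
    rw [extChartAt_J_symm] at h3
    exact h3
  refine (hiff (u, ρ) (hBt hu) hρ).2 fun v v' ↦ ?_
  have hT : AnalyticOnNhd ℝ (T v v') (B ×ˢ Set.Ioi 0) := by
    intro w hw
    have hw1 : w.1 ∈ targetC p := hBt hw.1
    have hw2 : 0 < w.2 := hw.2
    have c1 := contDiffAt_metricC h hw1
    have c2 := contDiffAt_formC hAω hw1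
    have c3 : ContDiffAt ℝ ω (liftMetric (metricC h p) (formC A p)) w :=
      contDiffAt_liftMetric c1 c2 hw2.ne'
    have c4 : ContDiffAt ℝ ω (fun w : E3 × ℝ ↦ coordRicci (metricC h p) w.1 v.1 v'.1) w :=
      ContDiffAt.comp (g := fun u ↦ coordRicci (metricC h p) u v.1 v'.1) w
        (contDiffAt_coordRicci c1 (isInvertible_metricC h hw1) v.1 v'.1) contDiffAt_fst
    have c5 : ContDiffAt ℝ ω (fun w : E3 × ℝ ↦ metricC h p w.1 v.1 v'.1) w :=
      ((ContDiffAt.comp (g := metricC h p) w c1 contDiffAt_fst).clm_apply contDiffAt_const).clm_apply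
        contDiffAt_const
    have c6 : ContDiffAt ℝ ω (chartField J E (p, 1)) w :=
      contDiffAt_fieldC hE (x := (p, 1)) hw1 hw2
    have c7 : ContDiffAt ℝ ω (T v v') w :=
      ((c4.sub (contDiffAt_const.mul c5)).add (contDiffAt_const.mul
      ((c3.clm_apply contDiffAt_const).clm_apply contDiffAt_const))).add
      (contDiffAt_const.mul (contDiffAt_coordLie c3 c6 v v'))
    exact c7.analyticAt
  refine hT.eqOn_zero_of_preconnected_of_eventuallyEq_zero (z₀ := (u₁, 1))
    (hB.isPreconnected.prod isPreconnected_Ioi) ⟨hu₁, Set.mem_Ioi.2 one_pos⟩ ?_ (x := (u, ρ)) ⟨hu, hρ⟩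
  have h1 : ∀ᶠ u in 𝓝 u₁, u ∈ targetC p := (isOpen_extChartAt_target p).mem_nhds (hBt hu₁)
  have h2 : ∀ᶠ w in 𝓝 (u₁, (1 : ℝ)), 0 < w.2 :=
    continuousAt_snd.eventually (Ioi_mem_nhds (one_pos : (0 : ℝ) < 1))
  have h3 : ∀ᶠ w in 𝓝 (u₁, (1 : ℝ)), w.1 ∈ targetC p ∧
      ∀ ρ, 0 < ρ → IsSolitonAt h A E a (symmC p w.1, ρ) :=
    (continuousAt_fst (p := (u₁, (1 : ℝ)))).eventually (h1.and H)
  filter_upwards [h2, h3] with w hw2 hw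
  exact (hiff w hw.1 hw2).1 (hw.2 _ hw2) v v'

/-- The set of points around which the equation holds is clopen and contains `U`, so it contains
every component that `U` meets. -/
theorem forall_isSolitonAt_of_connectedComponent (hA : IsBeltramiField h o A)
    (hAω : OneForm.IsContMDiff ω A) (hE : ContMDiffOn J J.tangent ω
      (fun x ↦ (⟨x, E x⟩ : TangentBundle J (N × ℝ))) (cylinder Set.univ))
    {a : ℝ} {U : Set N} (hU : IsOpen U) (hmeet : ∀ p : N, (connectedComponent p ∩ U).Nonempty)
    (H : ∀ q ∈ U, ∀ ρ, 0 < ρ → IsSolitonAt h A E a (q, ρ)) (p : N) {ρ : ℝ} (hρ : 0 < ρ) :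
    IsSolitonAt h A E a (p, ρ) := by
  let S : Set N := {p | ∀ᶠ q in 𝓝 p, ∀ ρ, 0 < ρ → IsSolitonAt h A E a (q, ρ)}
  have hUS : U ⊆ S := fun q hq ↦ Filter.mem_of_superset (hU.mem_nhds hq) H
  have hopen : IsOpen S := isOpen_iff_mem_nhds.2 fun p hp ↦ eventually_eventually_nhds.2 hp
  have hclosed : IsClosed S := by
    refine isClosed_of_closure_subset fun p hp ↦ ?_
    -- For closedness, a coordinate ball about a limit point `p` contains a point `q` of `S`; the
    -- identity theorem propagates the equation from a neighbourhood of `q` to the ball.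
    obtain ⟨ε, hε, hball⟩ := Metric.isOpen_iff.1 (isOpen_extChartAt_target (I := 𝓘(ℝ, E3)) p) _
      (mem_extChartAt_target p)
    have h1 : ∀ᶠ q in 𝓝 p, q ∈ (extChartAt 𝓘(ℝ, E3) p).source ∧
        extChartAt 𝓘(ℝ, E3) p q ∈ Metric.ball (extChartAt 𝓘(ℝ, E3) p p) ε :=
      Filter.Eventually.and
        ((isOpen_extChartAt_source (I := 𝓘(ℝ, E3)) p).mem_nhds (mem_extChartAt_source p))
        ((continuousAt_extChartAt (I := 𝓘(ℝ, E3)) p).eventually (Metric.ball_mem_nhds _ hε))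
    obtain ⟨q, hqS, hqs, hqb⟩ := ((mem_closure_iff_frequently.1 hp).and_eventually h1).exists
    have h2 : ∀ᶠ u in 𝓝 (extChartAt 𝓘(ℝ, E3) p q), ∀ ρ, 0 < ρ →
        IsSolitonAt h A E a (symmC p u, ρ) := by
      have h3 := continuousAt_extChartAt_symm' (I := 𝓘(ℝ, E3)) hqs
      rw [ContinuousAt, (extChartAt 𝓘(ℝ, E3) p).left_inv hqs] at h3
      exact h3.eventually hqS
    refine h1.mono fun q' hq' ρ hρ ↦ ?_
    have := isSolitonAt_of_eventually hA hAω hE (convex_ball _ ε) hball hqb h2 hq'.2 hρ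
    rwa [symmC, (extChartAt 𝓘(ℝ, E3) p).left_inv hq'.1] at this
  obtain ⟨q, hq, hqU⟩ := hmeet p
  have h3 : connectedComponent q ⊆ S :=
    IsClopen.connectedComponent_subset ⟨hclosed, hopen⟩ (hUS hqU)
  rw [← connectedComponent_eq hq] at h3
  exact (h3 mem_connectedComponent : p ∈ S).self_of_nhds ρ hρ

end UniqueContinuation

end BeltramiSoliton

end


/-! ### The main theorem. -/

theorem corollary5p3 {N : Type*} [TopologicalSpace N] [ChartedSpace BeltramiSoliton.E3 N]
    [IsManifold 𝓘(ℝ, BeltramiSoliton.E3) ω N]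
    (h : BeltramiSoliton.AnalyticMetric N) (o : BeltramiSoliton.ManifoldOrientation N)
    (A : BeltramiSoliton.OneForm N) (hA : BeltramiSoliton.IsBeltramiField h o A)
    (E : ∀ x : N × ℝ, BeltramiSoliton.TM x)
    (hE : ContMDiffOn BeltramiSoliton.J BeltramiSoliton.J.tangent ω
      (fun x ↦ (⟨x, E x⟩ : TangentBundle BeltramiSoliton.J (N × ℝ)))
      (BeltramiSoliton.cylinder Set.univ))
    (U : Set N) (hU : IsOpen U) (r : ℝ) (hr : 0 < r)
    (hC : BeltramiSoliton.ComplexifiesAlong E U r) :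
    (∃ (f : ℤ → N → ℝ) (F : ℤ → ∀ p : N, BeltramiSoliton.TN p),
      BeltramiSoliton.IsLaurentExpansion A E U r f F ∧
      (∀ j, ContMDiffOn 𝓘(ℝ, BeltramiSoliton.E3) 𝓘(ℝ, ℝ) ∞ (f j) U) ∧
      (∀ j, ContMDiffOn 𝓘(ℝ, BeltramiSoliton.E3) 𝓘(ℝ, BeltramiSoliton.E3).tangent ω
        (fun p ↦ (⟨p, F j p⟩ : TangentBundle 𝓘(ℝ, BeltramiSoliton.E3) N)) U)) ∧
    ∀ (f : ℤ → N → ℝ) (F : ℤ → ∀ p : N, BeltramiSoliton.TN p),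
      BeltramiSoliton.IsLaurentExpansion A E U r f F → ∀ a : ℝ,
        (BeltramiSoliton.IsSolitonFlowOn BeltramiSoliton.J (BeltramiSoliton.beltramiMetric h A) E a
            (BeltramiSoliton.cylinder U) ↔
          BeltramiSoliton.LaurentRelations h o A a f F U) ∧
        (BeltramiSoliton.OneForm.IsContMDiff ω A →
          (∀ p : N, (connectedComponent p ∩ U).Nonempty) →
          (BeltramiSoliton.IsSolitonFlowOn BeltramiSoliton.J (BeltramiSoliton.beltramiMetric h A)
              E a (BeltramiSoliton.cylinder Set.univ) ↔
            BeltramiSoliton.LaurentRelations h o A a f F U)) := by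
  refine ⟨?_, fun f F hf a ↦ ⟨?_, fun hAω hmeet ↦ ?_⟩⟩
  · obtain ⟨f, F, hf⟩ := BeltramiSoliton.exists_isLaurentExpansion hE hU hr hC A
    exact ⟨f, F, hf, fun j ↦ (hf.contMDiffOn hA.smooth hE hr hC j).1,
      fun j ↦ (hf.contMDiffOn hA.smooth hE hr hC j).2⟩
  · exact BeltramiSoliton.isSolitonFlowOn_iff_laurentRelations hA hE hr hC hf a
  · rw [← BeltramiSoliton.isSolitonFlowOn_iff_laurentRelations hA hE hr hC hf a,
      BeltramiSoliton.isSolitonFlowOn_cylinder_iff, BeltramiSoliton.isSolitonFlowOn_cylinder_iff]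
    -- Given the equivalence on `U`, only unique continuation from `U × (0, ∞)` to `M` remains.
    exact ⟨fun H q _ ↦ H q (Set.mem_univ q), fun H q _ ρ hρ ↦
      BeltramiSoliton.forall_isSolitonAt_of_connectedComponent hA hAω hE hU hmeet H q hρ⟩
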